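/- Let $f\in C^2(\mathbb R)$, $F(u)=\int_0^u f$, and $V(u;a,c)=F(u)-au-\tfrac c2u^2$. Fix $(a_0,E_0,c_0)\in\mathbb R^3$ and assume that there are simple roots $u_-<u_+$ of the equation $V(\cdot\,;a_0,c_0)=E_0$ with $V(\cdot\,;a_0,c_0)<E_0$ on $(u_-,u_+)$. Let $u_0=u(\cdot\,;a_0,E_0,c_0)$ be the corresponding periodic traveling wave profile of $u_t=u_{xxx}+f(u)_x$ (for waves depending on $x+c_0t$): $u_0''+f(u_0)-c_0u_0=a_0$, $\tfrac12(u_0')^2=E_0-V(u_0;a_0,c_0)$, $u_0(0)=u_-$. For $(a,E,c)$ near $(a_0,E_0,c_0)$ let $u_\pm=u_\pm(a,E,c)$ be the corresponding roots of $V(\cdot\,;a,c)=E$ near those above, and put $$T=\sqrt2\int_{u_-}^{u_+}\frac{du}{\sqrt{E-V}},\qquad M=\sqrt2\int_{u_-}^{u_+}\frac{u\,du}{\sqrt{E-V}},\qquad P=\sqrt2\int_{u_-}^{u_+}\frac{u^2\,du}{\sqrt{E-V}}$$ (period, mass $\int_0^Tu\,dx$ and momentum $\int_0^Tu^2\,dx$),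 and $\omega=1/T$. Assume that $\{T,M,P\}_{a,E,c}=\det\frac{\partial(T,M,P)}{\partial(a,E,c)}\ne0$ at $(a_0,E_0,c_0)$. Put $c=c_0-s$ and consider $M,P,\omega$ as functions of $(a,E,s)$ near $(a_0,E_0,0)$. Let $$A=\left(\frac{\partial(a-sM\omega,\,-sP\omega-2E,\,-s\omega)}{\partial(a,E,s)}\right)^{-1}\frac{\partial(M\omega,P\omega,\omega)}{\partial(a,E,s)}\quad\text{at }(a_0,E_0,0),$$ where the functions are differentiable and the inverse exists. Let $\partial_x\mathcal L[u_0]$, with $\mathcal L[u_0]=-\partial_x^2-f'(u_0)+c_0$, be the linearized operator on $L^2(\mathbb R)$, and call $u_0$ spectrally stable if the $L^2$ spectrum of $\partial_x\mathcal L[u_0]$ lies on the imaginary axis. Then: 1. If $u_0$ is spectrally stable, then the spectrum of the $3\times3$ matrix $A$ is real. 2. The spectrum of $A$ is real if and only if the Whitham system $$\partial_t(M\omega,P\omega,\omega)-\partial_x(a-sM\omega,\,-sP\omega-2E,\,-s\omega)=0$$ is hyperbolic at $(a_0,E_0,0)$, in the sense that the system linearized there is of evolutionary type (the Jacobian of the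 densities is invertible) and its characteristic equation $\det\left(\frac{\partial(M\omega,P\omega,\omega)}{\partial(a,E,s)}-z\,\frac{\partial(a-sM\omega,-sP\omega-2E,-s\omega)}{\partial(a,E,s)}\right)=0$ has three real roots $z$, counted with multiplicity. 3. If $\eta$ is a non-real eigenvalue of $A$, then there is a continuous branch $\mu(\kappa)$, $|\kappa|<\delta$, of $L^2$ spectrum of $\partial_x\mathcal L[u_0]$ such that $\partial_x\mathcal L[u_0]v=\mu(\kappa)v$ has a nontrivial solution with $v(x+T)=e^{i\kappa}v(x)$, where $T=T(a_0,E_0,c_0)$, such that $$\mu(\kappa)=-\frac{i\kappa}{\eta T}+O(\kappa^2)\qquad(\kappa\to0),$$ and such that $\mu(\kappa)$ is off the imaginary axis for $0<|\kappa|<\delta$. -/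

import Mathlib

open MeasureTheory Filter Topology Asymptotics

noncomputable section

namespace GKdV

/-! ### Periodic profiles of `u_t = u_xxx + f(u)_x` and their period, mass and momentum -/

/-- The effective potential `V(u; a, c) = F(u) - a u - (c/2) u²`, with `F' = f`, `F(0) = 0`. -/
def potential (f : ℝ → ℝ) (a c : ℝ) (u : ℝ) : ℝ :=
  (∫ y in (0 : ℝ)..u, f y) - a * u - c / 2 * u ^ 2

/-- `u₋ < u₊` are simple roots of `V(·; a, c) = E` and `V(·; a, c) < E` between them. -/
structure IsWell (f : ℝ → ℝ) (a E c um up : ℝ) : Prop where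
  lt : um < up
  left_root : potential f a c um = E
  right_root : potential f a c up = E
  left_simple : deriv (potential f a c) um ≠ 0
  right_simple : deriv (potential f a c) up ≠ 0
  below : ∀ v ∈ Set.Ioo um up, potential f a c v < E

/-- `u = u(·; a, E, c)`: a solution of the travelling wave equation `u''' + f(u)' - c u' = 0`,
integrated once with constant `a` and twice with constant `E`, normalised by `u(0) = u₋`. -/
structure IsProfile (f : ℝ → ℝ) (a E c um : ℝ) (u : ℝ → ℝ) : Prop where
  contDiff : ContDiff ℝ 2 u
  first_integral : ∀ x, deriv (deriv u) x + f (u x) - c * u x = a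
  second_integral : ∀ x, deriv u x ^ 2 / 2 = E - potential f a c (u x)
  initial : u 0 = um

/-- The turning point `u₋(a, E, c)` of the well that contains `m`: the first point to the left of
`m` where `V = E`. -/
def leftTurn (f : ℝ → ℝ) (m a E c : ℝ) : ℝ :=
  sSup {v | v ≤ m ∧ E ≤ potential f a c v}

/-- The turning point `u₊(a, E, c)` of the well that contains `m`: the first point to the right of
`m` where `V = E`. -/
def rightTurn (f : ℝ → ℝ) (m a E c : ℝ) : ℝ :=
  sInf {v | m ≤ v ∧ E ≤ potential f a c v}

/-- `∫₀ᵀ u(x)ᵏ dx = √2 ∫_{u₋}^{u₊} uᵏ / √(E - V(u; a, c)) du`. -/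
def moment (f : ℝ → ℝ) (m : ℝ) (k : ℕ) (a E c : ℝ) : ℝ :=
  √2 * ∫ v in (leftTurn f m a E c)..(rightTurn f m a E c),
    v ^ k / √(E - potential f a c v)

/-- The period `T(a, E, c)`. -/
def period (f : ℝ → ℝ) (m a E c : ℝ) : ℝ := moment f m 0 a E c

/-- The mass `M(a, E, c)`. -/
def mass (f : ℝ → ℝ) (m a E c : ℝ) : ℝ := moment f m 1 a E c

/-- The momentum `P(a, E, c)`. -/
def momentum (f : ℝ → ℝ) (m a E c : ℝ) : ℝ := moment f m 2 a E c

/-- The map `(a, E, c) ↦ (T, M, P)`. -/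
def tmp (f : ℝ → ℝ) (m : ℝ) (p : Fin 3 → ℝ) : Fin 3 → ℝ :=
  ![period f m (p 0) (p 1) (p 2), mass f m (p 0) (p 1) (p 2), momentum f m (p 0) (p 1) (p 2)]

/-- The Jacobian matrix of a map of `ℝ³`. -/
def jacobian (Φ : (Fin 3 → ℝ) → Fin 3 → ℝ) (w : Fin 3 → ℝ) : Matrix (Fin 3) (Fin 3) ℝ :=
  LinearMap.toMatrix' (fderiv ℝ Φ w : (Fin 3 → ℝ) →ₗ[ℝ] Fin 3 → ℝ)

/-! ### The Whitham system `∂ₜ (Mω, Pω, ω) - ∂ₓ (a - sMω, -sPω - 2E, -sω) = 0` -/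

/-- `ω = 1/T` in the variables `w = (a, E, s)`, where `c = c₀ - s`. -/
def waveNumber (f : ℝ → ℝ) (m c₀ : ℝ) (w : Fin 3 → ℝ) : ℝ :=
  (period f m (w 0) (w 1) (c₀ - w 2))⁻¹

/-- The densities `(Mω, Pω, ω)(a, E, s)`. -/
def whithamDensity (f : ℝ → ℝ) (m c₀ : ℝ) (w : Fin 3 → ℝ) : Fin 3 → ℝ :=
  ![mass f m (w 0) (w 1) (c₀ - w 2) * waveNumber f m c₀ w,
    momentum f m (w 0) (w 1) (c₀ - w 2) * waveNumber f m c₀ w,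
    waveNumber f m c₀ w]

/-- The fluxes `(a - sMω, -sPω - 2E, -sω)(a, E, s)`. -/
def whithamFlux (f : ℝ → ℝ) (m c₀ : ℝ) (w : Fin 3 → ℝ) : Fin 3 → ℝ :=
  ![w 0 - w 2 * (mass f m (w 0) (w 1) (c₀ - w 2) * waveNumber f m c₀ w),
    -(w 2 * (momentum f m (w 0) (w 1) (c₀ - w 2) * waveNumber f m c₀ w)) - 2 * w 1,
    -(w 2 * waveNumber f m c₀ w)]

/-- `A = (∂ flux / ∂(a, E, s))⁻¹ (∂ density / ∂(a, E, s))`. -/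
def whithamMatrix (f : ℝ → ℝ) (m c₀ : ℝ) (w : Fin 3 → ℝ) : Matrix (Fin 3) (Fin 3) ℝ :=
  (jacobian (whithamFlux f m c₀) w)⁻¹ * jacobian (whithamDensity f m c₀) w

/-- The characteristic polynomial `det (DU - z DG)` at the state `w` of a system
`∂ₜ U(w) - ∂ₓ G(w) = 0`. -/
def charPoly (U G : (Fin 3 → ℝ) → Fin 3 → ℝ) (w : Fin 3 → ℝ) : Polynomial ℝ :=
  ((jacobian U w).map (algebraMap ℝ (Polynomial ℝ)) -
    (Polynomial.X : Polynomial ℝ) • (jacobian G w).map (algebraMap ℝ (Polynomial ℝ))).det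

/-- The system `∂ₜ U(w) - ∂ₓ G(w) = 0` of three conservation laws is hyperbolic at the state `w`:
the system linearized there is of evolutionary type, and its characteristic equation has three
real roots, counted with multiplicity. -/
def IsHyperbolicAt (U G : (Fin 3 → ℝ) → Fin 3 → ℝ) (w : Fin 3 → ℝ) : Prop :=
  (jacobian U w).det ≠ 0 ∧ Multiset.card (charPoly U G w).roots = 3

/-! ### The linearized operator `∂ₓ 𝓛[u]` on `L²(ℝ)` -/

/-- The space `L²(ℝ; ℂ)`. -/
abbrev L2 : Type := Lp ℂ 2 (volume : Measure ℝ)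

/-- `g ∈ L²` is the distributional derivative of `v ∈ L²`. -/
def IsWeakDeriv (v g : L2) : Prop :=
  TemperedDistribution.derivCLM ℂ (Lp.toTemperedDistribution v) = Lp.toTemperedDistribution g

/-- `v ∈ H²(ℝ)` and `𝓛[u] v = -v'' - f'(u) v + c v` equals `l`. -/
def IsHill (f u : ℝ → ℝ) (c : ℝ) (v l : L2) : Prop :=
  ∃ v₁ v₂ : L2, IsWeakDeriv v v₁ ∧ IsWeakDeriv v₁ v₂ ∧
    ∀ᵐ x, l x = -v₂ x - ((deriv f (u x) : ℝ) : ℂ) * v x + (c : ℂ) * v x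

/-- The graph of the unbounded operator `∂ₓ 𝓛[u]` on `L²(ℝ)`: `v` is in its domain (`v ∈ H²` and
`𝓛[u] v ∈ H¹`) and is mapped to `w`. -/
def IsLinearized (f u : ℝ → ℝ) (c : ℝ) (v w : L2) : Prop :=
  ∃ l : L2, IsHill f u c v l ∧ IsWeakDeriv l w

/-- The `L²` spectrum of `∂ₓ 𝓛[u]`: all `μ ∈ ℂ` for which `∂ₓ 𝓛[u] - μ` has no everywhere defined
bounded inverse `R`. -/
def linSpectrum (f u : ℝ → ℝ) (c : ℝ) : Set ℂ :=
  {μ | ¬ ∃ R : L2 →L[ℂ] L2, ∀ v h : L2, IsLinearized f u c v (h + μ • v) ↔ v = R h}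

/-- Spectral stability: the spectrum lies on the imaginary axis. -/
def IsSpectrallyStable (f u : ℝ → ℝ) (c : ℝ) : Prop :=
  ∀ μ ∈ linSpectrum f u c, μ.re = 0

/-- `v` is a nontrivial classical solution of `∂ₓ 𝓛[u] v = μ v` with
`v(x + T) = exp(iκ) v(x)`. -/
structure IsFloquetSolution (f u : ℝ → ℝ) (c T : ℝ) (μ : ℂ) (κ : ℝ) (v : ℝ → ℂ) : Prop where
  ne_zero : v ≠ 0
  contDiff : ContDiff ℝ 3 v
  floquet : ∀ x, v (x + T) = Complex.exp (Complex.I * κ) * v x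
  eigen : ∀ x, deriv (fun y => -deriv (deriv v) y - ((deriv f (u y) : ℝ) : ℂ) * v y + (c : ℂ) * v y) x
    = μ * v x

end GKdV

end

noncomputable section

namespace GKdV

/-! ### Linear differential equations with bounded coefficients -/

/-! Put `ζ = exp (iκ) - 1` and look for eigenvalues of the form `μ = ζ ν`. An eigenfunction is
sought as `e₂ u' + μ v` with `𝓛[u] v = -e₀ + e₂ u + μ m`, `m' = v`; the third parameter `e₁` sits in
`v 0`. A first integral (`IsModulation.conservation`) turns the Floquet condition over one period
into a linear system `(ν N(ζν) - C) e = 0`. Its determinant `G(ζ, ν)` is C¹ because solutions of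
linear equations depend smoothly on `μ` (`exists_linear_ode_solution`).

At `ζ = 0` the function `v` is the variation of the wave in the direction `(e₀, e₁, -e₂)` of `(a, E,
c)`. Hence the increments of `∫ v`, `∫ u v` and `v'` over a period are combinations of derivatives
of `T`, `M`, `P`, and `G(0, ν)` is a nonzero multiple of the real cubic `modDet J ν`, with leading
coefficient `-det J ≠ 0`. The Whitham pencil is the same cubic: its determinant at `η` is `T⁻¹ η³
modDet J (-1 / (η T))` (`whitham_jacobians`). A non-real `η` gives a non-real root `ν₀`; such a root
of a real cubic is simple, so the implicit function theorem continues it to `N(ζ)`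
(`IsOrbit.exists_branch`). Then `μ(κ) = ζ N(ζ) = iκ ν₀ + O(κ²)` has real part `-κ Im ν₀ + O(κ²)`,
nonzero for small `κ ≠ 0`. Cut-off Floquet solutions form a Weyl sequence, which puts `μ(κ)` in the
`L²` spectrum (`IsFloquetSolution.mem_linSpectrum`). Spectral stability excludes such a branch,
hence a non-real `η`.

The derivatives of `T`, `M`, `P` are delicate, since the integrands are singular at the turning
points. A nonzero Jacobian already forces differentiability, so one curve per direction suffices.
The curve is chosen so that the turning points move affinely; the moments then become integrals over
a fixed half period with regular integrand and can be differentiated under the integral sign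
(`IsOrbit.hasDerivAt_moment`). An exact derivative converts the outcome into data of the linearized
equation (`IsVariation.integral_eq`). -/

theorem hasDerivAt_primitive {F : Type*} [NormedAddCommGroup F] [NormedSpace ℝ F] [CompleteSpace F]
    {φ : ℝ → F} (hφ : Continuous φ) (t : ℝ) :
    HasDerivAt (fun t => ∫ s in (0 : ℝ)..t, φ s) (φ t) t :=
  intervalIntegral.integral_hasDerivAt_right (hφ.intervalIntegrable _ _)
    (hφ.stronglyMeasurableAtFilter _ _) hφ.continuousAt

theorem continuous_primitive_zero {F : Type*} [NormedAddCommGroup F] [NormedSpace ℝ F] [CompleteSpace F]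
    {φ : ℝ → F} (hφ : Continuous φ) :
    Continuous (fun t => ∫ s in (0 : ℝ)..t, φ s) :=
  continuous_iff_continuousAt.2 fun t => (hasDerivAt_primitive hφ t).continuousAt

section LinearODE

variable {E : Type*} [NormedAddCommGroup E] [NormedSpace ℂ E]

/-- The weight `cosh (K t)` gives integration from `0` norm at most `1 / K` on the whole line: the
primitive of `cosh (K s)` is `sinh (K t) / K`, and `|sinh| ≤ cosh`. -/
theorem norm_inv_cosh_smul_integral_le {K C : ℝ} (hK : 0 < K) {φ : ℝ → E}
    (hφ : ∀ s, ‖φ s‖ ≤ C * Real.cosh (K * s)) (t : ℝ) :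
    ‖(Real.cosh (K * t))⁻¹ • ∫ s in (0 : ℝ)..t, φ s‖ ≤ C / K := by
  have hC : 0 ≤ C := by
    have := (norm_nonneg _).trans (hφ 0)
    simpa using this
  have hcosh : ∀ s, HasDerivAt (fun s => C / K * Real.sinh (K * s)) (C * Real.cosh (K * s)) s := by
    intro s
    have h1 : HasDerivAt (fun s : ℝ => K * s) K s := by simpa using (hasDerivAt_id s).const_mul K
    have := (h1.sinh).const_mul (C / K)
    exact this.congr_deriv (by field_simp)
  have hcont : Continuous fun s => C * Real.cosh (K * s) := by fun_prop
  have h1 : ‖∫ s in (0 : ℝ)..t, φ s‖ ≤ |∫ s in (0 : ℝ)..t, C * Real.cosh (K * s)| :=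
    intervalIntegral.norm_integral_le_abs_of_norm_le (Eventually.of_forall hφ)
      (hcont.intervalIntegrable _ _)
  rw [intervalIntegral.integral_eq_sub_of_hasDerivAt (fun s _ => hcosh s)
    (hcont.intervalIntegrable _ _)] at h1
  simp only [mul_zero, Real.sinh_zero, sub_zero] at h1
  have hpos := Real.cosh_pos (K * t)
  rw [norm_smul, norm_inv, Real.norm_of_nonneg hpos.le, inv_mul_le_iff₀ hpos, mul_comm]
  refine h1.trans ?_
  rw [abs_mul, abs_of_nonneg (by positivity : 0 ≤ C / K)]
  gcongr
  rw [abs_le]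
  constructor
  · have := Real.sinh_lt_cosh (-(K * t))
    rw [Real.sinh_neg, Real.cosh_neg] at this
    linarith
  · exact (Real.sinh_lt_cosh _).le

open BoundedContinuousFunction in
theorem norm_clm_smul_le {K C : ℝ} {A : ℝ → E →L[ℂ] E} (hA : ∀ t, ‖A t‖ ≤ C) (y : ℝ →ᵇ E)
    (s : ℝ) : ‖A s (Real.cosh (K * s) • y s)‖ ≤ C * ‖y‖ * Real.cosh (K * s) := by
  refine ((A s).le_opNorm _).trans ?_
  rw [norm_smul, Real.norm_of_nonneg (Real.cosh_pos _).le]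
  have := y.norm_coe_le_norm s
  calc ‖A s‖ * (Real.cosh (K * s) * ‖y s‖) ≤ C * (Real.cosh (K * s) * ‖y‖) := by
        have := Real.cosh_pos (K * s)
        have := hA s
        have := norm_nonneg (A s)
        gcongr
        linarith
    _ = _ := by ring

/-- A solution of a linear equation with bounded coefficients that vanishes at one point is zero. -/
theorem linear_ode_eq_zero (A : ℝ → E →L[ℂ] E) {C : ℝ} (hC : ∀ t, ‖A t‖ ≤ C) {Z : ℝ → E}
    (hZ : ∀ t, HasDerivAt Z (A t (Z t)) t) {t₀ : ℝ} (h0 : Z t₀ = 0) : Z = 0 := by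
  have hC0 : 0 ≤ C := (norm_nonneg _).trans (hC 0)
  refine ODE_solution_unique_univ (v := fun t z => A t z) (s := fun _ => Set.univ)
    (K := ⟨C, hC0⟩) (t₀ := t₀) (fun t => ?_) (fun t => ⟨hZ t, trivial⟩) (fun t => ⟨?_, trivial⟩) h0
  · exact ((A t).lipschitz.weaken (hC t)).lipschitzOnWith
  · simp

variable [CompleteSpace E]

open BoundedContinuousFunction in
/-- The bounded function `(cosh Kt)⁻¹ ∫₀ᵗ φ` for `φ` dominated by `cosh`. -/
def weightedPrimitive {K C : ℝ} (hK : 0 < K) (φ : ℝ → E) (hφ : Continuous φ)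
    (hC : ∀ s, ‖φ s‖ ≤ C * Real.cosh (K * s)) : ℝ →ᵇ E :=
  BoundedContinuousFunction.ofNormedAddCommGroup
    (fun t => (Real.cosh (K * t))⁻¹ • ∫ s in (0 : ℝ)..t, φ s)
    (by
      have := continuous_primitive_zero hφ
      have h2 : Continuous fun t => (Real.cosh (K * t))⁻¹ :=
        Continuous.inv₀ (by fun_prop) fun t => (Real.cosh_pos _).ne'
      exact h2.smul this) (C / K)
    (norm_inv_cosh_smul_integral_le hK hC)

open BoundedContinuousFunction in
/-- The Volterra operator of `A` on weighted functions. -/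
def volterra {K C : ℝ} (hK : 0 < K) (A : ℝ → E →L[ℂ] E) (hA : Continuous A)
    (hC : ∀ t, ‖A t‖ ≤ C) : (ℝ →ᵇ E) →L[ℂ] (ℝ →ᵇ E) :=
  have hcont : ∀ y : ℝ →ᵇ E, Continuous fun s => A s (Real.cosh (K * s) • y s) := fun y => by
    have : Continuous fun s => Real.cosh (K * s) • y s := by
      have := y.continuous
      fun_prop
    exact hA.clm_apply this
  LinearMap.mkContinuous
    { toFun := fun y => weightedPrimitive hK (fun s => A s (Real.cosh (K * s) • y s)) (hcont y)
        (norm_clm_smul_le hC y)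
      map_add' := fun y z => by
        ext t
        simp only [weightedPrimitive, coe_ofNormedAddCommGroup,
          BoundedContinuousFunction.add_apply, smul_add, map_add]
        rw [intervalIntegral.integral_add ((hcont y).intervalIntegrable _ _)
          ((hcont z).intervalIntegrable _ _), smul_add]
      map_smul' := fun c y => by
        ext t
        simp only [weightedPrimitive, coe_ofNormedAddCommGroup, coe_smul, RingHom.id_apply]
        rw [smul_comm c, ← intervalIntegral.integral_smul c]
        congr 2
        funext s
        rw [smul_comm, map_smul] } (C / K) fun y => by
      rw [LinearMap.coe_mk, AddHom.coe_mk, BoundedContinuousFunction.norm_le]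
      · intro t
        refine (norm_inv_cosh_smul_integral_le hK (norm_clm_smul_le hC y) t).trans ?_
        apply le_of_eq; ring
      · have := (norm_nonneg _).trans (hC 0)
        positivity

open BoundedContinuousFunction in
theorem volterra_apply {K C : ℝ} (hK : 0 < K) (A : ℝ → E →L[ℂ] E) (hA : Continuous A)
    (hC : ∀ t, ‖A t‖ ≤ C) (y : ℝ →ᵇ E) (t : ℝ) :
    volterra hK A hA hC y t
      = (Real.cosh (K * t))⁻¹ • ∫ s in (0 : ℝ)..t, A s (Real.cosh (K * s) • y s) := rfl

open BoundedContinuousFunction in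
/-- The initial value problem `Z' = (A + μ B) Z + b`, `Z(0) = z₀` with bounded continuous
coefficients has global solutions, smooth in the parameter near `μ = 0`. -/
theorem exists_linear_ode_solution (A B : ℝ → E →L[ℂ] E) (hA : Continuous A) (hB : Continuous B)
    {CA CB Cb : ℝ} (hCA : ∀ t, ‖A t‖ ≤ CA) (hCB : ∀ t, ‖B t‖ ≤ CB) (b : ℝ → E) (hb : Continuous b)
    (hCb : ∀ t, ‖b t‖ ≤ Cb) (z₀ : E) :
    ∃ Z : ℂ → ℝ → E, (∀ᶠ μ in 𝓝 (0 : ℂ), Z μ 0 = z₀ ∧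
      ∀ t, HasDerivAt (Z μ) ((A t + μ • B t) (Z μ t) + b t) t) ∧
      ∀ t, ContDiffAt ℂ 1 (fun μ => Z μ t) 0 := by
  -- The Volterra operator of `A` has norm at most `CA / K`, so any `K > CA` makes it a strict
  -- contraction.
  set K : ℝ := CA + 1 with hKdef
  have hCA0 : 0 ≤ CA := (norm_nonneg _).trans (hCA 0)
  have hCb0 : 0 ≤ Cb := (norm_nonneg _).trans (hCb 0)
  have hK : 0 < K := by positivity
  set V := volterra hK A hA hCA
  set W := volterra hK B hB hCB
  have hV : ‖V‖ < 1 := by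
    refine (ContinuousLinearMap.opNorm_le_bound V (M := CA / K) (by positivity) fun y => ?_).trans_lt ?_
    · refine (BoundedContinuousFunction.norm_le (by positivity)).2 fun t => ?_
      refine (norm_inv_cosh_smul_integral_le hK (norm_clm_smul_le hCA y) t).trans ?_
      apply le_of_eq; ring
    rw [div_lt_one hK, hKdef]; linarith
  have hb' : ∀ s, ‖b s‖ ≤ Cb * Real.cosh (K * s) := fun s =>
    (hCb s).trans (le_mul_of_one_le_right hCb0 (Real.one_le_cosh _))
  set g : ℝ →ᵇ E := weightedPrimitive hK b hb hb' +
    BoundedContinuousFunction.ofNormedAddCommGroup (fun t => (Real.cosh (K * t))⁻¹ • z₀)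
      (by
        have h2 : Continuous fun t => (Real.cosh (K * t))⁻¹ :=
          Continuous.inv₀ (by fun_prop) fun t => (Real.cosh_pos _).ne'
        fun_prop) ‖z₀‖ (fun t => by
        rw [norm_smul, norm_inv, Real.norm_of_nonneg (Real.cosh_pos _).le]
        refine mul_le_of_le_one_left (norm_nonneg _) (inv_le_one_of_one_le₀ (Real.one_le_cosh _)))
    with hg
  -- `Z = cosh (K ·) y` solves the initial value problem when `y = (V + μ W) y + g`. Units are open
  -- and inversion is smooth at a unit, so `y = (1 - V - μ W)⁻¹ g` is C¹ in `μ` near `0`.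
  obtain ⟨U, hU⟩ := isUnit_one_sub_of_norm_lt_one hV
  have hlin : ContDiff ℂ 1 fun μ : ℂ => 1 - (V + μ • W) := by fun_prop
  have hunit : ∀ᶠ μ in 𝓝 (0 : ℂ), IsUnit (1 - (V + μ • W)) := by
    have h0 : (fun μ : ℂ => 1 - (V + μ • W)) 0 ∈ {x | IsUnit x} := by
      simp only [zero_smul, add_zero]
      exact ⟨U, hU⟩
    exact hlin.continuous.continuousAt.eventually_mem (Units.isOpen.mem_nhds h0)
  refine ⟨fun μ t => Real.cosh (K * t) • (Ring.inverse (1 - (V + μ • W)) g) t, ?_, ?_⟩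
  · filter_upwards [hunit] with μ hμ
    set y := Ring.inverse (1 - (V + μ • W)) g with hy
    have hfix : y = (V + μ • W) y + g := by
      have := congrArg (fun L => L g) (Ring.mul_inverse_cancel _ hμ)
      simp only [mul_apply_eq_comp, _root_.sub_apply,
        one_apply_eq_self, ← hy] at this
      rw [← this]; abel
    have hcy : Continuous fun s => Real.cosh (K * s) • y s := by
      have := y.continuous
      fun_prop
    have hfix' : ∀ t, Real.cosh (K * t) • y t
        = z₀ + ∫ s in (0 : ℝ)..t, ((A s + μ • B s) (Real.cosh (K * s) • y s) + b s) := by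
      intro t
      have hi1 : IntervalIntegrable (fun s => A s (Real.cosh (K * s) • y s)) volume 0 t :=
        (hA.clm_apply hcy).intervalIntegrable _ _
      have hi2 : IntervalIntegrable (fun s => μ • B s (Real.cosh (K * s) • y s)) volume 0 t :=
        ((hB.clm_apply hcy).const_smul μ).intervalIntegrable _ _
      have h1 := congrArg (fun z : ℝ →ᵇ E => Real.cosh (K * t) • z t) hfix
      simp only [_root_.add_apply, BoundedContinuousFunction.add_apply,
        _root_.smul_apply, BoundedContinuousFunction.smul_apply, hg] at h1
      rw [show V y t = _ from volterra_apply hK A hA hCA y t,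
        show W y t = _ from volterra_apply hK B hB hCB y t] at h1
      simp only [weightedPrimitive, coe_ofNormedAddCommGroup] at h1
      rw [h1]
      have hne := (Real.cosh_pos (K * t)).ne'
      simp only [smul_add, smul_comm μ (Real.cosh (K * t))⁻¹, smul_inv_smul₀ hne]
      simp only [_root_.add_apply, _root_.smul_apply]
      rw [intervalIntegral.integral_add (hi1.add hi2) (hb.intervalIntegrable _ _),
        intervalIntegral.integral_add hi1 hi2, intervalIntegral.integral_smul]
      abel
    refine ⟨?_, fun t => ?_⟩
    · have := hfix' 0
      simpa using this
    · have hc : Continuous fun s => (A s + μ • B s) (Real.cosh (K * s) • y s) + b s :=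
        (((hA.add (hB.const_smul μ))).clm_apply hcy).add hb
      have := (hasDerivAt_primitive hc t).const_add z₀
      exact this.congr_of_eventuallyEq (Eventually.of_forall hfix')
  · intro t
    have h1 : ContDiffAt ℂ 1 (fun μ : ℂ => Ring.inverse (1 - (V + μ • W))) 0 := by
      have : ContDiffAt ℂ 1 Ring.inverse ((fun μ : ℂ => 1 - (V + μ • W)) 0) := by
        simp only [zero_smul, add_zero]
        rw [← hU]
        exact contDiffAt_ringInverse ℂ U
      exact this.comp (0 : ℂ) hlin.contDiffAt
    have h2 : ContDiffAt ℂ 1 (fun μ : ℂ => Ring.inverse (1 - (V + μ • W)) g) 0 :=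
      h1.clm_apply contDiffAt_const
    have h3 : ContDiffAt ℂ 1
        (fun μ : ℂ => BoundedContinuousFunction.evalCLM ℂ t (Ring.inverse (1 - (V + μ • W)) g)) 0 :=
      ((BoundedContinuousFunction.evalCLM ℂ t : (ℝ →ᵇ E) →L[ℂ] E).contDiff.contDiffAt (n := 1)).comp
        (0 : ℂ) h2
    exact h3.const_smul (Real.cosh (K * t))

end LinearODE

end GKdV

end

noncomputable section

namespace GKdV

/-! ### The periodic orbit in the well -/

theorem hasDerivAt_potential {f : ℝ → ℝ} (hf : Continuous f) (a c v : ℝ) :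
    HasDerivAt (potential f a c) (f v - a - c * v) v := by
  have h1 := hasDerivAt_primitive hf v
  have h2 : HasDerivAt (fun v : ℝ => a * v) a v := by simpa using (hasDerivAt_id v).const_mul a
  have h3 : HasDerivAt (fun v : ℝ => c / 2 * v ^ 2) (c * v) v :=
    ((hasDerivAt_pow 2 v).const_mul (c / 2)).congr_deriv (by push_cast; ring)
  exact (h1.sub h2).sub h3

theorem continuous_potential {f : ℝ → ℝ} (hf : Continuous f) (a c : ℝ) :
    Continuous (potential f a c) :=
  continuous_iff_continuousAt.2 fun v => (hasDerivAt_potential hf a c v).continuousAt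

/-- To the right of `um` the potential is below its value at `um`, so its slope there is at most
`0`, and simplicity of the root excludes `0`. The sign is that of the acceleration of the wave at
the turning point. -/
theorem IsWell.left_slope {f : ℝ → ℝ} (hf : Continuous f) {a E c um up : ℝ}
    (h : IsWell f a E c um up) : 0 < a - f um + c * um := by
  have hd := hasDerivAt_potential hf a c um
  have hne := h.left_simple
  rw [hd.deriv] at hne
  have ht := (hasDerivWithinAt_iff_tendsto_slope' (s := Set.Ioi um) (by simp)).1 hd.hasDerivWithinAt
  have : f um - a - c * um ≤ 0 := by
    refine le_of_tendsto ht ?_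
    filter_upwards [Ioo_mem_nhdsGT h.lt] with v hv
    rw [slope_def_field, h.left_root]
    exact div_nonpos_of_nonpos_of_nonneg (by linarith [h.below v hv]) (by linarith [hv.1])
  have := lt_of_le_of_ne this hne
  linarith

theorem IsWell.right_slope {f : ℝ → ℝ} (hf : Continuous f) {a E c um up : ℝ}
    (h : IsWell f a E c um up) : a - f up + c * up < 0 := by
  have hd := hasDerivAt_potential hf a c up
  have hne := h.right_simple
  rw [hd.deriv] at hne
  have ht := (hasDerivWithinAt_iff_tendsto_slope' (s := Set.Iio up) (by simp)).1 hd.hasDerivWithinAt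
  have : 0 ≤ f up - a - c * up := by
    refine ge_of_tendsto ht ?_
    filter_upwards [Ioo_mem_nhdsLT h.lt] with v hv
    rw [slope_def_field, h.right_root]
    exact div_nonneg_of_nonpos (by linarith [h.below v hv]) (by linarith [hv.2])
  have := lt_of_le_of_ne this hne.symm
  linarith

/-- The orbit `u` with velocity `p` through the turning points `um` (at time `0`) and `up` (at the
half period `X`). -/
structure IsOrbit (f : ℝ → ℝ) (a E c um up X : ℝ) (u p : ℝ → ℝ) : Prop where
  pos : 0 < X
  hasDerivAt_fst : ∀ x, HasDerivAt u (p x) x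
  hasDerivAt_snd : ∀ x, HasDerivAt p (a - f (u x) + c * u x) x
  energy : ∀ x, p x ^ 2 / 2 = E - potential f a c (u x)
  fst_zero : u 0 = um
  fst_half : u X = up
  snd_zero : p 0 = 0
  snd_half : p X = 0
  snd_pos : ∀ x ∈ Set.Ioo 0 X, 0 < p x
  reflect : ∀ x, u (2 * X - x) = u x
  periodic : ∀ x, u (x + 2 * X) = u x
  left_slope : 0 < a - f um + c * um
  right_slope : a - f up + c * up < 0

theorem pos_of_isPreconnected {s : Set ℝ} (hs : IsPreconnected s) {p : ℝ → ℝ} (hp : Continuous p)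
    (hne : ∀ x ∈ s, p x ≠ 0) {y : ℝ} (hy : y ∈ s) (hpy : 0 < p y) : ∀ x ∈ s, 0 < p x := by
  intro x hx
  by_contra hcon
  obtain ⟨z, hz, hz0⟩ := hs.intermediate_value hx hy hp.continuousOn
    (show (0 : ℝ) ∈ Set.Icc (p x) (p y) from ⟨not_lt.1 hcon, hpy.le⟩)
  exact hne z hz hz0

/-- Reflection symmetry of solutions of `u'' = g(u)` about a point with `u' = 0`. -/
theorem reflect_of_deriv_eq_zero {g u p : ℝ → ℝ} (hg : ContDiff ℝ 1 g)
    (hu : ∀ x, HasDerivAt u (p x) x) (hp : ∀ x, HasDerivAt p (g (u x)) x) {y : ℝ} (hy : p y = 0)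
    (x : ℝ) : u (2 * y - x) = u x := by
  have hcu : Continuous u := continuous_iff_continuousAt.2 fun x => (hu x).continuousAt
  have hcp : Continuous p := continuous_iff_continuousAt.2 fun x => (hp x).continuousAt
  -- The vector field is Lipschitz only on bounded sets, so the uniqueness argument is confined to a
  -- bounded time interval, on which both trajectories stay in a ball.
  obtain ⟨A, B, hx, hy'⟩ : ∃ A B, x ∈ Set.Ioo A B ∧ y ∈ Set.Ioo A B :=
    ⟨min x y - 1, max x y + 1, by grind, by grind⟩
  set Z : ℝ → ℝ × ℝ := fun x => (u x, p x)
  set W : ℝ → ℝ × ℝ := fun x => (u (2 * y - x), -p (2 * y - x))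
  obtain ⟨R₁, hR₁⟩ := (isCompact_Icc (a := A) (b := B)).exists_bound_of_continuousOn
    (f := Z) (by fun_prop)
  obtain ⟨R₂, hR₂⟩ := (isCompact_Icc (a := A) (b := B)).exists_bound_of_continuousOn
    (f := W) (by fun_prop)
  have hv : ContDiff ℝ 1 fun z : ℝ × ℝ => (z.2, g z.1) :=
    contDiff_snd.prodMk (hg.comp contDiff_fst)
  obtain ⟨K, hK⟩ := hv.contDiffOn.exists_lipschitzOnWith one_ne_zero
    (convex_closedBall (0 : ℝ × ℝ) (max R₁ R₂)) (isCompact_closedBall _ _)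
  have := ODE_solution_unique_of_mem_Ioo (v := fun (_ : ℝ) (z : ℝ × ℝ) => (z.2, g z.1))
    (s := fun _ => Metric.closedBall 0 (max R₁ R₂)) (f := W) (g := Z) (t₀ := y)
    (fun t _ => hK) hy' (fun t ht => ⟨?_, ?_⟩) (fun t ht => ⟨?_, ?_⟩) ?_ hx
  · exact congrArg Prod.fst this
  · have h1 := (hu (2 * y - t)).comp_const_sub (2 * y) t
    have h2 := ((hp (2 * y - t)).comp_const_sub (2 * y) t).neg
    rw [neg_neg] at h2
    exact h1.prodMk h2
  · rw [mem_closedBall_zero_iff]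
    exact (hR₂ t ⟨ht.1.le, ht.2.le⟩).trans (le_max_right _ _)
  · exact (hu t).prodMk (hp t)
  · rw [mem_closedBall_zero_iff]
    exact (hR₁ t ⟨ht.1.le, ht.2.le⟩).trans (le_max_left _ _)
  · have : 2 * y - y = y := by ring
    simp [Z, W, this, hy]

theorem tendsto_of_mem_Icc_of_tendsto {u : ℝ → ℝ} (hm : MonotoneOn u (Set.Ici 0)) {L : ℝ}
    (hL : Tendsto (fun n : ℕ => u n) atTop (𝓝 L)) {ξ : ℕ → ℝ}
    (hξ : ∀ n : ℕ, ξ n ∈ Set.Ioo (n : ℝ) (n + 1)) :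
    Tendsto (fun n => u (ξ n)) atTop (𝓝 L) := by
  have hL' : Tendsto (fun n : ℕ => u ((n : ℝ) + 1)) atTop (𝓝 L) := by
    have := (tendsto_add_atTop_iff_nat 1).2 hL
    simpa using this
  refine tendsto_of_tendsto_of_tendsto_of_le_of_le hL hL' (fun n => ?_) (fun n => ?_)
  · have h0 : (0 : ℝ) ≤ n := n.cast_nonneg
    exact hm h0 (h0.trans (hξ n).1.le) (hξ n).1.le
  · have h0 : (0 : ℝ) ≤ n := n.cast_nonneg
    exact hm (h0.trans (hξ n).1.le) (show (0 : ℝ) ≤ n + 1 by positivity) (hξ n).2.le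

/-- The profile starts at rest with positive acceleration. If it never came to rest again, it would
increase to a limit with `V = E`, hence to `up`, with velocity tending to `0`, while the
acceleration would tend to a nonzero value. At the first later time `X` of rest it is at `up`, and
the reflections about `0` and `X` compose to the translation by `2 X`. -/
theorem IsProfile.exists_isOrbit {f : ℝ → ℝ} (hf : ContDiff ℝ 2 f) {a E c um up : ℝ}
    (hwell : IsWell f a E c um up) {u : ℝ → ℝ} (hu : IsProfile f a E c um u) :
    ∃ X, IsOrbit f a E c um up X u (deriv u) := by
  have hql := hwell.left_slope hf.continuous
  have hqr := hwell.right_slope hf.continuous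
  have hu1 : ∀ x, HasDerivAt u (deriv u x) x := fun x =>
    (hu.contDiff.differentiable (by norm_num) x).hasDerivAt
  have hcd : ContDiff ℝ 1 (deriv u) :=
    (contDiff_succ_iff_deriv (n := 1)).1 hu.contDiff |>.2.2
  have hp1 : ∀ x, HasDerivAt (deriv u) (a - f (u x) + c * u x) x := fun x => by
    have := (hcd.differentiable (by norm_num) x).hasDerivAt
    rwa [show deriv (deriv u) x = a - f (u x) + c * u x by
      linarith [hu.first_integral x]] at this
  set p := deriv u with hpdef
  have hcu : Continuous u := hu.contDiff.continuous
  have hcp : Continuous p := hcd.continuous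
  have hen : ∀ x, p x ^ 2 / 2 = E - potential f a c (u x) := hu.second_integral
  have hp0 : p 0 = 0 := by
    have := hen 0
    rw [hu.initial, hwell.left_root] at this
    nlinarith
  have hV := continuous_potential hf.continuous a c
  have hpz : ∀ x, u x = up → p x = 0 := fun x hx => by
    have := hen x
    rw [hx, hwell.right_root] at this
    nlinarith
  -- the velocity is positive at small times
  obtain ⟨ε, hε, hεpos⟩ : ∃ ε > 0, ∀ x ∈ Set.Ioc 0 ε, 0 < p x := by
    have ht := (hasDerivWithinAt_iff_tendsto_slope' (s := Set.Ioi 0) (by simp)).1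
      (hp1 0).hasDerivWithinAt
    rw [hu.initial] at ht
    have := ht.eventually (lt_mem_nhds hql)
    obtain ⟨ε, hε, h⟩ := (mem_nhdsGT_iff_exists_Ioc_subset).1 this
    refine ⟨ε, hε, fun x hx => ?_⟩
    have := h hx
    simp only [Set.mem_ofPred_eq, slope_def_field, hp0, sub_zero] at this
    exact (div_pos_iff_of_pos_right hx.1).1 this
  have hmono : ∀ {Y : ℝ}, (∀ x ∈ Set.Ioo 0 Y, 0 < p x) → StrictMonoOn u (Set.Icc 0 Y) := by
    intro Y hY
    refine strictMonoOn_of_deriv_pos (convex_Icc _ _) hcu.continuousOn fun x hx => ?_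
    rw [interior_Icc] at hx
    exact hY x hx
  -- By the energy relation the velocity vanishes wherever `u = up`, so `up` is not reached while
  -- the velocity is positive.
  have hlt : ∀ {Y : ℝ}, (∀ x ∈ Set.Ioo 0 Y, 0 < p x) → ∀ x ∈ Set.Ioo 0 Y, u x < up := by
    intro Y hY x hx
    by_contra hcon
    obtain ⟨y, hy, hyu⟩ := intermediate_value_Icc hx.1.le (f := u) hcu.continuousOn
      (show up ∈ Set.Icc (u 0) (u x) from ⟨by rw [hu.initial]; exact hwell.lt.le, not_lt.1 hcon⟩)
    rcases hy.1.eq_or_lt with h | h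
    · rw [← h, hu.initial] at hyu
      exact hwell.lt.ne hyu
    · exact (hY y ⟨h, hy.2.trans_lt hx.2⟩).ne' (hpz y hyu)
  have hzero : ∃ x, ε ≤ x ∧ p x = 0 := by
    by_contra! hcon
    have hne : ∀ x ∈ Set.Ioi (0 : ℝ), p x ≠ 0 := fun x hx => by
      rcases le_or_gt ε x with h | h
      · exact hcon x h
      · exact (hεpos x ⟨hx, h.le⟩).ne'
    have hpos := pos_of_isPreconnected isPreconnected_Ioi hcp hne (y := ε) hε
      (hεpos ε ⟨hε, le_rfl⟩)
    have hposY : ∀ Y, ∀ x ∈ Set.Ioo 0 Y, 0 < p x := fun Y x hx => hpos x hx.1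
    have hm : MonotoneOn u (Set.Ici 0) := fun x hx y hy hxy =>
      (hmono (hposY y)).monotoneOn ⟨hx, hxy⟩ ⟨hy, le_rfl⟩ hxy
    have hltup : ∀ x, 0 ≤ x → u x < up := fun x hx => by
      have h1 := hlt (hposY (x + 2)) (x + 1) ⟨by linarith, by linarith⟩
      exact (hm hx (show (0 : ℝ) ≤ x + 1 by linarith) (by linarith)).trans_lt h1
    have hmn : Monotone fun n : ℕ => u n := fun m n hmn =>
      hm (show (0 : ℝ) ≤ m from m.cast_nonneg) (show (0 : ℝ) ≤ n from n.cast_nonneg)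
        (by exact_mod_cast hmn)
    obtain ⟨L, hL⟩ : ∃ L, Tendsto (fun n : ℕ => u n) atTop (𝓝 L) := by
      rcases tendsto_atTop_of_monotone hmn with h | h
      · obtain ⟨n, hn⟩ := (h.eventually (eventually_ge_atTop up)).exists
        exact absurd hn (not_le.2 (hltup n n.cast_nonneg))
      · exact h
    have hLsucc : Tendsto (fun n : ℕ => u ((n : ℝ) + 1)) atTop (𝓝 L) := by
      have := (tendsto_add_atTop_iff_nat 1).2 hL
      simpa using this
    -- Mean value points in `(n, n + 1)`: the increments of `u` tend to `0`, hence so do the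
    -- velocities there.
    choose ξ hξ hξu using fun n : ℕ => exists_hasDerivAt_eq_slope u p
      (show (n : ℝ) < n + 1 by linarith) hcu.continuousOn (fun x _ => hu1 x)
    have hlim1 : Tendsto (fun n => p (ξ n)) atTop (𝓝 0) := by
      have h1 := hLsucc.sub hL
      rw [sub_self] at h1
      refine h1.congr fun n => ?_
      rw [hξu]; simp
    have hVL : potential f a c L = E := by
      have h1 : Tendsto (fun n => E - potential f a c (u (ξ n))) atTop
          (𝓝 (E - potential f a c L)) :=
        ((hV.tendsto L).comp (tendsto_of_mem_Icc_of_tendsto hm hL hξ)).const_sub E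
      have h2 : Tendsto (fun n => p (ξ n) ^ 2 / 2) atTop (𝓝 0) := by
        simpa using (hlim1.pow 2).div_const 2
      have := tendsto_nhds_unique (h2.congr fun n => hen (ξ n)) h1
      linarith
    have hLup : L = up := by
      have h1 : L ≤ up := le_of_tendsto hL
        (Eventually.of_forall fun n => (hltup n n.cast_nonneg).le)
      have h2 : u 1 ≤ L := by
        have := hmn.ge_of_tendsto hL 1
        simpa using this
      have h3 : um < u 1 := by
        rw [← hu.initial]
        exact hmono (hposY 1) ⟨le_rfl, zero_le_one⟩ ⟨zero_le_one, le_rfl⟩ zero_lt_one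
      by_contra hne
      exact (hwell.below L ⟨h3.trans_le h2, lt_of_le_of_ne h1 hne⟩).ne hVL
    have hpn : Tendsto (fun n : ℕ => p n) atTop (𝓝 0) := by
      have h1 : Tendsto (fun n : ℕ => 2 * (E - potential f a c (u n))) atTop
          (𝓝 (2 * (E - potential f a c L))) :=
        (((hV.tendsto L).comp hL).const_sub E).const_mul 2
      rw [hVL, sub_self, mul_zero] at h1
      have h2 : Tendsto (fun n : ℕ => p n ^ 2) atTop (𝓝 0) :=
        h1.congr fun n => by rw [← hen]; ring
      have h3 := h2.sqrt
      simp only [Real.sqrt_sq_eq_abs, Real.sqrt_zero] at h3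
      exact (tendsto_zero_iff_abs_tendsto_zero _).2 h3
    have hpsucc : Tendsto (fun n : ℕ => p ((n : ℝ) + 1)) atTop (𝓝 0) := by
      have := (tendsto_add_atTop_iff_nat 1).2 hpn
      simpa using this
    -- The same device one derivative higher: the accelerations at `θ n` tend to `0`, but also to
    -- the acceleration at `up`.
    choose θ hθ hθu using fun n : ℕ => exists_hasDerivAt_eq_slope p _
      (show (n : ℝ) < n + 1 by linarith) hcp.continuousOn (fun x _ => hp1 x)
    have hacc : Tendsto (fun n => a - f (u (θ n)) + c * u (θ n)) atTop
        (𝓝 (a - f L + c * L)) := by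
      have h1 := tendsto_of_mem_Icc_of_tendsto hm hL hθ
      exact (((hf.continuous.tendsto L).comp h1).const_sub a).add (h1.const_mul c)
    have h0 : Tendsto (fun n => a - f (u (θ n)) + c * u (θ n)) atTop (𝓝 0) := by
      have h1 := hpsucc.sub hpn
      rw [sub_self] at h1
      refine h1.congr fun n => ?_
      rw [hθu]; simp
    have := tendsto_nhds_unique hacc h0
    rw [hLup] at this
    linarith
  set S := {x | ε ≤ x ∧ p x = 0} with hS
  have hSc : IsClosed S :=
    isClosed_Ici.inter (isClosed_eq hcp continuous_const)
  have hSb : BddBelow S := ⟨ε, fun x hx => hx.1⟩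
  obtain ⟨hX1, hX2⟩ := hSc.csInf_mem hzero hSb
  set X := sInf S
  have hX : 0 < X := hε.trans_le hX1
  have hεX : ε < X := lt_of_le_of_ne hX1 fun h => (hεpos ε ⟨hε, le_rfl⟩).ne' (by rw [h]; exact hX2)
  have hpos : ∀ x ∈ Set.Ioo 0 X, 0 < p x := by
    refine pos_of_isPreconnected isPreconnected_Ioo hcp (fun x hx h0 => ?_) (y := ε)
      ⟨hε, hεX⟩ (hεpos ε ⟨hε, le_rfl⟩)
    rcases le_or_gt ε x with h | h
    · exact not_lt.2 (csInf_le hSb ⟨h, h0⟩) hx.2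
    · exact (hεpos x ⟨hx.1, h.le⟩).ne' h0
  have hg : ContDiff ℝ 1 fun v => a - f v + c * v :=
    (contDiff_const.sub (hf.of_le (by norm_num))).add (contDiff_const.mul contDiff_id)
  have hrefl := reflect_of_deriv_eq_zero hg hu1 hp1 hX2
  have hrefl0 := reflect_of_deriv_eq_zero hg hu1 hp1 hp0
  refine ⟨X, hX, hu1, hp1, hen, hu.initial, ?_, hp0, hX2, hpos, hrefl, fun x => ?_, hql, hqr⟩
  · have hum : um < u X := by
      rw [← hu.initial]
      exact hmono hpos ⟨le_rfl, hX.le⟩ ⟨hX.le, le_rfl⟩ hX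
    have hVX : potential f a c (u X) = E := by
      have := hen X
      rw [hX2] at this
      linarith
    have hle : u X ≤ up := by
      have ht : Tendsto u (𝓝[<] X) (𝓝 (u X)) := (hcu.tendsto X).mono_left nhdsWithin_le_nhds
      refine le_of_tendsto ht ?_
      filter_upwards [Ioo_mem_nhdsLT hX] with x hx
      exact (hlt hpos x hx).le
    by_contra hne
    exact (hwell.below _ ⟨hum, lt_of_le_of_ne hle hne⟩).ne hVX
  · have h1 := hrefl (-x)
    have h2 := hrefl0 x
    rw [mul_zero, zero_sub] at h2
    rw [← h2, ← h1]
    congr 1; ring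

end GKdV

end

noncomputable section

namespace GKdV

/-! ### Deformations of a well with affinely moving turning points -/

/-- The affine motion `z ↦ z + h (α + β z)`. -/
def shift (α β h z : ℝ) : ℝ := z + h * (α + β * z)

/-- The parameter `a` for which the turning points of the well are the shifted ones. -/
def deformA (f : ℝ → ℝ) (c um up cdot α β h : ℝ) : ℝ :=
  ((∫ y in (0 : ℝ)..shift α β h up, f y) - ∫ y in (0 : ℝ)..shift α β h um, f y) /
    (shift α β h up - shift α β h um) -
    (c + h * cdot) * (shift α β h up + shift α β h um) / 2

/-- The parameter `E` for which the turning points of the well are the shifted ones. -/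
def deformE (f : ℝ → ℝ) (c um up cdot α β h : ℝ) : ℝ :=
  potential f (deformA f c um up cdot α β h) (c + h * cdot) (shift α β h um)

theorem shift_sub (α β h y z : ℝ) : shift α β h z - shift α β h y = (1 + h * β) * (z - y) := by
  unfold shift; ring

/-- `deformA` solves the linear equation in `a` saying that the potential takes equal values at the
two shifted ends. -/
theorem potential_shift_right (f : ℝ → ℝ) {c um up cdot α β h : ℝ} (hlt : um < up)
    (hβ : 0 < 1 + h * β) :
    potential f (deformA f c um up cdot α β h) (c + h * cdot) (shift α β h up)
      = deformE f c um up cdot α β h := by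
  have hne : shift α β h up - shift α β h um ≠ 0 := by
    rw [shift_sub]
    exact (mul_pos hβ (sub_pos.2 hlt)).ne'
  unfold deformE potential deformA
  field_simp
  ring

theorem hasDerivAt_shift (α β h z : ℝ) : HasDerivAt (fun h => shift α β h z) (α + β * z) h := by
  have := ((hasDerivAt_id h).mul_const (α + β * z)).const_add z
  simpa [shift] using this

theorem hasDerivAt_shift_right (α β h z : ℝ) :
    HasDerivAt (fun z => shift α β h z) (1 + h * β) z := by
  have h1 : HasDerivAt (fun z : ℝ => α + β * z) β z := by
    simpa using ((hasDerivAt_id z).const_mul β).const_add α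
  exact (hasDerivAt_id z).add (h1.const_mul h)

@[simp] theorem shift_zero (α β z : ℝ) : shift α β 0 z = z := by simp [shift]

theorem deformA_zero {f : ℝ → ℝ} {a E c um up : ℝ} (hw : IsWell f a E c um up) (cdot α β : ℝ) :
    deformA f c um up cdot α β 0 = a := by
  have h1 := hw.left_root
  have h2 := hw.right_root
  have hne : up - um ≠ 0 := (sub_pos.2 hw.lt).ne'
  unfold potential at h1 h2
  simp only [deformA, shift_zero, zero_mul, add_zero]
  field_simp
  linarith

theorem deformE_zero {f : ℝ → ℝ} {a E c um up : ℝ} (hw : IsWell f a E c um up) (cdot α β : ℝ) :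
    deformE f c um up cdot α β 0 = E := by
  simp only [deformE, deformA_zero hw, shift_zero, zero_mul, add_zero, hw.left_root]

/-- `hl` and `hr` are the equations `V(u±; a, c) = E` differentiated along the motion, the turning
points having velocities `α + β u±`. As `um ≠ up`, they determine `adot` and `Edot` from `cdot`,
`α`, `β`. -/
theorem hasDerivAt_deformA {f : ℝ → ℝ} (hf : Continuous f) {a E c um up : ℝ}
    (hw : IsWell f a E c um up) {adot Edot cdot α β : ℝ}
    (hl : (f um - a - c * um) * (α + β * um) = Edot + adot * um + cdot * um ^ 2 / 2)
    (hr : (f up - a - c * up) * (α + β * up) = Edot + adot * up + cdot * up ^ 2 / 2) :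
    HasDerivAt (fun h => deformA f c um up cdot α β h) adot 0 := by
  have hd : up - um ≠ 0 := (sub_pos.2 hw.lt).ne'
  have h1 := hw.left_root
  have h2 := hw.right_root
  unfold potential at h1 h2
  have hF : ∀ z, HasDerivAt (fun h => ∫ y in (0 : ℝ)..shift α β h z, f y)
      (f z * (α + β * z)) 0 := by
    intro z
    have := hasDerivAt_primitive hf (shift α β 0 z)
    rw [shift_zero] at this
    exact HasDerivAt.comp (0 : ℝ) (by simpa using this) (hasDerivAt_shift α β 0 z)
  have hc : HasDerivAt (fun h : ℝ => c + h * cdot) cdot 0 := by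
    simpa using ((hasDerivAt_id (0 : ℝ)).mul_const cdot).const_add c
  have hD := (((hF up).sub (hF um)).div ((hasDerivAt_shift α β 0 up).sub (hasDerivAt_shift α β 0 um))
    (by simpa using hd)).sub
    ((hc.mul ((hasDerivAt_shift α β 0 up).add (hasDerivAt_shift α β 0 um))).div_const 2)
  refine hD.congr_deriv ?_
  simp only [Pi.sub_apply, Pi.add_apply, shift_zero, zero_mul, add_zero]
  have hN : (∫ y in (0 : ℝ)..up, f y) - ∫ y in (0 : ℝ)..um, f y
      = (up - um) * (a + c * (up + um) / 2) := by linear_combination h2 - h1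
  rw [hN]
  field_simp
  linear_combination 2 * hr - 2 * hl

theorem hasDerivAt_deformed_potential {f : ℝ → ℝ} (hf : Continuous f) {a E c um up : ℝ}
    (hw : IsWell f a E c um up) {adot cdot α β : ℝ}
    (hA : HasDerivAt (fun h => deformA f c um up cdot α β h) adot 0) (z : ℝ) :
    HasDerivAt (fun h => potential f (deformA f c um up cdot α β h) (c + h * cdot) (shift α β h z))
      ((f z - a - c * z) * (α + β * z) - adot * z - cdot * z ^ 2 / 2) 0 := by
  have hF : HasDerivAt (fun h => ∫ y in (0 : ℝ)..shift α β h z, f y) (f z * (α + β * z)) 0 := by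
    have := hasDerivAt_primitive hf (shift α β 0 z)
    rw [shift_zero] at this
    exact HasDerivAt.comp (0 : ℝ) (by simpa using this) (hasDerivAt_shift α β 0 z)
  have hc : HasDerivAt (fun h : ℝ => c + h * cdot) cdot 0 := by
    simpa using ((hasDerivAt_id (0 : ℝ)).mul_const cdot).const_add c
  have hs := hasDerivAt_shift α β 0 z
  have := (hF.sub (hA.mul hs)).sub ((hc.div_const 2).mul (hs.pow 2))
  refine this.congr_deriv ?_
  simp only [shift_zero, deformA_zero hw]
  simp
  ring

theorem hasDerivAt_deformE {f : ℝ → ℝ} (hf : Continuous f) {a E c um up : ℝ}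
    (hw : IsWell f a E c um up) {adot Edot cdot α β : ℝ}
    (hl : (f um - a - c * um) * (α + β * um) = Edot + adot * um + cdot * um ^ 2 / 2)
    (hr : (f up - a - c * up) * (α + β * up) = Edot + adot * up + cdot * up ^ 2 / 2) :
    HasDerivAt (fun h => deformE f c um up cdot α β h) Edot 0 :=
  (hasDerivAt_deformed_potential hf hw (hasDerivAt_deformA hf hw hl hr) um).congr_deriv
    (by linear_combination hl)

/-- The excess of the deformed kinetic energy over the original one. -/
def excess (f : ℝ → ℝ) (a E c um up cdot α β h z : ℝ) : ℝ :=
  deformE f c um up cdot α β h -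
    potential f (deformA f c um up cdot α β h) (c + h * cdot) (shift α β h z) -
    (E - potential f a c z)

theorem hasDerivAt_excess {f : ℝ → ℝ} (hf : Continuous f) {a E c um up : ℝ}
    (hw : IsWell f a E c um up) {adot Edot cdot α β : ℝ}
    (hl : (f um - a - c * um) * (α + β * um) = Edot + adot * um + cdot * um ^ 2 / 2)
    (hr : (f up - a - c * up) * (α + β * up) = Edot + adot * up + cdot * up ^ 2 / 2) (z : ℝ) :
    HasDerivAt (fun h => excess f a E c um up cdot α β h z)
      (Edot + adot * z + cdot * z ^ 2 / 2 - (f z - a - c * z) * (α + β * z)) 0 :=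
  (((hasDerivAt_deformE hf hw hl hr).sub (hasDerivAt_deformed_potential hf hw
    (hasDerivAt_deformA hf hw hl hr) z)).sub_const _).congr_deriv (by ring)

theorem contDiff_primitive {f : ℝ → ℝ} (hf : Continuous f) :
    ContDiff ℝ 1 fun v => ∫ y in (0 : ℝ)..v, f y := by
  rw [contDiff_one_iff_deriv]
  refine ⟨fun v => (hasDerivAt_primitive hf v).differentiableAt, ?_⟩
  rwa [show deriv (fun v => ∫ y in (0 : ℝ)..v, f y) = f from
    funext fun v => (hasDerivAt_primitive hf v).deriv]

/-- Uniform first order bound for functions `C¹` on a compact box. -/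
theorem exists_box_bound {F : Type*} [NormedAddCommGroup F] [NormedSpace ℝ F] {δ : ℝ} (hδ : 0 ≤ δ)
    {s : Set F} (hs : IsCompact s) (hs' : Convex ℝ s) {G : ℝ × F → ℝ}
    (hG : ContDiffOn ℝ 1 G (Set.Icc (-δ) δ ×ˢ s)) :
    ∃ K : ℝ, 0 ≤ K ∧ ∀ h ∈ Set.Icc (-δ) δ, ∀ z ∈ s, ∀ y ∈ s,
      |G (h, z) - G (0, y)| ≤ K * max |h| ‖z - y‖ := by
  obtain ⟨K, hK⟩ := hG.exists_lipschitzOnWith one_ne_zero ((convex_Icc _ _).prod hs')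
    (isCompact_Icc.prod hs)
  refine ⟨K, K.2, fun h hh z hz y hy => ?_⟩
  have := hK.dist_le_mul (h, z) ⟨hh, hz⟩ (0, y) ⟨⟨by linarith, hδ⟩, hy⟩
  rwa [Real.dist_eq, dist_eq_norm, Prod.norm_def, Prod.mk_sub_mk, sub_zero, Real.norm_eq_abs] at this

/-- The excess vanishes at both ends of the well for every `h`, and identically for `h = 0`. Its
`z`-derivative, called `G` below, is C¹ and vanishes at `h = 0`, hence is `O(|h|)`; the mean value
inequality from either end yields the distance factor. That factor compensates the vanishing of the
kinetic energy at the turning points. -/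
theorem exists_excess_bound {f : ℝ → ℝ} (hf : ContDiff ℝ 2 f) {a E c um up : ℝ}
    (hw : IsWell f a E c um up) {cdot α β δ : ℝ} (hδ : 0 ≤ δ)
    (hβ : ∀ h ∈ Set.Icc (-δ) δ, 0 < 1 + h * β) :
    ∃ K : ℝ, 0 ≤ K ∧ ∀ h ∈ Set.Icc (-δ) δ, ∀ z ∈ Set.Icc um up,
      |excess f a E c um up cdot α β h z| ≤ K * |h| * min (z - um) (up - z) := by
  have hf1 : ContDiff ℝ 1 f := hf.of_le (by norm_num)
  have hF := contDiff_primitive hf.continuous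
  set G : ℝ × ℝ → ℝ := fun x => f x.2 - a - c * x.2 - (f (shift α β x.1 x.2) -
    deformA f c um up cdot α β x.1 - (c + x.1 * cdot) * shift α β x.1 x.2) * (1 + x.1 * β) with hGdef
  have hsh : ContDiff ℝ 1 fun x : ℝ × ℝ => shift α β x.1 x.2 := by unfold shift; fun_prop
  have hshz : ∀ z, ContDiff ℝ 1 fun x : ℝ × ℝ => shift α β x.1 z := fun z => by
    unfold shift; fun_prop
  have hG : ContDiffOn ℝ 1 G (Set.Icc (-δ) δ ×ˢ Set.Icc um up) := by
    have hA : ContDiffOn ℝ 1 (fun x : ℝ × ℝ => deformA f c um up cdot α β x.1)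
        (Set.Icc (-δ) δ ×ˢ Set.Icc um up) := by
      unfold deformA
      refine ContDiffOn.sub (ContDiffOn.div ?_ ?_ ?_) ?_
      · exact ((hF.comp (hshz up)).sub (hF.comp (hshz um))).contDiffOn
      · exact ((hshz up).sub (hshz um)).contDiffOn
      · rintro ⟨h, z⟩ hx
        simp only [shift_sub]
        exact (mul_pos (hβ h hx.1) (sub_pos.2 hw.lt)).ne'
      · have := ((hshz up).add (hshz um)).contDiffOn (s := Set.Icc (-δ) δ ×ˢ Set.Icc um up)
        have h2 : ContDiffOn ℝ 1 (fun x : ℝ × ℝ => c + x.1 * cdot)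
          (Set.Icc (-δ) δ ×ˢ Set.Icc um up) := by fun_prop
        exact (h2.mul this).div_const 2
    have h1 : ContDiff ℝ 1 fun x : ℝ × ℝ => f x.2 - a - c * x.2 := by fun_prop
    have h2 : ContDiff ℝ 1 fun x : ℝ × ℝ => f (shift α β x.1 x.2) := hf1.comp hsh
    have h3 : ContDiff ℝ 1 fun x : ℝ × ℝ => (c + x.1 * cdot) * shift α β x.1 x.2 := by fun_prop
    have h4 : ContDiff ℝ 1 fun x : ℝ × ℝ => 1 + x.1 * β := by fun_prop
    exact h1.contDiffOn.sub (((h2.contDiffOn.sub hA).sub h3.contDiffOn).mul h4.contDiffOn)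
  obtain ⟨K, hK0, hK⟩ := exists_box_bound hδ isCompact_Icc (convex_Icc um up) hG
  refine ⟨K, hK0, fun h hh z hz => ?_⟩
  have hbound : ∀ y ∈ Set.Icc um up, ‖G (h, y)‖ ≤ K * |h| := by
    intro y hy
    have h1 := hK h hh y hy y hy
    have h2 : G (0, y) = 0 := by simp [hGdef, deformA_zero hw]
    rwa [h2, sub_self, norm_zero, max_eq_left (abs_nonneg h), sub_zero] at h1
  have hder : ∀ y ∈ Set.Icc um up, HasDerivWithinAt (fun z => excess f a E c um up cdot α β h z)
      (G (h, y)) (Set.Icc um up) y := by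
    intro y _
    have h1 := (hasDerivAt_potential hf.continuous (deformA f c um up cdot α β h) (c + h * cdot)
      (shift α β h y)).comp y (hasDerivAt_shift_right α β h y)
    have h2 := (h1.const_sub (deformE f c um up cdot α β h)).sub
      ((hasDerivAt_potential hf.continuous a c y).const_sub E)
    exact (h2.congr_deriv (by simp only [hGdef]; ring)).hasDerivWithinAt
  have hum : um ∈ Set.Icc um up := ⟨le_rfl, hw.lt.le⟩
  have hup : up ∈ Set.Icc um up := ⟨hw.lt.le, le_rfl⟩
  have h0l : excess f a E c um up cdot α β h um = 0 := by
    simp [excess, deformE, hw.left_root]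
  have h0r : excess f a E c um up cdot α β h up = 0 := by
    simp [excess, potential_shift_right f hw.lt (hβ h hh), hw.right_root]
  have hl := (convex_Icc um up).norm_image_sub_le_of_norm_hasDerivWithin_le hder hbound hum hz
  have hr := (convex_Icc um up).norm_image_sub_le_of_norm_hasDerivWithin_le hder hbound hup hz
  rw [h0l, sub_zero, Real.norm_eq_abs, Real.norm_of_nonneg (sub_nonneg.2 hz.1)] at hl
  rw [h0r, sub_zero, Real.norm_eq_abs, Real.norm_of_nonpos (sub_nonpos.2 hz.2), neg_sub] at hr
  rw [mul_min_of_nonneg _ _ (by positivity)]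
  exact le_min hl hr

theorem exists_bound_Ioo {a b la lb : ℝ} {g : ℝ → ℝ}
    (hg : ContinuousOn g (Set.Ioo a b)) (ha : Tendsto g (𝓝[>] a) (𝓝 la))
    (hb : Tendsto g (𝓝[<] b) (𝓝 lb)) : ∃ C, ∀ x ∈ Set.Ioo a b, |g x| ≤ C := by
  obtain ⟨C, hC⟩ := isCompact_Icc.exists_bound_of_continuousOn
    (continuousOn_Icc_extendFrom_Ioo hg ha hb)
  refine ⟨C, fun x hx => ?_⟩
  have := hC x ⟨hx.1.le, hx.2.le⟩
  rwa [extendFrom_eq (subset_closure hx) (hg x hx)] at this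

/-- The kinetic energy is bounded below by the distance to the turning points. -/
theorem IsWell.exists_le_energy {f : ℝ → ℝ} (hf : Continuous f) {a E c um up : ℝ}
    (hw : IsWell f a E c um up) :
    ∃ C : ℝ, 0 ≤ C ∧ ∀ z ∈ Set.Ioo um up, min (z - um) (up - z) ≤ C * (E - potential f a c z) := by
  have hV := continuous_potential hf a c
  have hl := (hw.left_slope hf).ne'
  have hr := (hw.right_slope hf).ne
  have hd : ∀ v, HasDerivAt (fun v => E - potential f a c v) (a - f v + c * v) v := fun v =>
    ((hasDerivAt_potential hf a c v).const_sub E).congr_deriv (by ring)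
  have htl : Tendsto (fun z => (up - z) / slope (fun v => E - potential f a c v) um z) (𝓝[>] um)
      (𝓝 ((up - um) / (a - f um + c * um))) := by
    refine Tendsto.div ?_ ((hasDerivWithinAt_iff_tendsto_slope' (s := Set.Ioi um) (by simp)).1
      (hd um).hasDerivWithinAt) hl
    exact ((continuous_const.sub continuous_id).tendsto um).mono_left nhdsWithin_le_nhds
  have htr : Tendsto (fun z => (um - z) / slope (fun v => E - potential f a c v) up z) (𝓝[<] up)
      (𝓝 ((um - up) / (a - f up + c * up))) := by
    refine Tendsto.div ?_ ((hasDerivWithinAt_iff_tendsto_slope' (s := Set.Iio up) (by simp)).1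
      (hd up).hasDerivWithinAt) hr
    exact ((continuous_const.sub continuous_id).tendsto up).mono_left nhdsWithin_le_nhds
  -- Simplicity of the roots gives this quotient finite limits at both ends, so it is bounded.
  obtain ⟨C, hC⟩ := exists_bound_Ioo (g := fun z => (z - um) * (up - z) / (E - potential f a c z))
    (ContinuousOn.div (by fun_prop) (by fun_prop) fun z hz =>
      (sub_pos.2 (hw.below z hz)).ne')
    (htl.congr' (by
      filter_upwards [self_mem_nhdsWithin] with z hz
      have : z - um ≠ 0 := (sub_pos.2 hz).ne'
      rw [slope_def_field, hw.left_root, sub_self, sub_zero, div_div_eq_mul_div, mul_comm]))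
    (htr.congr' (by
      filter_upwards [self_mem_nhdsWithin] with z hz
      rw [slope_def_field, hw.right_root, sub_self, sub_zero, div_div_eq_mul_div]
      ring))
  have hlen : 0 < up - um := sub_pos.2 hw.lt
  refine ⟨2 / (up - um) * max C 0, by positivity, fun z hz => ?_⟩
  have hG := sub_pos.2 (hw.below z hz)
  have h1 := (le_abs_self _).trans ((hC z hz).trans (le_max_left C 0))
  rw [div_le_iff₀ hG] at h1
  -- The larger of the two distances is at least half the length of the well.
  have h2 : min (z - um) (up - z) * (up - um) ≤ 2 * ((z - um) * (up - z)) := by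
    have hz1 := hz.1
    have hz2 := hz.2
    rcases le_total (z - um) (up - z) with h | h
    · rw [min_eq_left h]; nlinarith
    · rw [min_eq_right h]; nlinarith
  calc min (z - um) (up - z) = min (z - um) (up - z) * (up - um) / (up - um) := by field_simp
    _ ≤ 2 * (max C 0 * (E - potential f a c z)) / (up - um) :=
      div_le_div_of_nonneg_right (by linarith) hlen.le
    _ = _ := by ring

end GKdV

end

noncomputable section

namespace GKdV

/-! ### Turning points, pullback of the moments to the orbit, and differentiation under the
integral. -/

theorem leftTurn_eq {f : ℝ → ℝ} {m a E c U W : ℝ} (hU : U ≤ m) (hW : m < W)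
    (hr : potential f a c U = E) (hb : ∀ v ∈ Set.Ioo U W, potential f a c v < E) :
    leftTurn f m a E c = U := by
  refine IsGreatest.csSup_eq ⟨⟨hU, hr.ge⟩, fun v hv => ?_⟩
  by_contra hcon
  exact not_lt.2 hv.2 (hb v ⟨not_le.1 hcon, hv.1.trans_lt hW⟩)

theorem rightTurn_eq {f : ℝ → ℝ} {m a E c U W : ℝ} (hU : U < m) (hW : m ≤ W)
    (hr : potential f a c W = E) (hb : ∀ v ∈ Set.Ioo U W, potential f a c v < E) :
    rightTurn f m a E c = W := by
  refine IsLeast.csInf_eq ⟨⟨hW, hr.ge⟩, fun v hv => ?_⟩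
  by_contra hcon
  exact not_lt.2 hv.2 (hb v ⟨hU.trans_le hv.1, not_le.1 hcon⟩)

namespace IsOrbit

variable {f : ℝ → ℝ} {a E c um up X : ℝ} {u p : ℝ → ℝ}

theorem continuous_fst (O : IsOrbit f a E c um up X u p) : Continuous u :=
  continuous_iff_continuousAt.2 fun x => (O.hasDerivAt_fst x).continuousAt

theorem continuous_snd (O : IsOrbit f a E c um up X u p) : Continuous p :=
  continuous_iff_continuousAt.2 fun x => (O.hasDerivAt_snd x).continuousAt

theorem strictMonoOn (O : IsOrbit f a E c um up X u p) : StrictMonoOn u (Set.Icc 0 X) := by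
  refine strictMonoOn_of_deriv_pos (convex_Icc _ _) O.continuous_fst.continuousOn fun x hx => ?_
  rw [interior_Icc] at hx
  rw [(O.hasDerivAt_fst x).deriv]
  exact O.snd_pos x hx

theorem fst_mem (O : IsOrbit f a E c um up X u p) {x : ℝ} (hx : x ∈ Set.Ioo 0 X) :
    u x ∈ Set.Ioo um up := by
  rw [← O.fst_zero, ← O.fst_half]
  exact ⟨O.strictMonoOn ⟨le_rfl, O.pos.le⟩ ⟨hx.1.le, hx.2.le⟩ hx.1,
    O.strictMonoOn ⟨hx.1.le, hx.2.le⟩ ⟨O.pos.le, le_rfl⟩ hx.2⟩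

theorem image_Ioo (O : IsOrbit f a E c um up X u p) : u '' Set.Ioo 0 X = Set.Ioo um up := by
  apply Set.Subset.antisymm
  · rintro _ ⟨x, hx, rfl⟩
    exact O.fst_mem hx
  · have := intermediate_value_Ioo O.pos.le O.continuous_fst.continuousOn
    rwa [O.fst_zero, O.fst_half] at this

theorem integral_well (O : IsOrbit f a E c um up X u p) (g : ℝ → ℝ) :
    ∫ z in Set.Ioo um up, g z = ∫ x in Set.Ioo 0 X, p x * g (u x) := by
  rw [← O.image_Ioo, integral_image_eq_integral_abs_deriv_smul measurableSet_Ioo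
    (fun x _ => (O.hasDerivAt_fst x).hasDerivWithinAt)
    (O.strictMonoOn.injOn.mono Set.Ioo_subset_Icc_self)]
  refine setIntegral_congr_fun measurableSet_Ioo fun x hx => ?_
  simp only [smul_eq_mul, abs_of_pos (O.snd_pos x hx)]

end IsOrbit

/-- The integrand of the moments of a deformed well, pulled back to the original orbit. -/
def pullback (k : ℕ) (α β : ℝ) (x : ℝ × ℝ × ℝ) : ℝ :=
  shift α β x.1 x.2.1 ^ k * (1 + x.1 * β) * (√(1 + x.2.2))⁻¹

/-- The substitutions `v = shift α β h z` and `z = u x` lead to the fixed half period `(0, X)`.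
There `dz = p dx` and `√(E - V) = p / √2`, so the endpoint singularity cancels, the two factors `√2`
combine to `2`, and only `1 / √(1 + ε)` remains. -/
theorem moment_deformed {f : ℝ → ℝ} {a E c um up X : ℝ} {u p : ℝ → ℝ}
    (O : IsOrbit f a E c um up X u p) (hlt : um < up) (k : ℕ) {m a' E' c' α β h : ℝ}
    (hβ : 0 < 1 + h * β) (ε : ℝ → ℝ) (hε : ∀ z ∈ Set.Ioo um up, 0 < 1 + ε z)
    (hV : ∀ z ∈ Set.Ioo um up,
      E' - potential f a' c' (shift α β h z) = (E - potential f a c z) * (1 + ε z))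
    (hbelow : ∀ z ∈ Set.Ioo um up, potential f a c z < E)
    (hl : potential f a' c' (shift α β h um) = E') (hr : potential f a' c' (shift α β h up) = E')
    (hm : m ∈ Set.Ioo (shift α β h um) (shift α β h up)) :
    moment f m k a' E' c' = 2 * ∫ x in Set.Ioo 0 X, pullback k α β (h, u x, ε (u x)) := by
  have hb : ∀ v ∈ Set.Ioo (shift α β h um) (shift α β h up), potential f a' c' v < E' := by
    intro v hv
    set z := (v - h * α) / (1 + h * β) with hz
    have hsz : shift α β h z = v := by
      unfold shift
      rw [hz]; field_simp; ring
    have hzm : z ∈ Set.Ioo um up := by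
      have h1 := shift_sub α β h um z
      have h2 := shift_sub α β h z up
      rw [hsz] at h1 h2
      refine ⟨?_, ?_⟩
      · have : 0 < (1 + h * β) * (z - um) := by rw [← h1]; linarith [hv.1]
        linarith [(pos_iff_pos_of_mul_pos this).1 hβ]
      · have : 0 < (1 + h * β) * (up - z) := by rw [← h2]; linarith [hv.2]
        linarith [(pos_iff_pos_of_mul_pos this).1 hβ]
    have h3 := hV z hzm
    rw [hsz] at h3
    have := mul_pos (sub_pos.2 (hbelow z hzm)) (hε z hzm)
    linarith
  have hsub : ∀ z, shift α β h z = (1 + h * β) * z + h * α := fun z => by unfold shift; ring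
  unfold moment
  rw [leftTurn_eq hm.1.le hm.2 hl hb, rightTurn_eq hm.1 hm.2.le hr hb, hsub um, hsub up,
    ← intervalIntegral.mul_integral_comp_mul_add, intervalIntegral.integral_of_le hlt.le,
    integral_Ioc_eq_integral_Ioo, O.integral_well, ← integral_const_mul, ← integral_const_mul,
    ← integral_const_mul]
  refine setIntegral_congr_fun measurableSet_Ioo fun x hx => ?_
  have hp := O.snd_pos x hx
  have hz := O.fst_mem hx
  have h1 := hV _ hz
  simp only [← hsub]
  rw [h1, ← O.energy, Real.sqrt_mul (by positivity), Real.sqrt_div (by positivity),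
    Real.sqrt_sq hp.le]
  have h2 : √(1 + ε (u x)) ≠ 0 := (Real.sqrt_pos.2 (hε _ hz)).ne'
  have h3 : √2 * √2 = (2 : ℝ) := Real.mul_self_sqrt zero_le_two
  have h4 : √2 ≠ (0 : ℝ) := by positivity
  unfold pullback
  field_simp
  linear_combination (shift α β h (u x) ^ k) * h3

/-- Dominated differentiation for a scalar parameter, with a Lipschitz bound only against the base
point `0`. `L` identifies a number with multiplication by it. -/
theorem hasDerivAt_integral_of_lip_at {μ : Measure ℝ} {F : ℝ → ℝ → ℝ} {F' bound : ℝ → ℝ}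
    {s : Set ℝ} (hs : s ∈ 𝓝 0) (hF : ∀ h ∈ s, AEStronglyMeasurable (F h) μ)
    (hF0 : Integrable (F 0) μ) (hF' : AEStronglyMeasurable F' μ)
    (hlip : ∀ᵐ x ∂μ, ∀ h ∈ s, |F h x - F 0 x| ≤ bound x * |h|) (hb : Integrable bound μ)
    (hd : ∀ᵐ x ∂μ, HasDerivAt (fun h => F h x) (F' x) 0) :
    Integrable F' μ ∧ HasDerivAt (fun h => ∫ x, F h x ∂μ) (∫ x, F' x ∂μ) 0 := by
  set L : ℝ →L[ℝ] ℝ →L[ℝ] ℝ := ContinuousLinearMap.smulRightL ℝ ℝ ℝ 1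
  have hL : ∀ y, L y 1 = y := fun y => by simp [L]
  obtain ⟨h1, h2⟩ := hasFDerivAt_integral_of_dominated_loc_of_lip' (𝕜 := ℝ) (F := F) (x₀ := 0)
    (F' := fun x => L (F' x)) (bound := bound) hs hF hF0
    (L.continuous.comp_aestronglyMeasurable hF')
    (by simpa using hlip) hb (hd.mono fun x hx => hx.hasFDerivAt)
  have hint : Integrable F' μ := by
    have := h1.apply_continuousLinearMap (1 : ℝ)
    simpa only [hL] using this
  refine ⟨hint, ?_⟩
  have h3 := h2.hasDerivAt
  rw [ContinuousLinearMap.integral_apply h1] at h3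
  simpa only [hL] using h3

theorem hasDerivAt_pullback (k : ℕ) (α β z : ℝ) {y : ℝ → ℝ} {y' : ℝ} (hy : HasDerivAt y y' 0)
    (hy0 : y 0 = 0) :
    HasDerivAt (fun h => pullback k α β (h, z, y h))
      (k * z ^ (k - 1) * (α + β * z) + z ^ k * β - z ^ k * y' / 2) 0 := by
  have h1 := (hasDerivAt_shift α β 0 z).pow k
  have h2 : HasDerivAt (fun h : ℝ => 1 + h * β) β 0 := by
    simpa using ((hasDerivAt_id (0 : ℝ)).mul_const β).const_add 1
  have h3 : HasDerivAt (fun h => (√(1 + y h))⁻¹) (-(y' / 2)) 0 :=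
    (((hy.const_add 1).sqrt (by simp [hy0])).inv (by simp [hy0])).congr_deriv (by simp [hy0])
  refine ((h1.mul h2).mul h3).congr_deriv ?_
  simp [hy0]
  ring

/-- The deformed kinetic energy is `(E - V)(1 + ε)` with `|ε| ≤ K C |h|` uniformly in `z`: the
excess is at most `K |h|` times the distance to the turning points, and the kinetic energy is
bounded below by a multiple of that distance. Hence the pulled back integrand is Lipschitz at `h =
0` with a constant bound. -/
theorem IsOrbit.hasDerivAt_moment {f : ℝ → ℝ} (hf : ContDiff ℝ 2 f) {a E c um up X : ℝ}
    {u p : ℝ → ℝ} (O : IsOrbit f a E c um up X u p) (hw : IsWell f a E c um up) {m : ℝ}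
    (hm : m ∈ Set.Ioo um up) {adot Edot cdot α β : ℝ}
    (hl : (f um - a - c * um) * (α + β * um) = Edot + adot * um + cdot * um ^ 2 / 2)
    (hr : (f up - a - c * up) * (α + β * up) = Edot + adot * up + cdot * up ^ 2 / 2) (k : ℕ) :
    IntegrableOn (fun x => k * u x ^ (k - 1) * (α + β * u x) + u x ^ k * β - u x ^ k *
      ((Edot + adot * u x + cdot * u x ^ 2 / 2 - (f (u x) - a - c * u x) * (α + β * u x)) /
        p x ^ 2)) (Set.Ioo 0 X) ∧
    HasDerivAt (fun h => moment f m k (deformA f c um up cdot α β h) (deformE f c um up cdot α β h)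
        (c + h * cdot))
      (2 * ∫ x in Set.Ioo 0 X, (k * u x ^ (k - 1) * (α + β * u x) + u x ^ k * β - u x ^ k *
        ((Edot + adot * u x + cdot * u x ^ 2 / 2 - (f (u x) - a - c * u x) * (α + β * u x)) /
        p x ^ 2))) 0 := by
  obtain ⟨C, hC0, hC⟩ := hw.exists_le_energy hf.continuous
  set δ : ℝ := 1 / (2 * (|β| + 1)) with hδdef
  have hδ : 0 < δ := by positivity
  have hβ : ∀ h ∈ Set.Icc (-δ) δ, 0 < 1 + h * β := by
    intro h hh
    have h1 : |h * β| ≤ 1 / 2 := by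
      rw [abs_mul]
      calc |h| * |β| ≤ δ * (|β| + 1) := by
            have := abs_le.2 hh
            gcongr
            linarith
        _ = 1 / 2 := by rw [hδdef]; field_simp
    linarith [(abs_le.1 h1).1]
  obtain ⟨K, hK0, hK⟩ := exists_excess_bound hf hw (cdot := cdot) (α := α) hδ.le hβ
  set ε : ℝ → ℝ → ℝ := fun h z => excess f a E c um up cdot α β h z / (E - potential f a c z)
    with hεdef
  have hε : ∀ h ∈ Set.Icc (-δ) δ, ∀ z ∈ Set.Ioo um up, |ε h z| ≤ K * C * |h| := by
    intro h hh z hz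
    have hG := sub_pos.2 (hw.below z hz)
    rw [hεdef, abs_div, abs_of_pos hG, div_le_iff₀ hG]
    calc _ ≤ K * |h| * min (z - um) (up - z) := hK h hh z ⟨hz.1.le, hz.2.le⟩
      _ ≤ K * |h| * (C * (E - potential f a c z)) := by
        gcongr
        exact hC z hz
      _ = _ := by ring
  have hε0 : ∀ z, ε 0 z = 0 := fun z => by
    simp [hεdef, excess, deformE_zero hw, deformA_zero hw]
  -- the set of admissible parameters
  set s : Set ℝ := {h | h ∈ Set.Icc (-δ) δ ∧ K * C * |h| ≤ 1 / 2 ∧ shift α β h um < m ∧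
    m < shift α β h up} with hsdef
  have hs : s ∈ 𝓝 (0 : ℝ) := by
    have h1 : ∀ᶠ h in 𝓝 (0 : ℝ), h ∈ Set.Icc (-δ) δ := Icc_mem_nhds (by linarith) hδ
    have h2 : ∀ᶠ h in 𝓝 (0 : ℝ), K * C * |h| < 1 / 2 := by
      have : Continuous fun h : ℝ => K * C * |h| := by fun_prop
      exact this.continuousAt.eventually_lt continuousAt_const (by simp)
    have h3 : ∀ᶠ h in 𝓝 (0 : ℝ), shift α β h um < m :=
      (hasDerivAt_shift α β 0 um).continuousAt.eventually_lt continuousAt_const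
        (by simpa using hm.1)
    have h4 : ∀ᶠ h in 𝓝 (0 : ℝ), m < shift α β h up :=
      continuousAt_const.eventually_lt (hasDerivAt_shift α β 0 up).continuousAt
        (by simpa using hm.2)
    filter_upwards [h1, h2, h3, h4] with h a1 a2 a3 a4
    exact ⟨a1, a2.le, a3, a4⟩
  have hεs : ∀ h ∈ s, ∀ z ∈ Set.Ioo um up, ε h z ∈ Set.Icc (-(1 / 2)) (1 / 2) := fun h hh z hz =>
    abs_le.1 ((hε h hh.1 z hz).trans hh.2.1)
  have hmoment : ∀ h ∈ s, moment f m k (deformA f c um up cdot α β h)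
      (deformE f c um up cdot α β h) (c + h * cdot)
        = 2 * ∫ x in Set.Ioo 0 X, pullback k α β (h, u x, ε h (u x)) := by
    intro h hh
    refine moment_deformed O hw.lt k (hβ h hh.1) (ε h) (fun z hz => ?_) (fun z hz => ?_)
      hw.below rfl (potential_shift_right f hw.lt (hβ h hh.1)) hh.2.2
    · linarith [(hεs h hh z hz).1]
    · have hG := (sub_pos.2 (hw.below z hz)).ne'
      simp only [hεdef]
      rw [mul_add, mul_one, mul_div_cancel₀ _ hG, excess]
      ring
  -- The bound `1 / 2` on the last variable keeps `1 + ε` away from the singularity of the inverse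
  -- square root.
  have hpb : ContDiffOn ℝ 1 (pullback k α β)
      (Set.Icc (-δ) δ ×ˢ (Set.Icc um up ×ˢ Set.Icc (-(1 / 2) : ℝ) (1 / 2))) := by
    unfold pullback
    refine ContDiffOn.mul (ContDiff.contDiffOn ?_) (ContDiffOn.inv (ContDiffOn.sqrt ?_ ?_) ?_)
    · unfold shift; fun_prop
    · fun_prop
    · rintro ⟨h, z, y⟩ ⟨-, -, hy⟩
      have := hy.1
      simp only at this ⊢
      linarith
    · rintro ⟨h, z, y⟩ ⟨-, -, hy⟩
      have := hy.1
      simp only at this ⊢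
      exact (Real.sqrt_pos.2 (by linarith)).ne'
  obtain ⟨K₂, hK₂0, hK₂⟩ := exists_box_bound hδ.le (isCompact_Icc.prod isCompact_Icc)
    ((convex_Icc um up).prod (convex_Icc (-(1 / 2) : ℝ) (1 / 2))) hpb
  have hcu := O.continuous_fst
  have hcp := O.continuous_snd
  have hcV := (continuous_potential hf.continuous a c)
  have hne : ∀ x ∈ Set.Ioo 0 X, E - potential f a c (u x) ≠ 0 := fun x hx =>
    (sub_pos.2 (hw.below _ (O.fst_mem hx))).ne'
  have hmeas : ∀ h ∈ s, ContinuousOn (fun x => pullback k α β (h, u x, ε h (u x)))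
      (Set.Ioo 0 X) := by
    intro h hh
    have h1 : ContinuousOn (fun x => ε h (u x)) (Set.Ioo 0 X) := by
      refine ContinuousOn.div (Continuous.continuousOn ?_) (Continuous.continuousOn ?_) hne
      · have := continuous_potential hf.continuous (deformA f c um up cdot α β h) (c + h * cdot)
        unfold excess shift
        fun_prop
      · fun_prop
    refine hpb.continuousOn.comp (continuousOn_const.prodMk (hcu.continuousOn.prodMk h1))
      fun x hx => ⟨hh.1, ?_, hεs h hh _ (O.fst_mem hx)⟩
    exact Set.Ioo_subset_Icc_self (O.fst_mem hx)
  have h0s : (0 : ℝ) ∈ s := mem_of_mem_nhds hs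
  have hpull0 : ∀ x, pullback k α β (0, u x, ε 0 (u x)) = u x ^ k := fun x => by
    simp [pullback, hε0]
  obtain ⟨hint, hder⟩ := hasDerivAt_integral_of_lip_at (μ := volume.restrict (Set.Ioo 0 X))
    (F := fun h x => pullback k α β (h, u x, ε h (u x)))
    (F' := fun x => k * u x ^ (k - 1) * (α + β * u x) + u x ^ k * β - u x ^ k *
      ((Edot + adot * u x + cdot * u x ^ 2 / 2 - (f (u x) - a - c * u x) * (α + β * u x)) /
        (E - potential f a c (u x))) / 2)
    (bound := fun _ => K₂ * (1 + K * C)) hs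
    (fun h hh => (hmeas h hh).aestronglyMeasurable measurableSet_Ioo)
    (by
      simp only [hpull0]
      exact ((hcu.pow k).integrableOn_Icc).mono_set Set.Ioo_subset_Icc_self)
    (by
      refine ContinuousOn.aestronglyMeasurable ?_ measurableSet_Ioo
      have := hf.continuous
      refine ContinuousOn.sub (by fun_prop) ?_
      refine ContinuousOn.div_const (ContinuousOn.mul (by fun_prop) ?_) 2
      exact ContinuousOn.div (by fun_prop) (by fun_prop) hne)
    (by
      filter_upwards [ae_restrict_mem measurableSet_Ioo] with x hx h hh
      have hz := O.fst_mem hx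
      have h1 := hK₂ h hh.1 (u x, ε h (u x)) ⟨Set.Ioo_subset_Icc_self hz, hεs h hh _ hz⟩
        (u x, ε 0 (u x)) ⟨Set.Ioo_subset_Icc_self hz, hεs 0 h0s _ hz⟩
      refine h1.trans ?_
      rw [mul_assoc]
      refine mul_le_mul_of_nonneg_left ?_ hK₂0
      rw [hε0, Prod.norm_def, Prod.mk_sub_mk, sub_self, norm_zero, sub_zero, Real.norm_eq_abs]
      have h2 := hε h hh.1 _ hz
      have h3 := abs_nonneg h
      have h4 : 0 ≤ K * C * |h| := by positivity
      refine max_le (by linarith) (max_le (by linarith) (by linarith)))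
    (by
      have : IntegrableOn (fun _ : ℝ => K₂ * (1 + K * C)) (Set.Ioo 0 X) volume :=
        integrableOn_const (by simp)
      exact this)
    (by
      filter_upwards [ae_restrict_mem measurableSet_Ioo] with x hx
      exact hasDerivAt_pullback k α β (u x)
        ((hasDerivAt_excess hf.continuous hw hl hr (u x)).div_const _) (hε0 _))
  have hcongr : Set.EqOn (fun x => k * u x ^ (k - 1) * (α + β * u x) + u x ^ k * β - u x ^ k *
      ((Edot + adot * u x + cdot * u x ^ 2 / 2 - (f (u x) - a - c * u x) * (α + β * u x)) /
        (E - potential f a c (u x))) / 2)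
      (fun x => k * u x ^ (k - 1) * (α + β * u x) + u x ^ k * β - u x ^ k *
      ((Edot + adot * u x + cdot * u x ^ 2 / 2 - (f (u x) - a - c * u x) * (α + β * u x)) /
        p x ^ 2)) (Set.Ioo 0 X) := by
    intro x hx
    have := (O.snd_pos x hx).ne'
    simp only [← O.energy]
    field_simp
  refine ⟨IntegrableOn.congr_fun hint hcongr measurableSet_Ioo, ?_⟩
  rw [setIntegral_congr_fun measurableSet_Ioo hcongr] at hder
  refine (hder.const_mul 2).congr_of_eventuallyEq ?_
  filter_upwards [hs] with h hh using hmoment h hh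

theorem IsOrbit.moment_eq {f : ℝ → ℝ} {a E c um up X : ℝ}
    {u p : ℝ → ℝ} (O : IsOrbit f a E c um up X u p) (hw : IsWell f a E c um up) {m : ℝ}
    (hm : m ∈ Set.Ioo um up) (k : ℕ) :
    moment f m k a E c = 2 * ∫ x in Set.Ioo 0 X, u x ^ k := by
  have := moment_deformed O hw.lt k (m := m) (a' := a) (E' := E) (c' := c) (α := 0) (β := 0)
    (h := 0) (by simp) (fun _ => 0) (by simp) (by simp) hw.below (by simpa using hw.left_root)
    (by simpa using hw.right_root) (by simpa using hm)
  rw [this]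
  simp [pullback]

end GKdV

end

noncomputable section

namespace GKdV

/-! ### The derivatives of the moments through the linearized equation -/

/-- `w` is the variation of the wave profile in the parameter direction `(adot, Edot, cdot)`, and
`w'` its derivative. -/
structure IsVariation (f : ℝ → ℝ) (a c um : ℝ) (u : ℝ → ℝ) (adot Edot cdot : ℝ) (w w' : ℝ → ℂ) :
    Prop where
  hasDerivAt_fst : ∀ x, HasDerivAt w (w' x) x
  hasDerivAt_snd : ∀ x, HasDerivAt w'
    (((c - deriv f (u x) : ℝ) : ℂ) * w x + ((adot + cdot * u x : ℝ) : ℂ)) x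
  fst_zero : w 0 = ((-(Edot + adot * um + cdot * um ^ 2 / 2) / (a - f um + c * um) : ℝ) : ℂ)
  snd_zero : w' 0 = 0

/-- The direction in which the excess kinetic energy moves along the shift. -/
def excessRate (f : ℝ → ℝ) (a c adot Edot cdot α β z : ℝ) : ℝ :=
  Edot + adot * z + cdot * z ^ 2 / 2 - (f z - a - c * z) * (α + β * z)

section

variable {f : ℝ → ℝ} {a E c um up X : ℝ} {u p : ℝ → ℝ} {adot Edot cdot : ℝ} {w w' : ℝ → ℂ}

theorem IsOrbit.hasDerivAt_acc (O : IsOrbit f a E c um up X u p) (hf : ContDiff ℝ 2 f) (x : ℝ) :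
    HasDerivAt (fun x => a - f (u x) + c * u x) ((c - deriv f (u x)) * p x) x := by
  have h1 : HasDerivAt f (deriv f (u x)) (u x) :=
    (hf.differentiable (by norm_num) _).hasDerivAt
  have h2 := h1.comp x (O.hasDerivAt_fst x)
  exact ((h2.const_sub a).add ((O.hasDerivAt_fst x).const_mul c)).congr_deriv (by ring)

/-- This is the energy relation differentiated in the parameters. The difference of the two sides
has zero derivative in `x`, and the value of `w 0` is what makes it vanish at `x = 0`. -/
theorem IsVariation.energy (hw : IsVariation f a c um u adot Edot cdot w w')
    (O : IsOrbit f a E c um up X u p) (hf : ContDiff ℝ 2 f) (x : ℝ) :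
    p x * w' x - ((a - f (u x) + c * u x : ℝ) : ℂ) * w x
      = ((Edot + adot * u x + cdot * u x ^ 2 / 2 : ℝ) : ℂ) := by
  set G : ℝ → ℂ := fun x => p x * w' x - ((a - f (u x) + c * u x : ℝ) : ℂ) * w x -
    ((Edot + adot * u x + cdot * u x ^ 2 / 2 : ℝ) : ℂ)
  have hder : ∀ x, HasDerivAt G 0 x := by
    intro x
    have h1 := (O.hasDerivAt_snd x).ofReal_comp.mul (hw.hasDerivAt_snd x)
    have h2 := (O.hasDerivAt_acc hf x).ofReal_comp.mul (hw.hasDerivAt_fst x)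
    have h3 := (((O.hasDerivAt_fst x).const_mul adot).const_add Edot).add
      ((((O.hasDerivAt_fst x).pow 2).const_mul cdot).div_const 2)
    refine ((h1.sub h2).sub h3.ofReal_comp).congr_deriv ?_
    push_cast
    ring
  have hc := is_const_of_deriv_eq_zero (f := G) (fun x => (hder x).differentiableAt)
    (fun x => (hder x).deriv) x 0
  have h0 : G 0 = 0 := by
    have := O.left_slope.ne'
    simp only [G, O.snd_zero, O.fst_zero, hw.fst_zero, hw.snd_zero]
    rw [← Complex.ofReal_mul, mul_div_cancel₀ _ this]
    push_cast
    ring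
  rw [h0] at hc
  exact sub_eq_zero.1 hc

/-- At a turning point, the variation is the velocity of the turning point. -/
theorem IsVariation.eq_of_snd_eq_zero (hw : IsVariation f a c um u adot Edot cdot w w')
    (O : IsOrbit f a E c um up X u p) (hf : ContDiff ℝ 2 f) {α β y : ℝ} (hp : p y = 0)
    (hne : a - f (u y) + c * u y ≠ 0)
    (h : (f (u y) - a - c * u y) * (α + β * u y) = Edot + adot * u y + cdot * u y ^ 2 / 2) :
    w y = ((α + β * u y : ℝ) : ℂ) := by
  have h1 := hw.energy O hf y
  rw [hp, ← h] at h1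
  have h2 : ((a - f (u y) + c * u y : ℝ) : ℂ) ≠ 0 := by exact_mod_cast hne
  apply mul_left_cancel₀ h2
  push_cast at h1 ⊢
  linear_combination -h1

/-- L'Hôpital's rule at a simple zero of the denominator, as a quotient of slopes. -/
theorem tendsto_div_of_hasDerivAt {r : ℝ → ℂ} {p : ℝ → ℝ} {r' : ℂ} {p' y : ℝ} {l : Filter ℝ}
    (hl : l ≤ 𝓝[≠] y) (hr : HasDerivAt r r' y) (hp : HasDerivAt p p' y) (hr0 : r y = 0)
    (hp0 : p y = 0) (hne : p' ≠ 0) : Tendsto (fun x => r x / p x) l (𝓝 (r' / p')) := by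
  have h1 := (hasDerivAt_iff_tendsto_slope.1 hr).mono_left hl
  have h2 := (hasDerivAt_iff_tendsto_slope.1 hp.ofReal_comp).mono_left hl
  refine (h1.div h2 (by exact_mod_cast hne)).congr' ?_
  filter_upwards [hl self_mem_nhdsWithin] with x hx
  have hxy : (x - y : ℝ) ≠ 0 := sub_ne_zero.2 hx
  simp only [slope, vsub_eq_sub, hr0, hp0, sub_zero, Pi.div_apply, Complex.ofReal_zero]
  rw [Complex.real_smul, Complex.real_smul, mul_div_mul_left]
  exact_mod_cast inv_ne_zero hxy

/-- Integration of the moment density between consecutive turning points. -/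
theorem IsVariation.integral_eq (hw : IsVariation f a c um u adot Edot cdot w w')
    (O : IsOrbit f a E c um up X u p) (hf : ContDiff ℝ 2 f) {α β y₀ y₁ : ℝ} (hy : y₀ < y₁)
    (hpne : ∀ x ∈ Set.Ioo y₀ y₁, p x ≠ 0)
    (hp : ∀ y ∈ ({y₀, y₁} : Set ℝ), p y = 0 ∧ a - f (u y) + c * u y ≠ 0 ∧
      (f (u y) - a - c * u y) * (α + β * u y) = Edot + adot * u y + cdot * u y ^ 2 / 2)
    (k : ℕ)
    (hint : IntervalIntegrable (fun x => k * u x ^ (k - 1) * (α + β * u x) + u x ^ k * β -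
      u x ^ k * (excessRate f a c adot Edot cdot α β (u x) / p x ^ 2)) volume y₀ y₁) :
    ((∫ x in y₀..y₁, (k * u x ^ (k - 1) * (α + β * u x) + u x ^ k * β -
      u x ^ k * (excessRate f a c adot Edot cdot α β (u x) / p x ^ 2)) : ℝ) : ℂ)
    = (∫ x in y₀..y₁, k * (u x : ℂ) ^ (k - 1) * w x)
      - ((u y₁ : ℂ) ^ k * (w' y₁ / ((a - f (u y₁) + c * u y₁ : ℝ) : ℂ))
      - (u y₀ : ℂ) ^ k * (w' y₀ / ((a - f (u y₀) + c * u y₀ : ℝ) : ℂ))) := by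
  set I : ℝ → ℝ := fun x => k * u x ^ (k - 1) * (α + β * u x) + u x ^ k * β -
      u x ^ k * (excessRate f a c adot Edot cdot α β (u x) / p x ^ 2) with hI
  set r : ℝ → ℂ := fun x => w x - ((α + β * u x : ℝ) : ℂ) with hr
  have hrd : ∀ x, HasDerivAt r (w' x - ((β * p x : ℝ) : ℂ)) x := fun x =>
    (hw.hasDerivAt_fst x).sub (((O.hasDerivAt_fst x).const_mul β).const_add α).ofReal_comp
  -- By the energy identity, the singular density `I` minus the regular term `k u^(k-1) w` is
  -- exactly `H'`. The affine motion subtracted in `r` agrees with `w` at the turning points, so `H`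
  -- has finite limits there.
  set H : ℝ → ℂ := fun x => -((u x : ℂ) ^ k * (r x / p x)) with hH
  have hHd : ∀ x ∈ Set.Ioo y₀ y₁, HasDerivAt H ((I x : ℂ) - k * (u x : ℂ) ^ (k - 1) * w x) x := by
    intro x hx
    have hpx : (p x : ℂ) ≠ 0 := by exact_mod_cast hpne x hx
    have h1 := (((O.hasDerivAt_fst x).ofReal_comp).pow k).mul
      ((hrd x).div (O.hasDerivAt_snd x).ofReal_comp hpx)
    refine h1.neg.congr_deriv ?_
    have hen := hw.energy O hf x
    simp only [hI, hr, excessRate]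
    simp only [Complex.ofReal_sub, Complex.ofReal_add, Complex.ofReal_mul, Complex.ofReal_div,
      Complex.ofReal_pow, Complex.ofReal_natCast, Complex.ofReal_ofNat, Pi.pow_apply,
      Pi.div_apply] at hen ⊢
    rw [← hen]
    field_simp
    ring
  have hcu := O.continuous_fst
  have hcw : Continuous w := continuous_iff_continuousAt.2 fun x =>
    (hw.hasDerivAt_fst x).continuousAt
  have hik : IntervalIntegrable (fun x => k * (u x : ℂ) ^ (k - 1) * w x) volume y₀ y₁ :=
    Continuous.intervalIntegrable (by fun_prop) _ _
  have hiI : IntervalIntegrable (fun x => (I x : ℂ)) volume y₀ y₁ :=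
    ⟨hint.1.ofReal, hint.2.ofReal⟩
  have hlim : ∀ y ∈ ({y₀, y₁} : Set ℝ), ∀ l : Filter ℝ, l ≤ 𝓝[≠] y → Tendsto H l
      (𝓝 (-((u y : ℂ) ^ k * (w' y / ((a - f (u y) + c * u y : ℝ) : ℂ))))) := by
    intro y hy l hl
    obtain ⟨h1, h2, h3⟩ := hp y hy
    have h4 := tendsto_div_of_hasDerivAt hl (hrd y) (O.hasDerivAt_snd y)
      (by simp only [hr]; rw [hw.eq_of_snd_eq_zero O hf h1 h2 h3, sub_self]) h1 h2
    rw [h1, mul_zero, Complex.ofReal_zero, sub_zero] at h4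
    have h5 : Tendsto (fun x => (u x : ℂ) ^ k) l (𝓝 ((u y : ℂ) ^ k)) := by
      have : Continuous fun x => (u x : ℂ) ^ k := by fun_prop
      exact (this.tendsto y).mono_left (hl.trans nhdsWithin_le_nhds)
    exact (h5.mul h4).neg
  have hFTC := intervalIntegral.integral_eq_sub_of_hasDerivAt_of_tendsto hy hHd (hiI.sub hik)
    (hlim y₀ (by simp) (𝓝[>] y₀) (nhdsWithin_mono _ fun x hx => ne_of_gt hx))
    (hlim y₁ (by simp) (𝓝[<] y₁) (nhdsWithin_mono _ fun x hx => ne_of_lt hx))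
  rw [intervalIntegral.integral_sub hiI hik] at hFTC
  rw [← intervalIntegral.integral_ofReal]
  linear_combination hFTC

theorem IsOrbit.snd_reflect (O : IsOrbit f a E c um up X u p) (x : ℝ) : p (2 * X - x) = -p x := by
  have h1 := (O.hasDerivAt_fst (2 * X - x)).comp_const_sub (2 * X) x
  have h2 : (fun x => u (2 * X - x)) = u := funext O.reflect
  rw [h2] at h1
  linarith [h1.unique (O.hasDerivAt_fst x)]

theorem IsOrbit.snd_periodic (O : IsOrbit f a E c um up X u p) (x : ℝ) : p (x + 2 * X) = p x := by
  have h1 := (O.hasDerivAt_fst (x + 2 * X)).comp_add_const x (2 * X)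
  have h2 : (fun x => u (x + 2 * X)) = u := funext O.periodic
  rw [h2] at h1
  exact h1.unique (O.hasDerivAt_fst x)

/-- The derivatives of the moments along a deformation of the well. -/
theorem IsVariation.exists_deformation (hv : IsVariation f a c um u adot Edot cdot w w')
    (O : IsOrbit f a E c um up X u p) (hf : ContDiff ℝ 2 f) (hw : IsWell f a E c um up) {m : ℝ}
    (hm : m ∈ Set.Ioo um up) :
    ∃ A B : ℝ → ℝ, A 0 = a ∧ B 0 = E ∧ HasDerivAt A adot 0 ∧ HasDerivAt B Edot 0 ∧
      ∀ k : ℕ, ∃ D : ℝ, HasDerivAt (fun h => moment f m k (A h) (B h) (c + h * cdot)) D 0 ∧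
        (D : ℂ) = (∫ x in (0 : ℝ)..2 * X, k * (u x : ℂ) ^ (k - 1) * w x)
          - (um : ℂ) ^ k * (w' (2 * X) / ((a - f um + c * um : ℝ) : ℂ)) := by
  have hql := O.left_slope.ne'
  have hqr := O.right_slope.ne
  have hd : up - um ≠ 0 := (sub_pos.2 hw.lt).ne'
  obtain ⟨α, β, hl, hr⟩ : ∃ α β : ℝ,
      (f um - a - c * um) * (α + β * um) = Edot + adot * um + cdot * um ^ 2 / 2 ∧
      (f up - a - c * up) * (α + β * up) = Edot + adot * up + cdot * up ^ 2 / 2 := by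
    -- `s` and `t` are the velocities forced on the two turning points; `α + β z` is their linear
    -- interpolation.
    set s := (Edot + adot * um + cdot * um ^ 2 / 2) / (f um - a - c * um)
    set t := (Edot + adot * up + cdot * up ^ 2 / 2) / (f up - a - c * up)
    have h1 : f um - a - c * um ≠ 0 := fun h => hql (by linarith)
    have h2 : f up - a - c * up ≠ 0 := fun h => hqr (by linarith)
    refine ⟨s - (t - s) / (up - um) * um, (t - s) / (up - um), ?_, ?_⟩
    · rw [show s - (t - s) / (up - um) * um + (t - s) / (up - um) * um = s by ring]
      exact mul_div_cancel₀ _ h1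
    · rw [show s - (t - s) / (up - um) * um + (t - s) / (up - um) * up = t by field_simp; ring]
      exact mul_div_cancel₀ _ h2
  refine ⟨_, _, deformA_zero hw cdot α β, deformE_zero hw cdot α β,
    hasDerivAt_deformA hf.continuous hw hl hr, hasDerivAt_deformE hf.continuous hw hl hr,
    fun k => ?_⟩
  obtain ⟨hint, hder⟩ := O.hasDerivAt_moment hf hw hm hl hr k
  refine ⟨_, hder, ?_⟩
  set I : ℝ → ℝ := fun x => k * u x ^ (k - 1) * (α + β * u x) + u x ^ k * β -
      u x ^ k * (excessRate f a c adot Edot cdot α β (u x) / p x ^ 2) with hI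
  have hint1 : IntervalIntegrable I volume 0 X := by
    rw [intervalIntegrable_iff_integrableOn_Ioo_of_le O.pos.le]
    exact hint
  -- Only `p²` enters `I`, so the second half period contributes as much as the first. In the sum
  -- the boundary terms at `X` cancel, and `w' 0 = 0` leaves only the term at `2 X`.
  have hrefl : ∀ x, I (2 * X - x) = I x := fun x => by
    simp only [hI, O.reflect, O.snd_reflect, neg_sq]
  have hint2 : IntervalIntegrable I volume X (2 * X) := by
    have := (hint1.comp_sub_left (2 * X)).symm
    simp only [hrefl] at this
    rwa [sub_zero, show 2 * X - X = X by ring] at this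
  have heq2 : ∫ x in X..2 * X, I x = ∫ x in (0 : ℝ)..X, I x := by
    have := intervalIntegral.integral_comp_sub_left (a := 0) (b := X) I (2 * X)
    simp only [hrefl] at this
    rw [this, sub_zero, show 2 * X - X = X by ring]
  have huT : u (2 * X) = um := by
    have := O.periodic 0
    rwa [zero_add, O.fst_zero] at this
  have hpT : p (2 * X) = 0 := by
    have := O.snd_periodic 0
    rwa [zero_add, O.snd_zero] at this
  have e1 := hv.integral_eq O hf O.pos (fun x hx => (O.snd_pos x hx).ne')
    (α := α) (β := β) (by
      rintro y (rfl | rfl)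
      · rw [O.fst_zero]; exact ⟨O.snd_zero, hql, hl⟩
      · rw [O.fst_half]; exact ⟨O.snd_half, hqr, hr⟩) k hint1
  have e2 := hv.integral_eq O hf (show X < 2 * X by linarith [O.pos]) (fun x hx => by
      have := O.snd_pos (2 * X - x) ⟨by linarith [hx.2], by linarith [hx.1]⟩
      rw [O.snd_reflect] at this
      linarith)
    (α := α) (β := β) (by
      rintro y (rfl | rfl)
      · rw [O.fst_half]; exact ⟨O.snd_half, hqr, hr⟩
      · rw [huT]; exact ⟨hpT, hql, hl⟩) k hint2
  rw [heq2] at e2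
  have hcu := O.continuous_fst
  have hcw : Continuous w := continuous_iff_continuousAt.2 fun x =>
    (hv.hasDerivAt_fst x).continuousAt
  have hc : Continuous fun x => k * (u x : ℂ) ^ (k - 1) * w x := by fun_prop
  rw [← intervalIntegral.integral_add_adjacent_intervals (hc.intervalIntegrable 0 X)
    (hc.intervalIntegrable X (2 * X))]
  rw [intervalIntegral.integral_of_le O.pos.le, integral_Ioc_eq_integral_Ioo] at e1 e2
  rw [huT] at e2
  rw [hv.snd_zero] at e1
  push_cast at e1 e2 ⊢
  change 2 * ((∫ x in Set.Ioo 0 X, I x : ℝ) : ℂ) = _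
  linear_combination e1 + e2

/-- The partial derivatives of period, mass and momentum through the variations of the profile. -/
theorem IsVariation.fderiv_tmp (hv : IsVariation f a c um u adot Edot cdot w w')
    (O : IsOrbit f a E c um up X u p) (hf : ContDiff ℝ 2 f) (hw : IsWell f a E c um up) {m : ℝ}
    (hm : m ∈ Set.Ioo um up) (hd : DifferentiableAt ℝ (tmp f m) ![a, E, c]) (k : Fin 3) :
    ((fderiv ℝ (tmp f m) ![a, E, c] ![adot, Edot, cdot] k : ℝ) : ℂ)
      = (∫ x in (0 : ℝ)..2 * X, ((k : ℕ) : ℂ) * (u x : ℂ) ^ ((k : ℕ) - 1) * w x)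
          - (um : ℂ) ^ (k : ℕ) * (w' (2 * X) / ((a - f um + c * um : ℝ) : ℂ)) := by
  obtain ⟨A, B, hA0, hB0, hA, hB, hD⟩ := hv.exists_deformation O hf hw hm
  obtain ⟨D, hD1, hD2⟩ := hD k
  rw [← hD2]
  congr 1
  -- Differentiability of `tmp f m` makes the derivative along this single curve equal to the
  -- directional derivative in its tangent direction.
  set γ : ℝ → Fin 3 → ℝ := fun h => ![A h, B h, c + h * cdot] with hγ
  have hγd : HasDerivAt γ ![adot, Edot, cdot] 0 := by
    rw [hasDerivAt_pi]
    intro i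
    fin_cases i
    · exact hA
    · exact hB
    · simpa [hγ] using ((hasDerivAt_id (0 : ℝ)).mul_const cdot).const_add c
  have hγ0 : γ 0 = ![a, E, c] := by simp [hγ, hA0, hB0]
  have h1 : HasFDerivAt (tmp f m) (fderiv ℝ (tmp f m) ![a, E, c]) (γ 0) := by
    rw [hγ0]; exact hd.hasFDerivAt
  have h2 := hasDerivAt_pi.1 (h1.comp_hasDerivAt (0 : ℝ) hγd) k
  refine h2.unique (hD1.congr_of_eventuallyEq (Eventually.of_forall fun h => ?_))
  fin_cases k <;> rfl

end

end GKdV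

end

noncomputable section

namespace GKdV

/-! ### Solutions of the eigenvalue problem -/

/-- The elementary matrix with the entry `1` in row `i` and column `j`, as an operator. -/
def unitOp {n : ℕ} (i j : Fin n) : (Fin n → ℂ) →L[ℂ] (Fin n → ℂ) :=
  (ContinuousLinearMap.proj j : (Fin n → ℂ) →L[ℂ] ℂ).smulRight (Pi.single i (1 : ℂ))

@[simp] theorem unitOp_apply {n : ℕ} (i j : Fin n) (z : Fin n → ℂ) (l : Fin n) :
    unitOp i j z l = if l = i then z j else 0 := by
  simp [unitOp, Pi.single_apply]

/-- Uniqueness for the system `v' = v₁`, `v₁' = k v - l`, `l' = μ v`. -/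
theorem third_order_eq_zero {k : ℝ → ℝ} {C : ℝ} (hk : ∀ x, |k x| ≤ C) {μ : ℂ}
    {v v₁ l : ℝ → ℂ} (h0 : ∀ x, HasDerivAt v (v₁ x) x)
    (h1 : ∀ x, HasDerivAt v₁ ((k x : ℂ) * v x - l x) x) (h2 : ∀ x, HasDerivAt l (μ * v x) x)
    (hv : v 0 = 0) (hv₁ : v₁ 0 = 0) (hl : l 0 = 0) : v = 0 := by
  set A : ℝ → (Fin 3 → ℂ) →L[ℂ] (Fin 3 → ℂ) := fun x =>
    unitOp 0 1 + (k x : ℂ) • unitOp 1 0 - unitOp 1 2 + μ • unitOp 2 0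
  have hA : ∀ x, ‖A x‖ ≤ ‖(unitOp 0 1 : (Fin 3 → ℂ) →L[ℂ] (Fin 3 → ℂ))‖
      + C * ‖(unitOp 1 0 : (Fin 3 → ℂ) →L[ℂ] (Fin 3 → ℂ))‖
      + ‖(unitOp 1 2 : (Fin 3 → ℂ) →L[ℂ] (Fin 3 → ℂ))‖
      + ‖μ • (unitOp 2 0 : (Fin 3 → ℂ) →L[ℂ] (Fin 3 → ℂ))‖ := by
    intro x
    refine (norm_add_le _ _).trans (add_le_add_left ((norm_sub_le _ _).trans (add_le_add_left
      ((norm_add_le _ _).trans (add_le_add_right ?_ _)) _)) _)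
    rw [norm_smul, Complex.norm_real]
    exact mul_le_mul_of_nonneg_right (hk x) (norm_nonneg _)
  have hZ := linear_ode_eq_zero A hA (Z := fun x => ![v x, v₁ x, l x]) (t₀ := 0) (fun x => by
    rw [hasDerivAt_pi]
    intro i
    fin_cases i
    · simpa [A] using h0 x
    · simpa [A] using h1 x
    · simpa [A] using h2 x) (by
    ext i
    fin_cases i
    · simpa using hv
    · simpa using hv₁
    · simpa using hl)
  funext x
  exact congrFun (congrFun hZ x) 0

theorem _root_.Function.Periodic.exists_abs_le {k : ℝ → ℝ} {T : ℝ} (hT : 0 < T)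
    (hp : Function.Periodic k T) (hk : Continuous k) : ∃ C, ∀ x, |k x| ≤ C := by
  obtain ⟨C, hC⟩ := isCompact_Icc.exists_bound_of_continuousOn (s := Set.Icc 0 T) hk.continuousOn
  refine ⟨C, fun x => ?_⟩
  obtain ⟨y, hy, hxy⟩ := hp.exists_mem_Ico₀ hT x
  rw [hxy]
  exact hC y ⟨hy.1, hy.2.le⟩

/-- The data of a modulation in the direction `e = (ȧ, Ė, ṡ)`: `e₂ u' + μ v` solves the eigenvalue
problem, `m` and `q` are primitives of `v` and `u v`. -/
structure IsModulation (f : ℝ → ℝ) (a c um : ℝ) (u : ℝ → ℝ) (e : Fin 3 → ℂ) (μ : ℂ)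
    (v v₁ m q : ℝ → ℂ) : Prop where
  hasDerivAt_fst : ∀ x, HasDerivAt v (v₁ x) x
  hasDerivAt_snd : ∀ x, HasDerivAt v₁
    (((c - deriv f (u x) : ℝ) : ℂ) * v x + (e 0 - e 2 * u x) - μ * m x) x
  hasDerivAt_mass : ∀ x, HasDerivAt m (v x) x
  hasDerivAt_momentum : ∀ x, HasDerivAt q (u x * v x) x
  fst_zero : v 0 = -(e 1 + e 0 * um - e 2 * um ^ 2 / 2) / ((a - f um + c * um : ℝ) : ℂ)
  snd_zero : v₁ 0 = 0
  mass_zero : m 0 = 0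
  momentum_zero : q 0 = 0

section

variable {f : ℝ → ℝ} {a E c um up X : ℝ} {u p : ℝ → ℝ}

theorem IsOrbit.continuous_coeff (O : IsOrbit f a E c um up X u p) (hf : ContDiff ℝ 2 f) :
    ContDiff ℝ 1 fun x => c - deriv f (u x) := by
  have h1 : ContDiff ℝ 1 (deriv f) := (contDiff_succ_iff_deriv (n := 1)).1 hf |>.2.2
  have h2 : ContDiff ℝ 1 u := by
    rw [contDiff_one_iff_deriv]
    refine ⟨fun x => (O.hasDerivAt_fst x).differentiableAt, ?_⟩
    rw [show deriv u = p from funext fun x => (O.hasDerivAt_fst x).deriv]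
    exact O.continuous_snd
  exact contDiff_const.sub (h1.comp h2)

theorem IsOrbit.exists_coeff_bound (O : IsOrbit f a E c um up X u p) (hf : ContDiff ℝ 2 f) :
    ∃ C, ∀ x, |c - deriv f (u x)| ≤ C :=
  Function.Periodic.exists_abs_le (T := 2 * X) (by linarith [O.pos])
    (fun x => by simp only [O.periodic]) (O.continuous_coeff hf).continuous

/-- With the primitives `m` and `q` as additional unknowns the problem is a linear first order
system in four unknowns, in which `μ` occurs in a single entry. -/
theorem IsOrbit.exists_modulation (O : IsOrbit f a E c um up X u p) (hf : ContDiff ℝ 2 f)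
    (e : Fin 3 → ℂ) :
    ∃ v v₁ m q : ℂ → ℝ → ℂ,
      (∀ᶠ μ in 𝓝 0, IsModulation f a c um u e μ (v μ) (v₁ μ) (m μ) (q μ)) ∧
      ∀ x, ContDiffAt ℂ 1 (fun μ => v₁ μ x) 0 ∧ ContDiffAt ℂ 1 (fun μ => m μ x) 0 ∧
        ContDiffAt ℂ 1 (fun μ => q μ x) 0 := by
  obtain ⟨C, hC⟩ := O.exists_coeff_bound hf
  have hcu := O.continuous_fst
  obtain ⟨C', hC'⟩ := Function.Periodic.exists_abs_le (T := 2 * X) (by linarith [O.pos])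
    O.periodic hcu
  have hk := (O.continuous_coeff hf).continuous
  set k : ℝ → ℝ := fun x => c - deriv f (u x)
  set A : ℝ → (Fin 4 → ℂ) →L[ℂ] (Fin 4 → ℂ) := fun x =>
    unitOp 0 1 + (k x : ℂ) • unitOp 1 0 + unitOp 2 0 + (u x : ℂ) • unitOp 3 0
  have hA : Continuous A := by fun_prop
  have hAb : ∀ x, ‖A x‖ ≤ ‖(unitOp 0 1 : (Fin 4 → ℂ) →L[ℂ] (Fin 4 → ℂ))‖
      + C * ‖(unitOp 1 0 : (Fin 4 → ℂ) →L[ℂ] (Fin 4 → ℂ))‖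
      + ‖(unitOp 2 0 : (Fin 4 → ℂ) →L[ℂ] (Fin 4 → ℂ))‖
      + C' * ‖(unitOp 3 0 : (Fin 4 → ℂ) →L[ℂ] (Fin 4 → ℂ))‖ := by
    intro x
    refine (norm_add_le _ _).trans (add_le_add ((norm_add_le _ _).trans (add_le_add_left
      ((norm_add_le _ _).trans (add_le_add_right ?_ _)) _)) ?_)
    · rw [norm_smul, Complex.norm_real]
      exact mul_le_mul_of_nonneg_right (hC x) (norm_nonneg _)
    · rw [norm_smul, Complex.norm_real]
      exact mul_le_mul_of_nonneg_right (hC' x) (norm_nonneg _)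
  obtain ⟨Z, hZ, hZs⟩ := exists_linear_ode_solution A
    (fun _ => -(unitOp 1 2 : (Fin 4 → ℂ) →L[ℂ] (Fin 4 → ℂ))) hA continuous_const hAb
    (fun _ => le_rfl) (fun x => (e 0 - e 2 * u x) • Pi.single 1 (1 : ℂ)) (by fun_prop)
    (Cb := (‖e 0‖ + ‖e 2‖ * C') * ‖(Pi.single 1 1 : Fin 4 → ℂ)‖)
    (fun x => by
      rw [norm_smul]
      refine mul_le_mul_of_nonneg_right ((norm_sub_le _ _).trans (add_le_add_right ?_ _))
        (norm_nonneg _)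
      rw [norm_mul, Complex.norm_real]
      exact mul_le_mul_of_nonneg_left (hC' x) (norm_nonneg _))
    (Pi.single 0 (-(e 1 + e 0 * um - e 2 * um ^ 2 / 2) / ((a - f um + c * um : ℝ) : ℂ)))
  refine ⟨fun μ x => Z μ x 0, fun μ x => Z μ x 1, fun μ x => Z μ x 2, fun μ x => Z μ x 3, ?_,
    fun x => ?_⟩
  · filter_upwards [hZ] with μ hμ
    obtain ⟨h0, hd⟩ := hμ
    have hd' := fun x => hasDerivAt_pi.1 (hd x)
    refine ⟨fun x => ?_, fun x => ?_, fun x => ?_, fun x => ?_, ?_, ?_, ?_, ?_⟩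
    · simpa [A] using hd' x 0
    · refine (hd' x 1).congr_deriv ?_
      simp [A, k]
      ring
    · simpa [A] using hd' x 2
    · simpa [A] using hd' x 3
    all_goals simp [h0]
  · have h := contDiffAt_pi.1 (hZs x)
    exact ⟨h 1, h 2, h 3⟩

/-- At `μ = 0` the coupling to `m` disappears. The sign of `e 2` comes from `c = c₀ - s`. -/
theorem IsModulation.isVariation {v v₁ m q : ℝ → ℂ} {e : Fin 3 → ℝ}
    (h : IsModulation f a c um u (fun i => e i) 0 v v₁ m q) :
    IsVariation f a c um u (e 0) (e 1) (-e 2) v v₁ where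
  hasDerivAt_fst := h.hasDerivAt_fst
  hasDerivAt_snd x := (h.hasDerivAt_snd x).congr_deriv (by push_cast; ring)
  fst_zero := by rw [h.fst_zero]; push_cast; ring
  snd_zero := h.snd_zero

/-- The kernel vectors found later are complex, while variations are attached to real directions;
superposition of the three basis directions bridges the two. -/
theorem IsModulation.sum {μ : ℂ} {V V₁ M Q : Fin 3 → ℝ → ℂ} {ε : Fin 3 → Fin 3 → ℂ}
    (h : ∀ j, IsModulation f a c um u (ε j) μ (V j) (V₁ j) (M j) (Q j)) (e : Fin 3 → ℂ) :
    IsModulation f a c um u (fun i => ∑ j, e j * ε j i) μ (fun x => ∑ j, e j * V j x)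
      (fun x => ∑ j, e j * V₁ j x) (fun x => ∑ j, e j * M j x) (fun x => ∑ j, e j * Q j x) where
  hasDerivAt_fst x := HasDerivAt.fun_sum fun j _ => ((h j).hasDerivAt_fst x).const_mul (e j)
  hasDerivAt_snd x :=
    (HasDerivAt.fun_sum fun j _ => ((h j).hasDerivAt_snd x).const_mul (e j)).congr_deriv (by
      simp only [Fin.sum_univ_three]; ring)
  hasDerivAt_mass x := HasDerivAt.fun_sum fun j _ => ((h j).hasDerivAt_mass x).const_mul (e j)
  hasDerivAt_momentum x :=
    (HasDerivAt.fun_sum fun j _ => ((h j).hasDerivAt_momentum x).const_mul (e j)).congr_deriv (by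
      simp only [Fin.sum_univ_three]; ring)
  fst_zero := by
    simp only [(h _).fst_zero, Fin.sum_univ_three]; ring
  snd_zero := by simp [(h _).snd_zero]
  mass_zero := by simp [(h _).mass_zero]
  momentum_zero := by simp [(h _).momentum_zero]

/-- The extension of the energy identity to `μ ≠ 0`. Where `p = 0` it expresses `v` through `m` and
`q`, so that the Floquet condition on `v` can be traded for one on `q`. -/
theorem IsModulation.conservation {v v₁ m q : ℝ → ℂ} {e : Fin 3 → ℂ} {μ : ℂ}
    (h : IsModulation f a c um u e μ v v₁ m q) (O : IsOrbit f a E c um up X u p)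
    (hf : ContDiff ℝ 2 f) (x : ℝ) :
    p x * v₁ x - ((a - f (u x) + c * u x : ℝ) : ℂ) * v x + u x * (-e 0 + e 2 * u x + μ * m x)
      = e 1 + e 2 * u x ^ 2 / 2 + μ * q x := by
  set G : ℝ → ℂ := fun x => p x * v₁ x - ((a - f (u x) + c * u x : ℝ) : ℂ) * v x +
    u x * (-e 0 + e 2 * u x + μ * m x) - (e 1 + e 2 * u x ^ 2 / 2 + μ * q x) with hG
  have hder : ∀ x, HasDerivAt G 0 x := by
    intro x
    have hu := (O.hasDerivAt_fst x).ofReal_comp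
    have h1 := (O.hasDerivAt_snd x).ofReal_comp.mul (h.hasDerivAt_snd x)
    have h2 := (O.hasDerivAt_acc hf x).ofReal_comp.mul (h.hasDerivAt_fst x)
    have h3 := hu.mul (((hu.const_mul (e 2)).const_add (-e 0)).add
      ((h.hasDerivAt_mass x).const_mul μ))
    have h4 := ((((hu.pow 2).const_mul (e 2)).div_const 2).const_add (e 1)).add
      ((h.hasDerivAt_momentum x).const_mul μ)
    refine (((h1.sub h2).add h3).sub h4).congr_deriv ?_
    push_cast
    simp
    ring
  have hc := is_const_of_deriv_eq_zero (f := G) (fun x => (hder x).differentiableAt)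
    (fun x => (hder x).deriv) x 0
  have h0 : G 0 = 0 := by
    have : ((a - f um + c * um : ℝ) : ℂ) ≠ 0 := by exact_mod_cast O.left_slope.ne'
    simp only [hG, O.snd_zero, O.fst_zero, h.fst_zero, h.snd_zero, h.mass_zero, h.momentum_zero]
    rw [mul_div_cancel₀ _ this]
    push_cast
    ring
  rw [h0] at hc
  exact sub_eq_zero.1 hc

/-- A solution of the first order system gives a classical Floquet solution. -/
theorem IsOrbit.isFloquetSolution (O : IsOrbit f a E c um up X u p) (hf : ContDiff ℝ 2 f) {μ : ℂ}
    {κ : ℝ} {v v₁ l : ℝ → ℂ} (h0 : ∀ x, HasDerivAt v (v₁ x) x)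
    (h1 : ∀ x, HasDerivAt v₁ (((c - deriv f (u x) : ℝ) : ℂ) * v x - l x) x)
    (h2 : ∀ x, HasDerivAt l (μ * v x) x) (hv : v ≠ 0)
    (b0 : v (2 * X) = Complex.exp (Complex.I * κ) * v 0)
    (b1 : v₁ (2 * X) = Complex.exp (Complex.I * κ) * v₁ 0)
    (b2 : l (2 * X) = Complex.exp (Complex.I * κ) * l 0) :
    IsFloquetSolution f u c (2 * X) μ κ v := by
  obtain ⟨C, hC⟩ := O.exists_coeff_bound hf
  have hk := O.continuous_coeff hf
  have hdv : deriv v = v₁ := funext fun x => (h0 x).deriv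
  have hdv₁ : deriv v₁ = fun x => ((c - deriv f (u x) : ℝ) : ℂ) * v x - l x :=
    funext fun x => (h1 x).deriv
  have hcv : Continuous v := continuous_iff_continuousAt.2 fun x => (h0 x).continuousAt
  have hcv₁ : Continuous v₁ := continuous_iff_continuousAt.2 fun x => (h1 x).continuousAt
  refine ⟨hv, ?_, ?_, fun x => ?_⟩
  · have c1 : ContDiff ℝ 1 v := by
      rw [contDiff_one_iff_deriv, hdv]
      exact ⟨fun x => (h0 x).differentiableAt, hcv₁⟩
    have c2 : ContDiff ℝ 1 l := by
      rw [contDiff_one_iff_deriv, show deriv l = fun x => μ * v x from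
        funext fun x => (h2 x).deriv]
      exact ⟨fun x => (h2 x).differentiableAt, by fun_prop⟩
    have c3 : ContDiff ℝ 2 v₁ := by
      refine (contDiff_succ_iff_deriv (n := 1)).2
        ⟨fun x => (h1 x).differentiableAt, by simp, ?_⟩
      rw [hdv₁]
      exact ((Complex.ofRealCLM.contDiff.comp hk).mul c1).sub c2
    refine (contDiff_succ_iff_deriv (n := 2)).2 ⟨fun x => (h0 x).differentiableAt, by simp, ?_⟩
    rwa [hdv]
  · set ρ := Complex.exp (Complex.I * κ)
    -- The defect `v (x + 2X) - ρ v x` solves the same system with zero data at `0`.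
    have := third_order_eq_zero hC (μ := μ)
      (v := fun x => v (x + 2 * X) - ρ * v x) (v₁ := fun x => v₁ (x + 2 * X) - ρ * v₁ x)
      (l := fun x => l (x + 2 * X) - ρ * l x)
      (fun x => ((h0 _).comp_add_const x (2 * X)).sub ((h0 x).const_mul ρ))
      (fun x => (((h1 _).comp_add_const x (2 * X)).sub ((h1 x).const_mul ρ)).congr_deriv (by
        rw [O.periodic]; ring))
      (fun x => (((h2 _).comp_add_const x (2 * X)).sub ((h2 x).const_mul ρ)).congr_deriv (by ring))
      (by simp [b0]) (by simp [b1]) (by simp [b2])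
    intro x
    exact sub_eq_zero.1 (congrFun this x)
  · have : (fun y => -deriv (deriv v) y - ((deriv f (u y) : ℝ) : ℂ) * v y + (c : ℂ) * v y) = l := by
      funext y
      rw [hdv, hdv₁]
      push_cast
      ring
    rw [this]
    exact (h2 x).deriv

/-- The translation mode. -/
theorem IsOrbit.isFloquetSolution_zero (O : IsOrbit f a E c um up X u p) (hf : ContDiff ℝ 2 f) :
    IsFloquetSolution f u c (2 * X) 0 0 (fun x => (p x : ℂ)) := by
  refine O.isFloquetSolution hf (v₁ := fun x => ((a - f (u x) + c * u x : ℝ) : ℂ)) (l := 0)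
    (fun x => (O.hasDerivAt_snd x).ofReal_comp)
    (fun x => (O.hasDerivAt_acc hf x).ofReal_comp.congr_deriv (by push_cast; simp))
    (fun x => by simp) (fun h => ?_) ?_ ?_ (by simp)
  · have h1 := O.snd_pos (X / 2) ⟨by linarith [O.pos], by linarith [O.pos]⟩
    have h2 := congrFun h (X / 2)
    simp only [Pi.zero_apply, Complex.ofReal_eq_zero] at h2
    exact h1.ne' h2
  · have := O.snd_periodic 0
    rw [zero_add] at this
    simp [this]
  · have := O.periodic 0
    rw [zero_add] at this
    simp [this]

/-- A modulation with the right increments over a period gives a Floquet solution. -/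
theorem IsModulation.isFloquetSolution {v v₁ m q : ℝ → ℂ} {e : Fin 3 → ℂ} {μ ζ ν : ℂ} {κ : ℝ}
    (h : IsModulation f a c um u e μ v v₁ m q) (O : IsOrbit f a E c um up X u p)
    (hf : ContDiff ℝ 2 f) (hζ : ζ = Complex.exp (Complex.I * κ) - 1) (hμ : μ = ζ * ν) (hμ0 : μ ≠ 0)
    (he : e ≠ 0) (hm : ν * m (2 * X) = -e 0 + e 2 * um)
    (hq : ν * q (2 * X) = e 1 + e 2 * um ^ 2 / 2)
    (hv₁ : ν * v₁ (2 * X) = e 2 * ((a - f um + c * um : ℝ) : ℂ)) :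
    IsFloquetSolution f u c (2 * X) μ κ (fun x => e 2 * p x + μ * v x) := by
  have hg : ((a - f um + c * um : ℝ) : ℂ) ≠ 0 := by exact_mod_cast O.left_slope.ne'
  have hρ : Complex.exp (Complex.I * κ) = 1 + ζ := by rw [hζ]; ring
  have huT : u (2 * X) = um := by
    have := O.periodic 0
    rwa [zero_add, O.fst_zero] at this
  have hpT : p (2 * X) = 0 := by
    have := O.snd_periodic 0
    rwa [zero_add, O.snd_zero] at this
  -- Since `𝓛[u] u' = 0`, the function `l` is `μ 𝓛[u] v`.
  refine O.isFloquetSolution hf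
    (v₁ := fun x => e 2 * ((a - f (u x) + c * u x : ℝ) : ℂ) + μ * v₁ x)
    (l := fun x => μ * (-e 0 + e 2 * u x + μ * m x))
    (fun x => ((O.hasDerivAt_snd x).ofReal_comp.const_mul (e 2)).add
      ((h.hasDerivAt_fst x).const_mul μ))
    (fun x => (((O.hasDerivAt_acc hf x).ofReal_comp.const_mul (e 2)).add
      ((h.hasDerivAt_snd x).const_mul μ)).congr_deriv (by push_cast; ring))
    (fun x => (((((O.hasDerivAt_fst x).ofReal_comp.const_mul (e 2)).const_add (-e 0)).add
      ((h.hasDerivAt_mass x).const_mul μ)).const_mul μ).congr_deriv (by ring))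
    (fun h0 => he ?_) ?_ ?_ ?_
  -- If the function vanishes, its derivative at the turning point gives `e 2 = 0`, so `v = 0`; the
  -- equation for `v` and its initial value then give `e 0 = 0` and `e 1 = 0`.
  · have hfun : ∀ x, e 2 * p x + μ * v x = 0 := fun x => congrFun h0 x
    have hd : ∀ x, e 2 * ((a - f (u x) + c * u x : ℝ) : ℂ) + μ * v₁ x = 0 := fun x => by
      have h1 := ((O.hasDerivAt_snd x).ofReal_comp.const_mul (e 2)).add
        ((h.hasDerivAt_fst x).const_mul μ)
      have h2 : HasDerivAt (fun _ : ℝ => (0 : ℂ)) 0 x := hasDerivAt_const x 0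
      exact h1.unique (h2.congr_of_eventuallyEq (Eventually.of_forall hfun))
    have e2 : e 2 = 0 := by
      have := hd 0
      rw [O.fst_zero, h.snd_zero, mul_zero, add_zero] at this
      exact (mul_eq_zero.1 this).resolve_right hg
    have hv0 : ∀ x, v x = 0 := fun x => by
      have := hfun x
      rw [e2, zero_mul, zero_add] at this
      exact (mul_eq_zero.1 this).resolve_left hμ0
    have hv₁0 : ∀ x, v₁ x = 0 := fun x => by
      have := hd x
      rw [e2, zero_mul, zero_add] at this
      exact (mul_eq_zero.1 this).resolve_left hμ0
    have e0 : e 0 = 0 := by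
      have h1 := h.hasDerivAt_snd 0
      have h2 : HasDerivAt (fun _ : ℝ => (0 : ℂ)) 0 0 := hasDerivAt_const 0 0
      have := h1.unique (h2.congr_of_eventuallyEq (Eventually.of_forall hv₁0))
      simpa [hv0, e2, h.mass_zero] using this
    have e1 : e 1 = 0 := by
      have := h.fst_zero
      rw [hv0, e0, e2, eq_comm, div_eq_zero_iff] at this
      simpa using this.resolve_right hg
    ext i
    fin_cases i
    exacts [e0, e1, e2]
  -- Both endpoints of the period are turning points, so the first integral there yields `v` in
  -- terms of the increments of `m` and `q`.
  · have c0 := h.conservation O hf 0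
    have cT := h.conservation O hf (2 * X)
    simp only [O.snd_zero, O.fst_zero, h.mass_zero, h.momentum_zero, hpT, huT,
      Complex.ofReal_zero, zero_mul, mul_zero, add_zero, zero_sub, zero_add] at c0 cT ⊢
    rw [hρ]
    apply mul_left_cancel₀ hg
    rw [hμ] at cT ⊢
    linear_combination (-(ζ * ν)) * cT + (ζ * ν) * (1 + ζ) * c0 + (ζ * ν) * ζ * (um * hm - hq)
  · rw [hρ, huT, O.fst_zero, h.snd_zero, hμ]
    linear_combination ζ * hv₁
  · simp only [huT, O.fst_zero, h.mass_zero]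
    rw [hρ, hμ]
    linear_combination ζ ^ 2 * ν * hm

end

end GKdV

end

noncomputable section

namespace GKdV

/-! ### The branch of Floquet eigenvalues -/

/-- The leading order characteristic function of the modulations, for the Jacobian `J` of period,
mass and momentum. -/
def modDet (J : Matrix (Fin 3) (Fin 3) ℝ) (ν : ℂ) : ℂ :=
  Matrix.det !![ν * J 0 0, ν * J 0 1, -(ν * J 0 2) + 1;
    ν * J 1 0 + 1, ν * J 1 1, -(ν * J 1 2);
    ν * J 2 0, ν * J 2 1 - 2, -(ν * J 2 2)]

/-- A non-real double root and its conjugate would be four roots. In formulas, `Im P(z) - Im z · Re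
P'(z) = 2 A (Im z)³`. -/
theorem cubic_simple_of_im_ne_zero {A B C D : ℝ} (hA : A ≠ 0) {z : ℂ} (hz : z.im ≠ 0)
    (h : A * z ^ 3 + B * z ^ 2 + C * z + D = 0) : 3 * A * z ^ 2 + 2 * B * z + C ≠ 0 := by
  intro h'
  have h1 := congrArg Complex.im h
  have h2 := congrArg Complex.re h'
  have h3 := congrArg Complex.im h'
  simp [pow_succ] at h1 h2 h3
  have hB : B = -3 * A * z.re := by
    apply mul_right_cancel₀ hz
    linear_combination h3 / 2
  have : 2 * A * z.im ^ 3 = 0 := by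
    linear_combination h1 - z.im * h2
  have := mul_eq_zero.1 this
  rcases this with h | h
  · exact hA (by linarith)
  · exact hz (pow_eq_zero_iff (by norm_num) |>.1 h)

theorem exists_hasDerivAt_modDet {J : Matrix (Fin 3) (Fin 3) ℝ} (hJ : J.det ≠ 0) {ν : ℂ}
    (hν : ν.im ≠ 0) (h : modDet J ν = 0) : ∃ d ≠ 0, HasDerivAt (modDet J) d ν := by
  set B : ℝ := (J 1 0 * J 2 1 - J 1 1 * J 2 0)
    + (J 0 1 * J 2 2 - J 0 2 * J 2 1) - 2 * (J 0 0 * J 1 2 - J 0 2 * J 1 0)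
  set C : ℝ := J 2 1 - 2 * J 1 0 + 2 * J 0 2
  have hform : ∀ z : ℂ, modDet J z
      = ((-J.det : ℝ) : ℂ) * z ^ 3 + (B : ℂ) * z ^ 2 + (C : ℂ) * z + ((-2 : ℝ) : ℂ) := by
    intro z
    simp only [modDet, Matrix.det_fin_three, B, C]
    simp
    ring
  refine ⟨_, cubic_simple_of_im_ne_zero (neg_ne_zero.2 hJ) hν ((hform ν).symm.trans h), ?_⟩
  rw [show modDet J = fun z => _ from funext hform]
  have h3 := (hasDerivAt_pow 3 ν).const_mul ((-J.det : ℝ) : ℂ)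
  have h2 := (hasDerivAt_pow 2 ν).const_mul (B : ℂ)
  have h1 := (hasDerivAt_id ν).const_mul (C : ℂ)
  refine (((h3.add h2).add h1).add_const ((-2 : ℝ) : ℂ)).congr_deriv ?_
  push_cast
  ring

theorem contDiffAt_det {F : Type*} [NormedAddCommGroup F] [NormedSpace ℂ F]
    {M : F → Matrix (Fin 3) (Fin 3) ℂ} {x : F}
    (h : ∀ i j, ContDiffAt ℂ 1 (fun y => M y i j) x) : ContDiffAt ℂ 1 (fun y => (M y).det) x := by
  simp only [Matrix.det_apply]
  refine ContDiffAt.sum fun σ _ => ContDiffAt.const_smul _ (contDiffAt_prod fun i _ => h _ _)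

/-- A scalar implicit function theorem. -/
theorem exists_implicit_root {G : ℂ × ℂ → ℂ} {ν₀ d : ℂ} (hG : ContDiffAt ℂ 1 G (0, ν₀))
    (h0 : G (0, ν₀) = 0) (hd : HasDerivAt (fun ν => G (0, ν)) d ν₀) (hd0 : d ≠ 0) :
    ∃ N : ℂ → ℂ, N 0 = ν₀ ∧ ContDiffAt ℂ 1 N 0 ∧ ∀ᶠ ζ in 𝓝 0, G (ζ, N ζ) = 0 := by
  have hcomp : fderiv ℂ G (0, ν₀) ∘L .inr ℂ ℂ ℂ = ContinuousLinearMap.toSpanSingleton ℂ d := by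
    have h1 : HasFDerivAt (fun ν : ℂ => ((0 : ℂ), ν)) (.inr ℂ ℂ ℂ) ν₀ :=
      hasFDerivAt_prodMk_right 0 ν₀
    have h2 := ((hG.differentiableAt one_ne_zero).hasFDerivAt.comp ν₀ h1).hasDerivAt
    ext
    have := h2.unique hd
    simpa using this
  have hinv : (fderiv ℂ G (0, ν₀) ∘L .inr ℂ ℂ ℂ).IsInvertible := by
    rw [hcomp]
    refine ⟨ContinuousLinearEquiv.unitsEquivAut ℂ (Units.mk0 d hd0), ?_⟩
    ext
    simp
  refine ⟨hG.implicitFunction one_ne_zero hinv, hG.implicitFunction_apply_self one_ne_zero hinv,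
    hG.contDiffAt_implicitFunction one_ne_zero hinv, ?_⟩
  filter_upwards [hG.eventually_apply_implicitFunction one_ne_zero hinv] with ζ hζ
  rw [hζ, h0]

theorem hasDerivAt_exp_I_mul :
    HasDerivAt (fun κ : ℝ => Complex.exp (Complex.I * κ)) Complex.I 0 := by
  have := (((hasDerivAt_id (0 : ℝ)).ofReal_comp).const_mul Complex.I).cexp
  simpa using this

theorem isBigO_exp_sub_one : (fun κ : ℝ => Complex.exp (Complex.I * κ) - 1) =O[𝓝 0]
    (fun κ : ℝ => κ) := by
  have := hasDerivAt_exp_I_mul.isBigO_sub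
  simpa using this

theorem isBigO_exp_sub_one_sub : (fun κ : ℝ => Complex.exp (Complex.I * κ) - 1 - Complex.I * κ)
    =O[𝓝 0] (fun κ : ℝ => κ ^ 2) := by
  rw [isBigO_iff]
  refine ⟨1, ?_⟩
  have : ∀ᶠ κ : ℝ in 𝓝 0, |κ| ≤ 1 :=
    (continuous_abs.continuousAt.eventually_lt continuousAt_const (by simp)).mono
      fun κ (hκ : |κ| < 1) => hκ.le
  filter_upwards [this] with κ hκ
  have h1 : ‖Complex.I * κ‖ = |κ| := by simp
  have := Complex.norm_exp_sub_one_sub_id_le (x := Complex.I * κ) (by rwa [h1])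
  rw [h1] at this
  simpa using this

/-- With `ζ = exp (iκ) - 1` one has `ζ = iκ + O(κ²)` and `N(ζ) = ν₀ + O(κ)`. -/
theorem isBigO_branch {N : ℂ → ℂ} {ν₀ : ℂ} (h0 : N 0 = ν₀) (hN : ContDiffAt ℂ 1 N 0) :
    (fun κ : ℝ => (Complex.exp (Complex.I * κ) - 1) * N (Complex.exp (Complex.I * κ) - 1) -
      Complex.I * κ * ν₀) =O[𝓝 0] (fun κ : ℝ => κ ^ 2) := by
  have ht : Tendsto (fun κ : ℝ => Complex.exp (Complex.I * κ) - 1) (𝓝 0) (𝓝 0) := by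
    have : Continuous fun κ : ℝ => Complex.exp (Complex.I * κ) - 1 := by fun_prop
    simpa using this.tendsto 0
  have h1 : (fun κ : ℝ => N (Complex.exp (Complex.I * κ) - 1) - ν₀) =O[𝓝 0] (fun κ : ℝ => κ) := by
    have := (hN.differentiableAt one_ne_zero).isBigO_sub.comp_tendsto ht
    rw [h0] at this
    refine IsBigO.trans ?_ isBigO_exp_sub_one
    simpa [Function.comp_def] using this
  have h2 := isBigO_exp_sub_one.mul h1
  have h3 := (isBigO_exp_sub_one_sub.const_mul_left ν₀)
  simp only [← pow_two] at h2
  refine (h2.add h3).congr_left fun κ => ?_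
  ring

/-- The leading term has real part `-κ Im ν₀`, of first order in `κ`, which the quadratic error
cannot cancel. -/
theorem re_ne_zero_of_isBigO {μ : ℝ → ℂ} {ν₀ : ℂ} (hν : ν₀.im ≠ 0)
    (h : (fun κ : ℝ => μ κ - Complex.I * κ * ν₀) =O[𝓝 0] (fun κ : ℝ => κ ^ 2)) :
    ∀ᶠ κ in 𝓝 0, κ ≠ 0 → (μ κ).re ≠ 0 := by
  obtain ⟨C, hC0, hC⟩ := h.exists_pos
  have h2 : ∀ᶠ κ : ℝ in 𝓝 0, C * |κ| < |ν₀.im| := by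
    have : Continuous fun κ : ℝ => C * |κ| := by fun_prop
    exact this.continuousAt.eventually_lt continuousAt_const (by simpa using hν)
  filter_upwards [hC.bound, h2] with κ h1 h2 hκ hre
  have h3 := (Complex.abs_re_le_norm _).trans h1
  have h4 : (μ κ - Complex.I * κ * ν₀).re = κ * ν₀.im := by
    simp [hre]
  rw [h4, abs_mul, norm_pow, Real.norm_eq_abs] at h3
  have h5 : 0 < |κ| := abs_pos.2 hκ
  nlinarith

/-- For `μ = ζ ν` all three Floquet conditions on a modulation carry a factor `ζ`. After dividing it
out they say that `e` is in the kernel of `ν Nm(ζν) - Cm`, and the determinant at `ζ = 0` is `-(g /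
2) modDet J ν`, with the simple root `ν₀`. -/
theorem IsOrbit.exists_branch {f : ℝ → ℝ} {a E c um up X : ℝ} {u p : ℝ → ℝ}
    (O : IsOrbit f a E c um up X u p) (hf : ContDiff ℝ 2 f) (hw : IsWell f a E c um up) {m : ℝ}
    (hm : m ∈ Set.Ioo um up) (hJ : (jacobian (tmp f m) ![a, E, c]).det ≠ 0) {ν₀ : ℂ}
    (hν : ν₀.im ≠ 0) (hroot : modDet (jacobian (tmp f m) ![a, E, c]) ν₀ = 0) :
    ∃ μ : ℝ → ℂ, (fun κ : ℝ => μ κ - Complex.I * κ * ν₀) =O[𝓝 0] (fun κ : ℝ => κ ^ 2) ∧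
      ∀ᶠ κ in 𝓝 0, ContinuousAt μ κ ∧ (∃ v, IsFloquetSolution f u c (2 * X) (μ κ) κ v) ∧
        (κ ≠ 0 → (μ κ).re ≠ 0) := by
  set J := jacobian (tmp f m) ![a, E, c] with hJdef
  -- Where a map is not differentiable, `fderiv` is `0`, so a nonzero determinant already implies
  -- differentiability.
  have hdiff : DifferentiableAt ℝ (tmp f m) ![a, E, c] := by
    by_contra hcon
    apply hJ
    rw [hJdef, jacobian, fderiv_zero_of_not_differentiableAt hcon]
    simp
  choose V V₁ M Q hmod hsmooth using fun j : Fin 3 =>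
    O.exists_modulation hf (fun i => ((Pi.single j 1 : Fin 3 → ℝ) i : ℂ))
  have hg : ((a - f um + c * um : ℝ) : ℂ) ≠ 0 := by exact_mod_cast O.left_slope.ne'
  set g : ℂ := ((a - f um + c * um : ℝ) : ℂ) with hgdef
  set Cm : Matrix (Fin 3) (Fin 3) ℂ := !![-1, 0, (um : ℂ); 0, 1, (um : ℂ) ^ 2 / 2; 0, 0, g] with hCm
  set Nm : ℂ → Matrix (Fin 3) (Fin 3) ℂ := fun μ =>
    Matrix.of ![fun j => M j μ (2 * X), fun j => Q j μ (2 * X), fun j => V₁ j μ (2 * X)] with hNm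
  have hNs : ∀ i j, ContDiffAt ℂ 1 (fun μ => Nm μ i j) 0 := by
    intro i j
    obtain ⟨h1, h2, h3⟩ := hsmooth j (2 * X)
    fin_cases i
    exacts [h2, h3, h1]
  set G : ℂ × ℂ → ℂ := fun x => (x.2 • Nm (x.1 * x.2) - Cm).det with hG
  have hGs : ContDiffAt ℂ 1 G (0, ν₀) := by
    refine contDiffAt_det fun i j => ?_
    have h1 : ContDiffAt ℂ 1 (fun x : ℂ × ℂ => x.1 * x.2) (0, ν₀) := by fun_prop
    have h2 : ContDiffAt ℂ 1 (fun x : ℂ × ℂ => Nm (x.1 * x.2) i j) (0, ν₀) :=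
      ContDiffAt.comp (0, ν₀) (g := fun μ => Nm μ i j) (by simpa using hNs i j) h1
    exact (contDiffAt_snd.mul h2).sub contDiffAt_const
  -- the period map at `μ = 0`
  have hJcol : ∀ i j, J i j = fderiv ℝ (tmp f m) ![a, E, c] (Pi.single j 1) i := fun i j => by
    rw [hJdef, jacobian, LinearMap.toMatrix'_apply]; rfl
  -- The third direction is `∂/∂s = -∂/∂c`.
  set sg : Fin 3 → ℝ := ![1, 1, -1] with hsg
  have hN0 : ∀ j, M j 0 (2 * X) = (sg j : ℂ) * (J 1 j - um * J 0 j) ∧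
      Q j 0 (2 * X) = (sg j : ℂ) * (J 2 j - um ^ 2 * J 0 j) / 2 ∧
      V₁ j 0 (2 * X) = (sg j : ℂ) * (-(g * J 0 j)) := by
    intro j
    have hj := (hmod j).self_of_nhds
    have hv := hj.isVariation (e := Pi.single j 1)
    have hcv : Continuous (V j 0) := continuous_iff_continuousAt.2 fun x =>
      (hj.hasDerivAt_fst x).continuousAt
    have hcu := O.continuous_fst
    have hMint : ∫ x in (0 : ℝ)..2 * X, V j 0 x = M j 0 (2 * X) := by
      rw [intervalIntegral.integral_eq_sub_of_hasDerivAt (fun x _ => hj.hasDerivAt_mass x)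
        (hcv.intervalIntegrable _ _), hj.mass_zero, sub_zero]
    have hQint : ∫ x in (0 : ℝ)..2 * X, (u x : ℂ) * V j 0 x = Q j 0 (2 * X) := by
      rw [intervalIntegral.integral_eq_sub_of_hasDerivAt (fun x _ => hj.hasDerivAt_momentum x)
        (Continuous.intervalIntegrable (by fun_prop) _ _), hj.momentum_zero, sub_zero]
    have hdir : ![(Pi.single j 1 : Fin 3 → ℝ) 0, (Pi.single j 1 : Fin 3 → ℝ) 1,
        -(Pi.single j 1 : Fin 3 → ℝ) 2] = sg j • (Pi.single j 1 : Fin 3 → ℝ) := by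
      ext i
      fin_cases i <;> fin_cases j <;> simp [hsg]
    have hfd := fun k => hv.fderiv_tmp O hf hw hm hdiff k
    simp only [hdir, map_smul, Pi.smul_apply, ← hJcol, smul_eq_mul, Complex.ofReal_mul] at hfd
    have h0 := hfd 0
    have h1 := hfd 1
    have h2 := hfd 2
    simp only [Fin.val_zero, Nat.cast_zero, zero_mul, intervalIntegral.integral_zero, pow_zero,
      one_mul, zero_sub] at h0
    simp only [Fin.val_one, Nat.cast_one, one_mul, Nat.sub_self, pow_zero, pow_one, hMint] at h1
    simp only [Fin.val_two, Nat.add_one_sub_one, pow_one, mul_assoc, Nat.cast_ofNat] at h2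
    rw [intervalIntegral.integral_const_mul, hQint] at h2
    set r := V₁ j 0 (2 * X) / g with hr
    have hrg : V₁ j 0 (2 * X) = r * g := by rw [hr]; field_simp
    refine ⟨?_, ?_, ?_⟩
    · linear_combination (um : ℂ) * h0 - h1
    · linear_combination ((um : ℂ) ^ 2 * h0 - h2) / 2
    · rw [hrg]; linear_combination g * h0
  have hG0 : ∀ ν, G (0, ν) = -(g / 2) * modDet J ν := by
    intro ν
    simp only [hG, zero_mul, modDet, Matrix.det_fin_three, hNm, hCm]
    simp [(hN0 _).1, (hN0 _).2.1, (hN0 _).2.2, hsg]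
    ring
  obtain ⟨d, hd0, hd⟩ := exists_hasDerivAt_modDet hJ hν hroot
  obtain ⟨N, hN1, hN2, hN3⟩ := exists_implicit_root hGs (by rw [hG0, hroot, mul_zero])
    (d := -(g / 2) * d) (by simp only [hG0]; exact hd.const_mul _)
    (mul_ne_zero (neg_ne_zero.2 (div_ne_zero hg two_ne_zero)) hd0)
  set Z : ℝ → ℂ := fun κ => Complex.exp (Complex.I * κ) - 1 with hZ
  have hZc : Continuous Z := by fun_prop
  have hZt : Tendsto Z (𝓝 0) (𝓝 0) := by simpa [hZ] using hZc.tendsto 0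
  have hbig := isBigO_branch hN1 hN2
  have hre := re_ne_zero_of_isBigO hν hbig
  refine ⟨fun κ => Z κ * N (Z κ), hbig, ?_⟩
  have hNc : ∀ᶠ ζ in 𝓝 (0 : ℂ), ContinuousAt N ζ :=
    (hN2.eventually (by simp)).mono fun ζ hζ => hζ.continuousAt
  have hN0' : ∀ᶠ ζ in 𝓝 (0 : ℂ), N ζ ≠ 0 :=
    hN2.continuousAt.eventually_ne (by rw [hN1]; rintro rfl; simp at hν)
  have hmodZ : ∀ᶠ κ in 𝓝 0, ∀ j, IsModulation f a c um u
      (fun i => ((Pi.single j 1 : Fin 3 → ℝ) i : ℂ)) (Z κ * N (Z κ)) (V j (Z κ * N (Z κ)))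
      (V₁ j (Z κ * N (Z κ))) (M j (Z κ * N (Z κ))) (Q j (Z κ * N (Z κ))) := by
    have ht : Tendsto (fun κ => Z κ * N (Z κ)) (𝓝 0) (𝓝 0) := by
      simpa using hZt.mul (hN2.continuousAt.tendsto.comp hZt)
    exact eventually_all.2 fun j => ht.eventually (hmod j)
  have hZne : ∀ᶠ κ in 𝓝 (0 : ℝ), κ ≠ 0 → Z κ ≠ 0 := by
    have h : HasDerivAt Z Complex.I 0 := hasDerivAt_exp_I_mul.sub_const 1
    have := h.eventually_ne (c := 0) Complex.I_ne_zero
    rwa [eventually_nhdsWithin_iff] at this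
  filter_upwards [hre, hZt.eventually hN3, hZt.eventually hNc, hZt.eventually hN0', hmodZ, hZne]
    with κ h1 h2 h3 h4 h5 h6
  refine ⟨hZc.continuousAt.mul (ContinuousAt.comp (g := N) h3 hZc.continuousAt), ?_, h1⟩
  -- The modulation ansatz needs `μ ≠ 0`; at `κ = 0`, where `μ = 0`, the translation mode `u'` takes
  -- its place.
  by_cases hκ : κ = 0
  · subst hκ
    exact ⟨_, by simpa [hZ] using O.isFloquetSolution_zero hf⟩
  · obtain ⟨e, he, hker⟩ := Matrix.exists_mulVec_eq_zero_iff.2 h2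
    have hsum := IsModulation.sum h5 e
    have hee : (fun i => ∑ j, e j * ((Pi.single j 1 : Fin 3 → ℝ) i : ℂ)) = e := by
      ext i
      fin_cases i <;> simp [Fin.sum_univ_three]
    rw [hee] at hsum
    have k0 := congrFun hker 0
    have k1 := congrFun hker 1
    have k2 := congrFun hker 2
    simp only [Matrix.mulVec, dotProduct, Fin.sum_univ_three, hNm, hCm] at k0 k1 k2
    simp at k0 k1 k2
    refine ⟨_, hsum.isFloquetSolution O hf rfl rfl (mul_ne_zero (h6 hκ) h4) he ?_ ?_ ?_⟩
    · simp only [Fin.sum_univ_three]; linear_combination k0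
    · simp only [Fin.sum_univ_three]; linear_combination k1
    · simp only [Fin.sum_univ_three]; linear_combination k2

end GKdV

end

noncomputable section

namespace GKdV

/-! ### Bounded eigenfunctions belong to the spectrum -/

/-- Integration by parts against Schwartz functions; compact support makes every product integrable.
-/
theorem isWeakDeriv_toLp {F F' : ℝ → ℂ} (hF : ∀ x, HasDerivAt F (F' x) x) (hF' : Continuous F')
    (hc : HasCompactSupport F) (hc' : HasCompactSupport F') (h1 : MemLp F 2 volume)
    (h2 : MemLp F' 2 volume) : IsWeakDeriv (h1.toLp F) (h2.toLp F') := by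
  have hFc : Continuous F := continuous_iff_continuousAt.2 fun x => (hF x).continuousAt
  unfold IsWeakDeriv
  ext g
  rw [TemperedDistribution.derivCLM_apply_apply, Lp.toTemperedDistribution_apply,
    Lp.toTemperedDistribution_apply]
  have e1 : ∫ x, (-SchwartzMap.derivCLM ℂ ℂ g) x • (h1.toLp F) x = ∫ x, -(deriv g x * F x) := by
    refine integral_congr_ae ?_
    filter_upwards [h1.coeFn_toLp] with x hx
    rw [hx]
    simp
  have e2 : ∫ x, g x • (h2.toLp F') x = ∫ x, g x * F' x := by
    refine integral_congr_ae ?_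
    filter_upwards [h2.coeFn_toLp] with x hx
    rw [hx, smul_eq_mul]
  have hgc : Continuous (deriv g) := (SchwartzMap.derivCLM ℂ ℂ g).continuous
  rw [e1, e2, integral_neg, integral_mul_deriv_eq_deriv_mul_of_integrable
    (fun x _ => g.differentiableAt.hasDerivAt) (fun x _ => hF x)]
  · exact (g.continuous.mul hF').integrable_of_hasCompactSupport hc'.mul_left
  · exact (hgc.mul hFc).integrable_of_hasCompactSupport hc.mul_left
  · exact (g.continuous.mul hFc).integrable_of_hasCompactSupport hc.mul_left

theorem norm_toLp_sq {F : ℝ → ℂ} (h : MemLp F 2 volume) :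
    ‖h.toLp F‖ ^ 2 = ∫ x, ‖F x‖ ^ 2 := by
  have h1 : (inner ℂ (h.toLp F) (h.toLp F) : ℂ) = ((∫ x, ‖F x‖ ^ 2 : ℝ) : ℂ) := by
    rw [L2.inner_def, ← integral_complex_ofReal]
    refine integral_congr_ae ?_
    filter_upwards [h.coeFn_toLp] with x hx
    rw [hx, inner_self_eq_norm_sq_to_K]
    simp
  rw [inner_self_eq_norm_sq_to_K] at h1
  apply Complex.ofReal_injective
  rw [← h1, Complex.ofReal_pow]
  rfl

theorem exists_cutoff : ∃ φ φ₁ φ₂ φ₃ : ℝ → ℝ, ∃ B : ℝ, (∀ x, HasDerivAt φ (φ₁ x) x) ∧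
    (∀ x, HasDerivAt φ₁ (φ₂ x) x) ∧ (∀ x, HasDerivAt φ₂ (φ₃ x) x) ∧ Continuous φ₃ ∧
    (∀ x, |x| ≤ 1 → φ x = 1) ∧
    (∀ x, 2 < |x| → φ x = 0 ∧ φ₁ x = 0 ∧ φ₂ x = 0 ∧ φ₃ x = 0) ∧
    ∀ x, |φ₁ x| ≤ B ∧ |φ₂ x| ≤ B ∧ |φ₃ x| ≤ B := by
  let b : ContDiffBump (0 : ℝ) := ⟨1, 2, one_pos, one_lt_two⟩
  have hb : ContDiff ℝ 3 (b : ℝ → ℝ) := b.contDiff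
  have hb1 : ContDiff ℝ 2 (deriv b) := (contDiff_succ_iff_deriv (n := 2)).1 hb |>.2.2
  have hb2 : ContDiff ℝ 1 (deriv (deriv b)) := (contDiff_succ_iff_deriv (n := 1)).1 hb1 |>.2.2
  have hb3 : Continuous (deriv (deriv (deriv b))) := hb2.continuous_deriv le_rfl
  have hcs : HasCompactSupport (b : ℝ → ℝ) := b.hasCompactSupport
  obtain ⟨B₁, hB₁⟩ := hcs.deriv.exists_bound_of_continuous hb1.continuous
  obtain ⟨B₂, hB₂⟩ := hcs.deriv.deriv.exists_bound_of_continuous hb2.continuous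
  obtain ⟨B₃, hB₃⟩ := hcs.deriv.deriv.deriv.exists_bound_of_continuous hb3
  refine ⟨b, deriv b, deriv (deriv b), deriv (deriv (deriv b)), max B₁ (max B₂ B₃),
    fun x => (hb.differentiable (by norm_num) x).hasDerivAt,
    fun x => (hb1.differentiable (by norm_num) x).hasDerivAt,
    fun x => (hb2.differentiable (by norm_num) x).hasDerivAt, hb3, fun x hx => ?_, fun x hx => ?_,
    fun x => ⟨(hB₁ x).trans (le_max_left _ _),
      (hB₂ x).trans ((le_max_left _ _).trans (le_max_right _ _)),
      (hB₃ x).trans ((le_max_right _ _).trans (le_max_right _ _))⟩⟩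
  · exact b.one_of_mem_closedBall (by simpa [b] using hx)
  · have h0 : x ∉ tsupport (b : ℝ → ℝ) := by
      rw [b.tsupport_eq]
      simpa [b] using hx
    have h1 := fun h => h0 (support_deriv_subset (f := (b : ℝ → ℝ)) h)
    have h1' := fun h => h0 (tsupport_deriv_subset (f := (b : ℝ → ℝ)) h)
    have h2 := fun h => h1' (support_deriv_subset (f := deriv b) h)
    have h2' := fun h => h1' (tsupport_deriv_subset (f := deriv b) h)
    have h3 := fun h => h2' (support_deriv_subset (f := deriv (deriv b)) h)
    exact ⟨image_eq_zero_of_notMem_tsupport h0, Function.notMem_support.1 h1,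
      Function.notMem_support.1 h2, Function.notMem_support.1 h3⟩

theorem _root_.Function.Periodic.exists_norm_le {F : ℝ → ℂ} {T : ℝ} (hT : 0 < T) (hF : Continuous F)
    (hp : ∀ x, ‖F (x + T)‖ = ‖F x‖) : ∃ C, ∀ x, ‖F x‖ ≤ C := by
  obtain ⟨C, hC⟩ := Function.Periodic.exists_abs_le (k := fun x => ‖F x‖) hT hp hF.norm
  exact ⟨C, fun x => (le_abs_self _).trans (hC x)⟩

/-- A compactly supported function bounded by `B` has `L²` norm at most `B √(2r)`. -/
theorem norm_toLp_sq_le {F : ℝ → ℂ} (h : MemLp F 2 volume) {B r : ℝ} (hr : 0 ≤ r)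
    (hB : ∀ x, ‖F x‖ ≤ B) (h0 : ∀ x, r < |x| → F x = 0) :
    ‖h.toLp F‖ ^ 2 ≤ B ^ 2 * (2 * r) := by
  rw [norm_toLp_sq]
  have h1 : ∫ x, ‖F x‖ ^ 2 = ∫ x in Set.Icc (-r) r, ‖F x‖ ^ 2 := by
    refine (setIntegral_eq_integral_of_forall_compl_eq_zero fun x hx => ?_).symm
    rw [h0 x (not_le.1 fun h => hx (abs_le.1 h))]
    simp
  rw [h1]
  have hB0 : 0 ≤ B := (norm_nonneg _).trans (hB 0)
  have := norm_setIntegral_le_of_norm_le_const (μ := volume) (s := Set.Icc (-r) r)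
    (f := fun x => ‖F x‖ ^ 2) (C := B ^ 2) (by simp) (fun x _ => by
      rw [Real.norm_of_nonneg (by positivity)]
      exact pow_le_pow_left₀ (norm_nonneg _) (hB x) 2)
  refine (le_abs_self _).trans (this.trans ?_)
  rw [Real.volume_real_Icc_of_le (by linarith)]
  apply le_of_eq; ring

theorem le_norm_toLp_sq {F v : ℝ → ℂ} (h : MemLp F 2 volume) {r : ℝ} (hr : 0 ≤ r)
    (hF : ∀ x ∈ Set.Icc 0 r, F x = v x) : ∫ x in (0 : ℝ)..r, ‖v x‖ ^ 2 ≤ ‖h.toLp F‖ ^ 2 := by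
  rw [norm_toLp_sq, intervalIntegral.integral_of_le hr]
  have hi : Integrable fun x => ‖F x‖ ^ 2 := by
    have := h.integrable_norm_pow (by norm_num)
    simpa using this
  calc ∫ x in Set.Ioc 0 r, ‖v x‖ ^ 2 = ∫ x in Set.Ioc 0 r, ‖F x‖ ^ 2 :=
        setIntegral_congr_fun measurableSet_Ioc fun x hx => by
          simp only [hF x ⟨hx.1.le, hx.2⟩]
    _ ≤ _ := setIntegral_le_integral hi (Eventually.of_forall fun x => by positivity)

/-- The truncated eigenfunction at scale `s` satisfies the resolvent equation with a small right
hand side. -/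
theorem exists_weyl_bound {f u : ℝ → ℝ} {c T : ℝ} {μ : ℂ} {κ : ℝ} {v : ℝ → ℂ} (hT : 0 < T)
    (hk : ContDiff ℝ 1 fun x => deriv f (u x)) (hkp : ∀ x, u (x + T) = u x)
    (h : IsFloquetSolution f u c T μ κ v) :
    ∃ C : ℝ, 0 ≤ C ∧ ∀ s : ℝ, 1 ≤ s → ∃ g h : L2, IsLinearized f u c g (h + μ • g) ∧
      ‖h‖ ^ 2 ≤ C / s ∧ ∫ x in (0 : ℝ)..s, ‖v x‖ ^ 2 ≤ ‖g‖ ^ 2 := by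
  obtain ⟨φ, φ₁, φ₂, φ₃, B, d0, d1, d2, c3, hone, hzero, hB⟩ := exists_cutoff
  have hv : ContDiff ℝ 3 v := h.contDiff
  have hv1 : ContDiff ℝ 2 (deriv v) := (contDiff_succ_iff_deriv (n := 2)).1 hv |>.2.2
  have hv2 : ContDiff ℝ 1 (deriv (deriv v)) := (contDiff_succ_iff_deriv (n := 1)).1 hv1 |>.2.2
  have dv0 : ∀ x, HasDerivAt v (deriv v x) x := fun x =>
    (hv.differentiable (by norm_num) x).hasDerivAt
  have dv1 : ∀ x, HasDerivAt (deriv v) (deriv (deriv v) x) x := fun x =>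
    (hv1.differentiable (by norm_num) x).hasDerivAt
  set l : ℝ → ℂ := fun y => -deriv (deriv v) y - ((deriv f (u y) : ℝ) : ℂ) * v y + (c : ℂ) * v y
    with hl
  have hlc : ContDiff ℝ 1 l :=
    (hv2.neg.sub ((Complex.ofRealCLM.contDiff.comp hk).mul (hv.of_le (by norm_num)))).add
      (contDiff_const.mul (hv.of_le (by norm_num)))
  have dl : ∀ x, HasDerivAt l (μ * v x) x := fun x => by
    have := (hlc.differentiable one_ne_zero x).hasDerivAt
    rwa [show deriv l x = μ * v x from h.eigen x] at this
  -- everything is bounded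
  have hρ : ‖Complex.exp (Complex.I * κ)‖ = 1 := by
    rw [mul_comm]; exact Complex.norm_exp_ofReal_mul_I κ
  set ρ := Complex.exp (Complex.I * κ)
  have p0 : ∀ x, v (x + T) = ρ * v x := h.floquet
  have p1 : ∀ x, deriv v (x + T) = ρ * deriv v x := fun x => by
    have h1 := (dv0 (x + T)).comp_add_const x T
    rw [show (fun x => v (x + T)) = fun x => ρ * v x from funext p0] at h1
    exact h1.unique ((dv0 x).const_mul ρ)
  have p2 : ∀ x, deriv (deriv v) (x + T) = ρ * deriv (deriv v) x := fun x => by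
    have h1 := (dv1 (x + T)).comp_add_const x T
    rw [show (fun x => deriv v (x + T)) = fun x => ρ * deriv v x from funext p1] at h1
    exact h1.unique ((dv1 x).const_mul ρ)
  have pl : ∀ x, l (x + T) = ρ * l x := fun x => by
    simp only [hl, p0, p2, hkp]; ring
  obtain ⟨C₀, hC₀⟩ := Function.Periodic.exists_norm_le hT hv.continuous
    fun x => by rw [p0, norm_mul, hρ, one_mul]
  obtain ⟨C₁, hC₁⟩ := Function.Periodic.exists_norm_le hT hv1.continuous
    fun x => by rw [p1, norm_mul, hρ, one_mul]
  obtain ⟨C₂, hC₂⟩ := Function.Periodic.exists_norm_le hT hv2.continuous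
    fun x => by rw [p2, norm_mul, hρ, one_mul]
  obtain ⟨Cl, hCl⟩ := Function.Periodic.exists_norm_le hT hlc.continuous
    fun x => by rw [pl, norm_mul, hρ, one_mul]
  set D := B * Cl + B * C₀ + 3 * (B * C₁) + 2 * (B * C₂) with hD
  have hB0 : 0 ≤ B := (abs_nonneg _).trans (hB 0).1
  have hC₀0 : 0 ≤ C₀ := (norm_nonneg _).trans (hC₀ 0)
  have hC₁0 : 0 ≤ C₁ := (norm_nonneg _).trans (hC₁ 0)
  have hC₂0 : 0 ≤ C₂ := (norm_nonneg _).trans (hC₂ 0)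
  have hCl0 : 0 ≤ Cl := (norm_nonneg _).trans (hCl 0)
  -- The remainder will be bounded by `D / s` and supported in `[-2s, 2s]`, an interval of length `4
  -- s`.
  refine ⟨4 * D ^ 2, by positivity, fun s hs => ?_⟩
  have hs0 : 0 < s := by linarith
  -- the scaled cutoff
  set t := s⁻¹ with ht
  have ht0 : 0 < t := inv_pos.2 hs0
  have ht1 : t ≤ 1 := inv_le_one_of_one_le₀ hs
  have hsc : ∀ {ψ ψ' : ℝ → ℝ}, (∀ x, HasDerivAt ψ (ψ' x) x) → ∀ x,
      HasDerivAt (fun x => ((ψ (t * x) : ℝ) : ℂ)) ((t * ψ' (t * x) : ℝ) : ℂ) x := by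
    intro ψ ψ' hψ x
    have h1 : HasDerivAt (fun x : ℝ => t * x) t x := by simpa using (hasDerivAt_id x).const_mul t
    exact (((hψ (t * x)).comp x h1).congr_deriv (mul_comm _ _)).ofReal_comp
  have hvan : ∀ x, 2 * s < |x| → 2 < |t * x| := fun x hx => by
    rw [abs_mul, abs_of_pos ht0, ht, inv_mul_eq_div, lt_div_iff₀ hs0]
    exact hx
  have hcont : ∀ {ψ ψ' : ℝ → ℝ}, (∀ x, HasDerivAt ψ (ψ' x) x) → Continuous ψ := fun hψ =>
    continuous_iff_continuousAt.2 fun x => (hψ x).continuousAt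
  have cφ := hcont d0
  have cφ₁ := hcont d1
  have cφ₂ := hcont d2
  have cv := hv.continuous
  have cv1 := hv1.continuous
  have cv2 := hv2.continuous
  have cl := hlc.continuous
  have hcs : ∀ {F : ℝ → ℂ}, (∀ x, 2 * s < |x| → F x = 0) → HasCompactSupport F := fun hF =>
    HasCompactSupport.intro (isCompact_Icc (a := -(2 * s)) (b := 2 * s)) fun x hx =>
      hF x (not_le.1 fun h => hx (abs_le.1 h))
  -- the truncated functions
  set g : ℝ → ℂ := fun x => φ (t * x) * v x with hg
  set g1 : ℝ → ℂ := fun x => (t * φ₁ (t * x) : ℝ) * v x + φ (t * x) * deriv v x with hg1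
  set g2 : ℝ → ℂ := fun x => (t * (t * φ₂ (t * x)) : ℝ) * v x + (t * φ₁ (t * x) : ℝ) * deriv v x +
    ((t * φ₁ (t * x) : ℝ) * deriv v x + φ (t * x) * deriv (deriv v) x) with hg2
  set lg : ℝ → ℂ := fun x => φ (t * x) * l x - (t * (t * φ₂ (t * x)) : ℝ) * v x -
    2 * ((t * φ₁ (t * x) : ℝ) * deriv v x) with hlg
  -- `r` collects the terms of `∂ₓ 𝓛[u] g` in which the cutoff is differentiated; each carries at
  -- least one factor `t = 1 / s`.
  set r : ℝ → ℂ := fun x => (t * φ₁ (t * x) : ℝ) * l x -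
    (t * (t * (t * φ₃ (t * x))) : ℝ) * v x - 3 * ((t * (t * φ₂ (t * x)) : ℝ) * deriv v x) -
    2 * ((t * φ₁ (t * x) : ℝ) * deriv (deriv v) x) with hr
  have s1 : ∀ x, HasDerivAt (fun x => ((t * φ₁ (t * x) : ℝ) : ℂ))
      ((t * (t * φ₂ (t * x)) : ℝ) : ℂ) x := fun x => by
    simpa using (hsc d1 x).const_mul (t : ℂ)
  have s2 : ∀ x, HasDerivAt (fun x => ((t * (t * φ₂ (t * x)) : ℝ) : ℂ))
      ((t * (t * (t * φ₃ (t * x))) : ℝ) : ℂ) x := fun x => by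
    simpa using ((hsc d2 x).const_mul (t : ℂ)).const_mul (t : ℂ)
  have dg : ∀ x, HasDerivAt g (g1 x) x := fun x => (hsc d0 x).mul (dv0 x)
  have dg1 : ∀ x, HasDerivAt g1 (g2 x) x := fun x =>
    ((s1 x).mul (dv0 x)).add ((hsc d0 x).mul (dv1 x))
  have dlg : ∀ x, HasDerivAt lg (r x + μ * g x) x := fun x =>
    ((((hsc d0 x).mul (dl x)).sub ((s2 x).mul (dv0 x))).sub
      (((s1 x).mul (dv1 x)).const_mul 2)).congr_deriv (by simp only [hr, hg]; ring)
  have zg : ∀ x, 2 * s < |x| → g x = 0 := fun x hx => by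
    obtain ⟨z0, z1, z2, z3⟩ := hzero _ (hvan x hx); simp [hg, z0]
  have zg1 : ∀ x, 2 * s < |x| → g1 x = 0 := fun x hx => by
    obtain ⟨z0, z1, z2, z3⟩ := hzero _ (hvan x hx); simp [hg1, z0, z1]
  have zg2 : ∀ x, 2 * s < |x| → g2 x = 0 := fun x hx => by
    obtain ⟨z0, z1, z2, z3⟩ := hzero _ (hvan x hx); simp [hg2, z0, z1, z2]
  have zlg : ∀ x, 2 * s < |x| → lg x = 0 := fun x hx => by
    obtain ⟨z0, z1, z2, z3⟩ := hzero _ (hvan x hx); simp [hlg, z0, z1, z2]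
  have zr : ∀ x, 2 * s < |x| → r x = 0 := fun x hx => by
    obtain ⟨z0, z1, z2, z3⟩ := hzero _ (hvan x hx); simp [hr, z1, z2, z3]
  have cg : Continuous g := by fun_prop
  have cg1 : Continuous g1 := by fun_prop
  have cg2 : Continuous g2 := by fun_prop
  have clg : Continuous lg := by fun_prop
  have cr : Continuous r := by fun_prop
  have mg := cg.memLp_of_hasCompactSupport (p := 2) (μ := volume) (hcs zg)
  have mg1 := cg1.memLp_of_hasCompactSupport (p := 2) (μ := volume) (hcs zg1)
  have mg2 := cg2.memLp_of_hasCompactSupport (p := 2) (μ := volume) (hcs zg2)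
  have mlg := clg.memLp_of_hasCompactSupport (p := 2) (μ := volume) (hcs zlg)
  have mr := cr.memLp_of_hasCompactSupport (p := 2) (μ := volume) (hcs zr)
  have hsum : mr.toLp r + μ • mg.toLp g = (mr.add (mg.const_smul μ)).toLp (r + μ • g) := by
    rw [MemLp.toLp_add mr (mg.const_smul μ), MemLp.toLp_const_smul]
  refine ⟨mg.toLp g, mr.toLp r, ⟨mlg.toLp lg, ⟨mg1.toLp g1, mg2.toLp g2, ?_, ?_, ?_⟩, ?_⟩, ?_, ?_⟩
  · exact isWeakDeriv_toLp dg cg1 (hcs zg) (hcs zg1) mg mg1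
  · exact isWeakDeriv_toLp dg1 cg2 (hcs zg1) (hcs zg2) mg1 mg2
  · filter_upwards [mlg.coeFn_toLp, mg.coeFn_toLp, mg2.coeFn_toLp] with x e1 e2 e3
    rw [e1, e2, e3]
    simp only [hlg, hg, hg2, hl]
    ring
  · rw [hsum]
    refine isWeakDeriv_toLp dlg (cr.add (cg.const_smul μ)) (hcs zlg) (hcs fun x hx => ?_) mlg _
    simp [zr x hx, zg x hx]
  · have hrb : ∀ x, ‖r x‖ ≤ t * D := by
      intro x
      obtain ⟨b1, b2, b3⟩ := hB (t * x)
      have tt : t * t ≤ t := mul_le_of_le_one_left ht0.le ht1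
      have ttt : t * (t * t) ≤ t := (mul_le_of_le_one_left (by positivity) ht1).trans tt
      have n1 : ‖((t * φ₁ (t * x) : ℝ) : ℂ)‖ ≤ t * B := by
        rw [Complex.norm_real, Real.norm_eq_abs, abs_mul, abs_of_pos ht0]
        gcongr
      have n2 : ‖((t * (t * φ₂ (t * x)) : ℝ) : ℂ)‖ ≤ t * B := by
        rw [Complex.norm_real, Real.norm_eq_abs, ← mul_assoc, abs_mul, abs_of_pos (by positivity)]
        gcongr
      have n3 : ‖((t * (t * (t * φ₃ (t * x))) : ℝ) : ℂ)‖ ≤ t * B := by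
        rw [Complex.norm_real, Real.norm_eq_abs, ← mul_assoc, ← mul_assoc, abs_mul,
          abs_of_pos (by positivity), mul_assoc t t t]
        gcongr
      have a1 : ‖((t * φ₁ (t * x) : ℝ) : ℂ) * l x‖ ≤ t * B * Cl := by
        rw [norm_mul]
        have := hCl x
        gcongr
      have a2 : ‖((t * (t * (t * φ₃ (t * x))) : ℝ) : ℂ) * v x‖ ≤ t * B * C₀ := by
        rw [norm_mul]
        have := hC₀ x
        gcongr
      have a3 : ‖3 * (((t * (t * φ₂ (t * x)) : ℝ) : ℂ) * deriv v x)‖ ≤ 3 * (t * B * C₁) := by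
        rw [norm_mul, norm_mul]
        have := hC₁ x
        simp only [Complex.norm_ofNat]
        gcongr
      have a4 : ‖2 * (((t * φ₁ (t * x) : ℝ) : ℂ) * deriv (deriv v) x)‖ ≤ 2 * (t * B * C₂) := by
        rw [norm_mul, norm_mul]
        have := hC₂ x
        simp only [Complex.norm_ofNat]
        gcongr
      calc ‖r x‖ ≤ t * B * Cl + t * B * C₀ + 3 * (t * B * C₁) + 2 * (t * B * C₂) :=
            (norm_sub_le _ _).trans (add_le_add ((norm_sub_le _ _).trans (add_le_add
              ((norm_sub_le _ _).trans (add_le_add a1 a2)) a3)) a4)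
        _ = t * D := by rw [hD]; ring
    refine (norm_toLp_sq_le mr (by positivity) hrb zr).trans (le_of_eq ?_)
    rw [ht]
    field_simp
    ring
  · refine le_norm_toLp_sq mg hs0.le fun x hx => ?_
    have : φ (t * x) = 1 := by
      apply hone
      rw [abs_mul, abs_of_pos ht0, abs_of_nonneg hx.1, ht, inv_mul_eq_div]
      exact div_le_one_of_le₀ hx.2 hs0.le
    simp [hg, this]

/-- A Floquet solution with multiplier on the unit circle gives a point of the `L²` spectrum. -/
theorem IsFloquetSolution.mem_linSpectrum {f u : ℝ → ℝ} {c T : ℝ} {μ : ℂ} {κ : ℝ} {v : ℝ → ℂ}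
    (hT : 0 < T) (hk : ContDiff ℝ 1 fun x => deriv f (u x)) (hkp : ∀ x, u (x + T) = u x)
    (h : IsFloquetSolution f u c T μ κ v) : μ ∈ linSpectrum f u c := by
  rintro ⟨R, hR⟩
  obtain ⟨C, hC0, hC⟩ := exists_weyl_bound hT hk hkp h
  have cv := h.contDiff.continuous
  have hper : Function.Periodic (fun x => ‖v x‖ ^ 2) T := fun x => by
    simp only [h.floquet, norm_mul]
    rw [mul_comm Complex.I, Complex.norm_exp_ofReal_mul_I, one_mul]
  set β := ∫ x in (0 : ℝ)..T, ‖v x‖ ^ 2 with hβ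
  have hint : ∀ a b : ℝ, IntervalIntegrable (fun x => ‖v x‖ ^ 2) volume a b := fun a b =>
    Continuous.intervalIntegrable (by fun_prop) _ _
  have hβ0 : 0 < β := by
    obtain ⟨y, hy⟩ := Function.ne_iff.1 h.ne_zero
    have h1 := hper.intervalIntegral_add_eq 0 y
    rw [zero_add] at h1
    rw [hβ, h1]
    refine intervalIntegral.integral_pos (by linarith) (by fun_prop) (fun x _ => by positivity)
      ⟨y, ⟨le_rfl, by linarith⟩, ?_⟩
    have : 0 < ‖v y‖ := norm_pos_iff.2 hy
    positivity
  -- Over `n` periods the truncated eigenfunction has squared norm at least `n β`, while its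
  -- residual is of order `1 / (n T)` in squared norm. A bounded `R` cannot map the latter to the
  -- former for all `n`.
  have key : ∀ n : ℕ, 1 ≤ n * T → n * β ≤ ‖R‖ ^ 2 * (C / (n * T)) := by
    intro n hn
    obtain ⟨g, w, h1, h2, h3⟩ := hC _ hn
    have h4 := hper.intervalIntegral_add_zsmul_eq n 0 hint
    simp only [zero_add, zsmul_eq_mul, Int.cast_natCast] at h4
    rw [h4] at h3
    have h5 : ‖g‖ ≤ ‖R‖ * ‖w‖ := by
      rw [(hR g w).1 h1]
      exact R.le_opNorm w
    calc n * β ≤ ‖g‖ ^ 2 := h3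
      _ ≤ (‖R‖ * ‖w‖) ^ 2 := pow_le_pow_left₀ (norm_nonneg _) h5 2
      _ = ‖R‖ ^ 2 * ‖w‖ ^ 2 := mul_pow _ _ _
      _ ≤ _ := by gcongr
  obtain ⟨n, hn⟩ := exists_nat_gt (max (1 / T) (‖R‖ ^ 2 * C / β))
  have hn1 : 1 < n * T := by
    have := (le_max_left _ _).trans_lt hn
    rwa [div_lt_iff₀ hT] at this
  have hn2 : ‖R‖ ^ 2 * C < n * β := by
    have := (le_max_right _ _).trans_lt hn
    rwa [div_lt_iff₀ hβ0] at this
  have h3 := key n hn1.le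
  have h4 : ‖R‖ ^ 2 * (C / (n * T)) ≤ ‖R‖ ^ 2 * C := by
    gcongr
    exact div_le_self hC0 hn1.le
  linarith

end GKdV

end

noncomputable section

namespace GKdV

/-! ### The Whitham system -/

/-- The real spectrum of `B⁻¹ A` and the roots of `det (A - z B)`. -/
theorem spectrum_real_iff_card_roots (U G : Matrix (Fin 3) (Fin 3) ℝ) (hG : G.det ≠ 0) :
    (∀ η ∈ spectrum ℂ ((G⁻¹ * U).map (algebraMap ℝ ℂ)), η.im = 0) ↔
      Multiset.card ((U.map (algebraMap ℝ (Polynomial ℝ)) -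
        (Polynomial.X : Polynomial ℝ) • G.map (algebraMap ℝ (Polynomial ℝ))).det).roots = 3 := by
  set A := G⁻¹ * U with hA
  have hGA : G * A = U := by
    rw [hA, ← mul_assoc, Matrix.mul_nonsing_inv _ (isUnit_iff_ne_zero.2 hG), one_mul]
  -- `det (U - X G) = det G · det (A - X)`, and negating a `3 × 3` matrix changes the sign of its
  -- determinant. So the characteristic equation has the roots of `A.charpoly`, and three real ones
  -- with multiplicity means that it splits over `ℝ`.
  have hdet : (U.map (algebraMap ℝ (Polynomial ℝ)) -
      (Polynomial.X : Polynomial ℝ) • G.map (algebraMap ℝ (Polynomial ℝ))).det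
        = Polynomial.C (-G.det) * A.charpoly := by
    have h1 : U.map (algebraMap ℝ (Polynomial ℝ)) -
        (Polynomial.X : Polynomial ℝ) • G.map (algebraMap ℝ (Polynomial ℝ))
        = G.map (algebraMap ℝ (Polynomial ℝ)) * -A.charmatrix := by
      rw [Matrix.charmatrix, neg_sub, mul_sub, ← hGA, Matrix.map_mul]
      congr 1
      rw [Matrix.scalar_apply, ← Matrix.smul_one_eq_diagonal, mul_smul_comm, mul_one]
    rw [h1, Matrix.det_mul, Matrix.det_neg, Matrix.charpoly]
    have h2 : (G.map (algebraMap ℝ (Polynomial ℝ))).det = Polynomial.C G.det :=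
      ((algebraMap ℝ (Polynomial ℝ)).map_det G).symm
    rw [h2]
    simp
    ring
  rw [hdet, Polynomial.roots_C_mul _ (neg_ne_zero.2 hG)]
  have hdeg : A.charpoly.natDegree = 3 := by simp [Matrix.charpoly_natDegree_eq_dim]
  have hmap : (A.map (algebraMap ℝ ℂ)).charpoly = A.charpoly.map (algebraMap ℝ ℂ) :=
    Matrix.charpoly_map A (algebraMap ℝ ℂ)
  have hsplit : Multiset.card A.charpoly.roots = 3 ↔ A.charpoly.Splits := by
    rw [Polynomial.splits_iff_card_roots, hdeg]
  rw [hsplit]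
  constructor
  · intro h
    refine Polynomial.Splits.of_splits_map (algebraMap ℝ ℂ) (IsAlgClosed.splits _) fun η hη => ?_
    rw [← hmap] at hη
    have := h η (Matrix.mem_spectrum_iff_isRoot_charpoly.2 (Polynomial.isRoot_of_mem_roots hη))
    exact ⟨η.re, Complex.ext rfl this.symm⟩
  · intro h η hη
    rw [Matrix.mem_spectrum_iff_isRoot_charpoly, hmap] at hη
    obtain ⟨r, rfl⟩ := h.mem_range_of_isRoot A.charpoly_monic.ne_zero hη
    exact Complex.ofReal_im r

theorem det_sub_smul_eq_zero (U G : Matrix (Fin 3) (Fin 3) ℝ) (hG : G.det ≠ 0) {η : ℂ}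
    (hη : η ∈ spectrum ℂ ((G⁻¹ * U).map (algebraMap ℝ ℂ))) :
    (U.map (algebraMap ℝ ℂ) - η • G.map (algebraMap ℝ ℂ)).det = 0 := by
  set A := G⁻¹ * U with hA
  have hGA : G * A = U := by
    rw [hA, ← mul_assoc, Matrix.mul_nonsing_inv _ (isUnit_iff_ne_zero.2 hG), one_mul]
  have h1 : U.map (algebraMap ℝ ℂ) - η • G.map (algebraMap ℝ ℂ)
      = G.map (algebraMap ℝ ℂ) * -(algebraMap ℂ _ η - A.map (algebraMap ℝ ℂ)) := by
    rw [neg_sub, mul_sub, ← hGA, Matrix.map_mul, Algebra.algebraMap_eq_smul_one, mul_smul_comm,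
      mul_one]
  have h2 : (algebraMap ℂ (Matrix (Fin 3) (Fin 3) ℂ) η - A.map (algebraMap ℝ ℂ)).det = 0 := by
    by_contra hne
    exact hη ((Matrix.isUnit_iff_isUnit_det _).2 (isUnit_iff_ne_zero.2 hne))
  rw [h1, Matrix.det_mul, Matrix.det_neg, h2, mul_zero, mul_zero]

theorem jacobian_apply {Φ : (Fin 3 → ℝ) → Fin 3 → ℝ} {w : Fin 3 → ℝ}
    {D : Fin 3 → (Fin 3 → ℝ) →L[ℝ] ℝ} (h : ∀ i, HasFDerivAt (fun w => Φ w i) (D i) w) (i j : Fin 3) :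
    jacobian Φ w i j = D i (Pi.single j 1) := by
  rw [jacobian, LinearMap.toMatrix'_apply, (hasFDerivAt_pi.2 h).fderiv]
  rfl

section

variable {f : ℝ → ℝ} {m a E c : ℝ}

/-- The derivatives of period, mass and momentum in the variables `(a, E, s)`. -/
theorem exists_hasFDerivAt_moments (hJ : DifferentiableAt ℝ (tmp f m) ![a, E, c]) :
    ∃ D : Fin 3 → (Fin 3 → ℝ) →L[ℝ] ℝ,
      HasFDerivAt (fun w : Fin 3 → ℝ => period f m (w 0) (w 1) (c - w 2)) (D 0) ![a, E, 0] ∧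
      HasFDerivAt (fun w : Fin 3 → ℝ => mass f m (w 0) (w 1) (c - w 2)) (D 1) ![a, E, 0] ∧
      HasFDerivAt (fun w : Fin 3 → ℝ => momentum f m (w 0) (w 1) (c - w 2)) (D 2) ![a, E, 0] ∧
      ∀ i, D i (Pi.single 0 1) = jacobian (tmp f m) ![a, E, c] i 0 ∧
        D i (Pi.single 1 1) = jacobian (tmp f m) ![a, E, c] i 1 ∧
        D i (Pi.single 2 1) = -jacobian (tmp f m) ![a, E, c] i 2 := by
  set L : (Fin 3 → ℝ) → Fin 3 → ℝ := fun w => ![w 0, w 1, c - w 2] with hL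
  set L' : (Fin 3 → ℝ) →L[ℝ] (Fin 3 → ℝ) := ContinuousLinearMap.pi
    ![ContinuousLinearMap.proj 0, ContinuousLinearMap.proj 1, -ContinuousLinearMap.proj 2] with hL'
  have hLd : HasFDerivAt L L' ![a, E, 0] := by
    rw [hasFDerivAt_pi']
    intro i
    fin_cases i
    · exact (ContinuousLinearMap.proj (R := ℝ) (φ := fun _ : Fin 3 => ℝ) 0).hasFDerivAt
    · exact (ContinuousLinearMap.proj (R := ℝ) (φ := fun _ : Fin 3 => ℝ) 1).hasFDerivAt
    · exact (ContinuousLinearMap.proj (R := ℝ) (φ := fun _ : Fin 3 => ℝ) 2).hasFDerivAt.const_sub c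
  have hL0 : L ![a, E, 0] = ![a, E, c] := by simp [hL]
  have hT : HasFDerivAt (tmp f m) (fderiv ℝ (tmp f m) ![a, E, c]) (L ![a, E, 0]) := by
    rw [hL0]; exact hJ.hasFDerivAt
  have hcomp := hT.comp ![a, E, 0] hLd
  have hi := hasFDerivAt_pi'.1 hcomp
  refine ⟨fun i => (ContinuousLinearMap.proj i : (Fin 3 → ℝ) →L[ℝ] ℝ) ∘L
    (fderiv ℝ (tmp f m) ![a, E, c] ∘L L'), hi 0, hi 1, hi 2, fun i => ⟨?_, ?_, ?_⟩⟩
  · have : L' (Pi.single 0 1) = Pi.single 0 1 := by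
      ext i; fin_cases i <;> simp [hL']
    simp [this, jacobian, LinearMap.toMatrix'_apply]
  · have : L' (Pi.single 1 1) = Pi.single 1 1 := by
      ext i; fin_cases i <;> simp [hL']
    simp [this, jacobian, LinearMap.toMatrix'_apply]
  · have : L' (Pi.single 2 1) = -Pi.single 2 1 := by
      ext i; fin_cases i <;> simp [hL']
    simp [this, jacobian, LinearMap.toMatrix'_apply]

/-- The linearization of the Whitham system at `s = 0`. -/
theorem whitham_jacobians (hJ : DifferentiableAt ℝ (tmp f m) ![a, E, c])
    (hT : period f m a E c ≠ 0) :
    DifferentiableAt ℝ (whithamDensity f m c) ![a, E, 0] ∧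
    DifferentiableAt ℝ (whithamFlux f m c) ![a, E, 0] ∧
    (jacobian (whithamFlux f m c) ![a, E, 0]).det = 2 * (period f m a E c)⁻¹ ∧
    (jacobian (whithamDensity f m c) ![a, E, 0]).det
      = (period f m a E c)⁻¹ ^ 4 * (jacobian (tmp f m) ![a, E, c]).det ∧
    ∀ η : ℂ, η ≠ 0 → ((jacobian (whithamDensity f m c) ![a, E, 0]).map (algebraMap ℝ ℂ)
        - η • (jacobian (whithamFlux f m c) ![a, E, 0]).map (algebraMap ℝ ℂ)).det
      = (period f m a E c : ℂ)⁻¹ * η ^ 3 *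
        modDet (jacobian (tmp f m) ![a, E, c]) (-1 / (η * (period f m a E c : ℂ))) := by
  obtain ⟨D, hD0, hD1, hD2, hDJ⟩ := exists_hasFDerivAt_moments hJ
  set J := jacobian (tmp f m) ![a, E, c]
  set T := period f m a E c with hTdef
  have hw : ∀ w : Fin 3 → ℝ, w = ![a, E, 0] → (period f m (w 0) (w 1) (c - w 2) = T ∧
      mass f m (w 0) (w 1) (c - w 2) = mass f m a E c ∧
      momentum f m (w 0) (w 1) (c - w 2) = momentum f m a E c) := by
    rintro w rfl
    simp [hTdef]
  obtain ⟨e0, e1, e2⟩ := hw _ rfl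
  set Mv := mass f m a E c
  set Pv := momentum f m a E c
  have hω : HasFDerivAt (waveNumber f m c) ((-(T ^ 2)⁻¹) • D 0) ![a, E, 0] := by
    have hinv : HasDerivAt (fun x : ℝ => x⁻¹) (-(T ^ 2)⁻¹)
        ((fun w : Fin 3 → ℝ => period f m (w 0) (w 1) (c - w 2)) ![a, E, 0]) := by
      simp only [e0]
      exact hasDerivAt_inv hT
    exact hinv.comp_hasFDerivAt (![a, E, 0] : Fin 3 → ℝ) hD0
  have eω : waveNumber f m c ![a, E, 0] = T⁻¹ := by rw [waveNumber, e0]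
  set p0 : (Fin 3 → ℝ) →L[ℝ] ℝ := ContinuousLinearMap.proj 0
  set p1 : (Fin 3 → ℝ) →L[ℝ] ℝ := ContinuousLinearMap.proj 1
  set p2 : (Fin 3 → ℝ) →L[ℝ] ℝ := ContinuousLinearMap.proj 2
  have hp0 : HasFDerivAt (fun w : Fin 3 → ℝ => w 0) p0 ![a, E, 0] := p0.hasFDerivAt
  have hp1 : HasFDerivAt (fun w : Fin 3 → ℝ => w 1) p1 ![a, E, 0] := p1.hasFDerivAt
  have hp2 : HasFDerivAt (fun w : Fin 3 → ℝ => w 2) p2 ![a, E, 0] := p2.hasFDerivAt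
  have hMω := hD1.mul hω
  have hPω := hD2.mul hω
  rw [e1, eω] at hMω
  rw [e2, eω] at hPω
  have hU : ∀ i, HasFDerivAt (fun w => whithamDensity f m c w i)
      ((![Mv • (-(T ^ 2)⁻¹) • D 0 + T⁻¹ • D 1, Pv • (-(T ^ 2)⁻¹) • D 0 + T⁻¹ • D 2,
        (-(T ^ 2)⁻¹) • D 0] : Fin 3 → (Fin 3 → ℝ) →L[ℝ] ℝ) i) ![a, E, 0] := by
    intro i
    fin_cases i
    exacts [hMω, hPω, hω]
  have hG : ∀ i, HasFDerivAt (fun w => whithamFlux f m c w i)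
      ((![p0 - (Mv * T⁻¹) • p2, -((Pv * T⁻¹) • p2) - (2 : ℝ) • p1, -(T⁻¹ • p2)] :
        Fin 3 → (Fin 3 → ℝ) →L[ℝ] ℝ) i) ![a, E, 0] := by
    have e3 : (![a, E, 0] : Fin 3 → ℝ) 2 = 0 := rfl
    -- At `s = 0` the derivative of `s` times a function is the value of that function times `ds`.
    have g0 := hp0.sub (hp2.mul hMω)
    have g1 := (hp2.mul hPω).neg.sub (hp1.const_mul 2)
    have g2 := (hp2.mul hω).neg
    simp only [Pi.mul_apply, e1, e2, eω] at g0 g1 g2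
    simp only [e3, zero_smul, zero_add] at g0 g1 g2
    intro i
    fin_cases i
    exacts [g0, g1, g2]
  have hUe := jacobian_apply hU
  have hGe := jacobian_apply hG
  have q0 := fun i => (hDJ i).1
  have q1 := fun i => (hDJ i).2.1
  have q2 := fun i => (hDJ i).2.2
  have hTc : (T : ℂ) ≠ 0 := by exact_mod_cast hT
  refine ⟨differentiableAt_pi.2 fun i => (hU i).differentiableAt,
    differentiableAt_pi.2 fun i => (hG i).differentiableAt, ?_, ?_, fun η hη => ?_⟩
  -- The flux Jacobian is upper triangular with diagonal `1, -2, -1/T`.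
  · simp only [Matrix.det_fin_three, hGe]
    simp [p0, p1, p2]
  · simp only [Matrix.det_fin_three, hUe]
    simp [q0, q1, q2]
    field_simp
    ring
  -- Subtracting `M` and `P` times the frequency row removes `M` and `P` from the pencil. With `ν =
  -- -1 / (η T)` its rows become `-η (ν dM + da)`, `-η (ν dP - 2 dE)` and `(η / T)(ν dT + ds)`,
  -- which are the rows of `modDet` up to a cyclic permutation.
  · simp only [Matrix.det_fin_three, Matrix.sub_apply, Matrix.smul_apply, Matrix.map_apply, hUe,
      hGe, modDet]
    simp [p0, p1, p2, q0, q1, q2]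
    field_simp
    ring

end

end GKdV

end

/-! ### Conclusion: from eigenvalues of the Whitham matrix to spectrum of the linearized operator.
-/

theorem corollary1
    (f : ℝ → ℝ) (hf : ContDiff ℝ 2 f)
    (a₀ E₀ c₀ um up m : ℝ) (hwell : GKdV.IsWell f a₀ E₀ c₀ um up) (hm : m ∈ Set.Ioo um up)
    (u : ℝ → ℝ) (hu : GKdV.IsProfile f a₀ E₀ c₀ um u)
    (hTMP : (GKdV.jacobian (GKdV.tmp f m) ![a₀, E₀, c₀]).det ≠ 0) :
    -- the matrix `A(a₀, E₀, 0)` is well defined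
    (DifferentiableAt ℝ (GKdV.whithamDensity f m c₀) ![a₀, E₀, 0] ∧
      DifferentiableAt ℝ (GKdV.whithamFlux f m c₀) ![a₀, E₀, 0] ∧
      IsUnit (GKdV.jacobian (GKdV.whithamFlux f m c₀) ![a₀, E₀, 0]).det) ∧
    -- spectral stability requires real spectrum of `A(a₀, E₀, 0)`
    (GKdV.IsSpectrallyStable f u c₀ →
      ∀ η ∈ spectrum ℂ ((GKdV.whithamMatrix f m c₀ ![a₀, E₀, 0]).map (algebraMap ℝ ℂ)),
        η.im = 0) ∧
    -- which is equivalent to hyperbolicity of the Whitham system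
    ((∀ η ∈ spectrum ℂ ((GKdV.whithamMatrix f m c₀ ![a₀, E₀, 0]).map (algebraMap ℝ ℂ)),
        η.im = 0) ↔
      GKdV.IsHyperbolicAt (GKdV.whithamDensity f m c₀) (GKdV.whithamFlux f m c₀)
        ![a₀, E₀, 0]) ∧
    -- a non-real eigenvalue gives a branch of spectrum off the imaginary axis
    (∀ η ∈ spectrum ℂ ((GKdV.whithamMatrix f m c₀ ![a₀, E₀, 0]).map (algebraMap ℝ ℂ)),
      η.im ≠ 0 →
      ∃ δ > 0, ∃ μ : ℝ → ℂ,
        ContinuousOn μ (Set.Ioo (-δ) δ) ∧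
        (∀ κ ∈ Set.Ioo (-δ) δ, μ κ ∈ GKdV.linSpectrum f u c₀ ∧
          ∃ v : ℝ → ℂ,
            GKdV.IsFloquetSolution f u c₀ (GKdV.period f m a₀ E₀ c₀) (μ κ) κ v) ∧
        (∀ κ ∈ Set.Ioo (-δ) δ, κ ≠ 0 → (μ κ).re ≠ 0) ∧
        (fun κ : ℝ => μ κ - (-(Complex.I * κ) / (η * (GKdV.period f m a₀ E₀ c₀ : ℂ))))
          =O[𝓝 0] (fun κ : ℝ => κ ^ 2)) := by
  obtain ⟨X, O⟩ := hu.exists_isOrbit hf hwell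
  have hX := O.pos
  have hperiod : GKdV.period f m a₀ E₀ c₀ = 2 * X := by
    rw [GKdV.period, O.moment_eq hwell hm 0]
    simp [hX.le]
  have hdiff : DifferentiableAt ℝ (GKdV.tmp f m) ![a₀, E₀, c₀] := by
    by_contra hcon
    apply hTMP
    rw [GKdV.jacobian, fderiv_zero_of_not_differentiableAt hcon]
    simp
  have hT : GKdV.period f m a₀ E₀ c₀ ≠ 0 := by rw [hperiod]; positivity
  obtain ⟨hUd, hGd, hGdet, hUdet, hpencil⟩ := GKdV.whitham_jacobians hdiff hT
  have hG : (GKdV.jacobian (GKdV.whithamFlux f m c₀) ![a₀, E₀, 0]).det ≠ 0 := by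
    rw [hGdet]
    exact mul_ne_zero two_ne_zero (inv_ne_zero hT)
  have hU : (GKdV.jacobian (GKdV.whithamDensity f m c₀) ![a₀, E₀, 0]).det ≠ 0 := by
    rw [hUdet]
    exact mul_ne_zero (pow_ne_zero 4 (inv_ne_zero hT)) hTMP
  have hbranch : ∀ η ∈ spectrum ℂ
      ((GKdV.whithamMatrix f m c₀ ![a₀, E₀, 0]).map (algebraMap ℝ ℂ)), η.im ≠ 0 →
      ∃ δ > 0, ∃ μ : ℝ → ℂ,
        ContinuousOn μ (Set.Ioo (-δ) δ) ∧
        (∀ κ ∈ Set.Ioo (-δ) δ, μ κ ∈ GKdV.linSpectrum f u c₀ ∧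
          ∃ v : ℝ → ℂ,
            GKdV.IsFloquetSolution f u c₀ (GKdV.period f m a₀ E₀ c₀) (μ κ) κ v) ∧
        (∀ κ ∈ Set.Ioo (-δ) δ, κ ≠ 0 → (μ κ).re ≠ 0) ∧
        (fun κ : ℝ => μ κ - (-(Complex.I * κ) / (η * (GKdV.period f m a₀ E₀ c₀ : ℂ))))
          =O[𝓝 0] (fun κ : ℝ => κ ^ 2) := by
    intro η hη him
    have hη0 : η ≠ 0 := fun h => him (by simp [h])
    have hTc : (GKdV.period f m a₀ E₀ c₀ : ℂ) ≠ 0 := by exact_mod_cast hT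
    -- `ν₀ = -1 / (η T)` is the value for which `iκ ν₀` is the asserted leading term.
    have hroot : GKdV.modDet (GKdV.jacobian (GKdV.tmp f m) ![a₀, E₀, c₀])
        (-1 / (η * (GKdV.period f m a₀ E₀ c₀ : ℂ))) = 0 := by
      have h := GKdV.det_sub_smul_eq_zero _ _ hG hη
      rw [hpencil η hη0] at h
      exact (mul_eq_zero.1 h).resolve_left
        (mul_ne_zero (inv_ne_zero hTc) (pow_ne_zero 3 hη0))
    have hν : (-1 / (η * (GKdV.period f m a₀ E₀ c₀ : ℂ))).im ≠ 0 := by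
      have hn : Complex.normSq η ≠ 0 := fun h => hη0 (Complex.normSq_eq_zero.1 h)
      rw [show -1 / (η * (GKdV.period f m a₀ E₀ c₀ : ℂ))
        = ((-(GKdV.period f m a₀ E₀ c₀)⁻¹ : ℝ) : ℂ) * η⁻¹ by push_cast; field_simp,
        Complex.im_ofReal_mul, Complex.inv_im]
      exact mul_ne_zero (neg_ne_zero.2 (inv_ne_zero hT)) (div_ne_zero (neg_ne_zero.2 him) hn)
    obtain ⟨μ, hμO, hμ⟩ := O.exists_branch hf hwell hm hTMP hν hroot
    obtain ⟨δ, hδ, hball⟩ := Metric.eventually_nhds_iff_ball.1 hμ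
    rw [Real.ball_eq_Ioo, zero_sub, zero_add] at hball
    have hk : ContDiff ℝ 1 fun x => deriv f (u x) := by
      simpa using (contDiff_const (c := c₀)).sub (O.continuous_coeff hf)
    refine ⟨δ, hδ, μ, fun κ hκ => (hball κ hκ).1.continuousWithinAt, fun κ hκ => ?_,
      fun κ hκ => (hball κ hκ).2.2, ?_⟩
    · obtain ⟨v, hv⟩ := (hball κ hκ).2.1
      exact ⟨hv.mem_linSpectrum (by positivity) hk O.periodic, v, by rwa [hperiod]⟩
    · convert hμO using 3 with κ
      ring
  refine ⟨⟨hUd, hGd, isUnit_iff_ne_zero.2 hG⟩, fun hstab η hη => ?_, ?_, hbranch⟩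
  · by_contra him
    obtain ⟨δ, hδ, μ, -, hspec, hre, -⟩ := hbranch η hη him
    have hmem : δ / 2 ∈ Set.Ioo (-δ) δ := ⟨by linarith, by linarith⟩
    exact hre _ hmem (by positivity) (hstab _ (hspec _ hmem).1)
  · rw [GKdV.whithamMatrix, GKdV.spectrum_real_iff_card_roots _ _ hG]
    exact ⟨fun h => ⟨hU, h⟩, fun h => h.2⟩
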